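/- Let $k$ be an algebraically closed field and $n\ge 1$. Let $\Gamma_n$ be the following $k$-algebra: $\Gamma_1=k[x]/(x^2)$; for $n\ge 2$, $\Gamma_n$ is the path algebra (paths written from left to right) of the quiver with vertices $1,\dots,n$ and arrows $\alpha_i:i\to i+1$ $(1\le i\le n-1)$ and $\beta_i:i\to i-1$ $(2\le i\le n)$, modulo the ideal generated by $\alpha_1\beta_2\alpha_1$ and $\beta_2\alpha_1\beta_2$ if $n=2$, and by $\alpha_{i-1}\alpha_i$, $\beta_{i+1}\beta_i$ and $\alpha_i\beta_{i+1}-\beta_i\alpha_{i-1}$ for $2\le i\le n-1$ if $n\ge3$. Write $A=\Gamma_n$, let $e_i$ be the idempotent of the vertex $i$, and put $P_i=Ae_i$, $P_i^\vee=\operatorname{Hom}_A(P_i,A)\cong e_iA$ and $P_{i,j}=P_i\otimes_kP_j^\vee$, an $A$-$A$-bimodule. Let $D^b(A)$ be the bounded derived category of finitely generated left $A$-modules. For $1\le i\le n$ let $X_i$ be the complex of bimodules $P_{i,i}\xrightarrow{\mathrm{ev}}A$, $\mathrm{ev}(p\otimes f)=f(p)$, concentrated in homological degrees $1$ and $0$,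 that is, the cone of $\mathrm{ev}$, and let $F_i=X_i\otimes_A-:D^b(A)\to D^b(A)$ be the corresponding spherical twist. For $1\le m\le n$ let $G_m$ be the complex of $A$-$A$-bimodules which in homological degree $i$, $0\le i\le m-1$, is $$G_{m,i}=\bigoplus_{j=1}^{m-i}P_{i+j,j},$$ and is zero in all other degrees, and whose differential $G_{m,i}\to G_{m,i-1}$ for $1\le i\le m-1$ is given on the summand $P_{i+j,j}\cong Ae_{i+j}\otimes_ke_jA$ by $$x\otimes y\longmapsto x\beta_{i+j}\otimes y+(-1)^i\,x\otimes\beta_{j+1}y\ \in\ P_{i+j-1,j}\oplus P_{i+j,j+1}.$$ The evaluation maps give a map of complexes $\mathrm{ev}:G_m\to A$, where $A$ is in degree $0$ and $\mathrm{ev}$ is given on $G_{m,0}=\bigoplus_{j=1}^mP_{j,j}$ by $p\otimes f\mapsto f(p)$. Let $H_m=\operatorname{cone}(G_m\xrightarrow{\mathrm{ev}}A)$. Then the functors $X_i\otimes_A-$ $(1\le i\le n)$ and $H_m\otimes_A-$ on bounded complexes of finitely generated left $A$-modules take values in such complexes and preserve quasi-isomorphisms, so that they induce endofunctors of $D^b(A)$,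 and there is a natural isomorphism of functors $D^b(A)\to D^b(A)$ $$F_mF_{m-1}\cdots F_2F_1\;\cong\;H_m\otimes_A-\,,$$ where $F_1$ is applied first. -/

import Mathlib

open CategoryTheory CategoryTheory.Limits TensorProduct MulOpposite

universe u

noncomputable section

namespace SphericalTwist

/-! ## The algebras `Γ_n` -/

/-- Symbols for the trivial paths `e_i`, the arrows `α_i : i → i+1` and `β_i : i → i-1`, and the
variable `x` of `Γ_1 = k[x]/(x²)`. Symbols whose index is out of range are set to zero below. -/
inductive Gen : Type
  | e (i : ℕ)
  | a (i : ℕ)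
  | b (i : ℕ)
  | x

section Gamma

variable (k : Type u) [Field k] (n : ℕ)

/-- `e_i` in the free algebra. -/
abbrev fe (i : ℕ) : FreeAlgebra k Gen := FreeAlgebra.ι k (Gen.e i)
/-- `α_i` in the free algebra. -/
abbrev fa (i : ℕ) : FreeAlgebra k Gen := FreeAlgebra.ι k (Gen.a i)
/-- `β_i` in the free algebra. -/
abbrev fb (i : ℕ) : FreeAlgebra k Gen := FreeAlgebra.ι k (Gen.b i)
/-- `x` in the free algebra. -/
abbrev fx : FreeAlgebra k Gen := FreeAlgebra.ι k Gen.x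

/-- The relations of `Γ_n`. A path is written from left to right, so an arrow `a : s → t`
satisfies `e_s a = a = a e_t`. -/
inductive Rel : FreeAlgebra k Gen → FreeAlgebra k Gen → Prop
  -- the symbols that occur are `e_1, …, e_n`, `α_1, …, α_{n-1}`, `β_2, …, β_n`,
  -- and `x` if `n = 1`
  | e_range (i : ℕ) : ¬ (1 ≤ i ∧ i ≤ n) → Rel (fe k i) 0
  | a_range (i : ℕ) : ¬ (1 ≤ i ∧ i + 1 ≤ n) → Rel (fa k i) 0
  | b_range (i : ℕ) : ¬ (2 ≤ i ∧ i ≤ n) → Rel (fb k i) 0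
  | x_range : n ≠ 1 → Rel (fx k) 0
  -- the path algebra of the quiver
  | e_sum : Rel (∑ i ∈ Finset.Icc 1 n, fe k i) 1
  | e_mul_self (i : ℕ) : Rel (fe k i * fe k i) (fe k i)
  | e_mul_e (i j : ℕ) : i ≠ j → Rel (fe k i * fe k j) 0
  | e_mul_a (i : ℕ) : Rel (fe k i * fa k i) (fa k i)
  | a_mul_e (i : ℕ) : Rel (fa k i * fe k (i + 1)) (fa k i)
  | e_mul_b (i : ℕ) : Rel (fe k (i + 1) * fb k (i + 1)) (fb k (i + 1))
  | b_mul_e (i : ℕ) : Rel (fb k (i + 1) * fe k i) (fb k (i + 1))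
  -- the ideal for `n = 1`
  | x_sq : Rel (fx k * fx k) 0
  -- the ideal for `n = 2`
  | aba : n = 2 → Rel (fa k 1 * fb k 2 * fa k 1) 0
  | bab : n = 2 → Rel (fb k 2 * fa k 1 * fb k 2) 0
  -- the ideal for `n ≥ 3`
  | aa (i : ℕ) : 2 ≤ i → i + 1 ≤ n → Rel (fa k (i - 1) * fa k i) 0
  | bb (i : ℕ) : 2 ≤ i → i + 1 ≤ n → Rel (fb k (i + 1) * fb k i) 0
  | ab (i : ℕ) : 2 ≤ i → i + 1 ≤ n → Rel (fa k i * fb k (i + 1)) (fb k i * fa k (i - 1))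

/-- The algebra `Γ_n`: the path algebra of the double of a line with `n` vertices modulo the
relations `α_{i-1} α_i = 0`, `β_{i+1} β_i = 0`, `α_i β_{i+1} = β_i α_{i-1}` for `2 ≤ i ≤ n - 1`
(for `n = 2`: `αβα = βαβ = 0`; for `n = 1`: `k[x]/(x²)`). -/
def Gam : Type u := RingQuot (Rel k n)

instance : Ring (Gam k n) := inferInstanceAs (Ring (RingQuot (Rel k n)))
instance : Algebra k (Gam k n) := inferInstanceAs (Algebra k (RingQuot (Rel k n)))

/-- The quotient map from the free algebra. -/
def Gam.mk : FreeAlgebra k Gen →ₐ[k] Gam k n := RingQuot.mkAlgHom k (Rel k n)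

/-- The idempotent `e_i` of `Γ_n`, for `1 ≤ i ≤ n` (and `0` otherwise). -/
def e (i : ℕ) : Gam k n := Gam.mk k n (fe k i)
/-- The arrow `β_i : i → i - 1` of `Γ_n`, for `2 ≤ i ≤ n` (and `0` otherwise). -/
def b (i : ℕ) : Gam k n := Gam.mk k n (fb k i)

lemma mk_rel {s t : FreeAlgebra k Gen} (h : Rel k n s t) : Gam.mk k n s = Gam.mk k n t :=
  RingQuot.mkAlgHom_rel k h

lemma b_mul_e (i : ℕ) : b k n (i + 1) * e k n i = b k n (i + 1) := by
  simpa [b, e] using mk_rel k n (Rel.b_mul_e (n := n) i)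

lemma b_mul_b (i : ℕ) : b k n (i + 1) * b k n i = 0 := by
  by_cases h1 : 2 ≤ i
  · by_cases h2 : i + 1 ≤ n
    · simpa [b] using mk_rel k n (Rel.bb (k := k) i h1 h2)
    · have : b k n (i + 1) = 0 := by
        simpa [b] using mk_rel k n (Rel.b_range (k := k) (n := n) (i + 1) (by omega))
      rw [this, zero_mul]
  · have : b k n i = 0 := by
      simpa [b] using mk_rel k n (Rel.b_range (k := k) (n := n) i (by omega))
    rw [this, mul_zero]

end Gamma

/-! ## Bimodules and tensor products over a noncommutative algebra -/

section Bimodules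

variable (k : Type u) [Field k] (A : Type u) [Ring A] [Algebra k A]

/-- `A`-`A`-bimodules are modules over `A ⊗_k A^op`. -/
abbrev Bimod := ModuleCat.{u} (A ⊗[k] Aᵐᵒᵖ)

variable {k A}

/-- The left module underlying a bimodule. -/
abbrev leftMod (M : Bimod k A) : ModuleCat.{u} A :=
  (ModuleCat.restrictScalars
    (Algebra.TensorProduct.includeLeft : A →ₐ[k] A ⊗[k] Aᵐᵒᵖ).toRingHom).obj M

/-- The right action of `a : A` on an element `m` of a bimodule: `m ↦ m a`. -/
def rightAct {M : Bimod k A} (m : M) (a : A) : M :=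
  ((1 : A) ⊗ₜ[k] op a : A ⊗[k] Aᵐᵒᵖ) • m

/-- The submodule of `M ⊗_ℤ N` generated by the elements `m a ⊗ n - m ⊗ a n`. -/
def balanced (M : Bimod k A) (N : ModuleCat.{u} A) : Submodule A (leftMod M ⊗[ℤ] N) :=
  Submodule.span A
    {t | ∃ (m : M) (a : A) (y : N),
      t = (show leftMod M from rightAct m a) ⊗ₜ[ℤ] y - (show leftMod M from m) ⊗ₜ[ℤ] (a • y)}

/-- The left `A`-module `M ⊗_A N`, for a bimodule `M` and a left module `N`. -/
def tensorObj (M : Bimod k A) (N : ModuleCat.{u} A) : ModuleCat.{u} A :=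
  ModuleCat.of A ((leftMod M ⊗[ℤ] N) ⧸ balanced M N)

/-- The map `f ⊗ g : M ⊗_ℤ N → M' ⊗_ℤ N'`. -/
def preTensorMap {M M' : Bimod k A} {N N' : ModuleCat.{u} A} (f : M ⟶ M') (g : N ⟶ N') :
    (leftMod M ⊗[ℤ] N) →ₗ[A] (leftMod M' ⊗[ℤ] N') :=
  TensorProduct.AlgebraTensorModule.map
    ((ModuleCat.restrictScalars
      (Algebra.TensorProduct.includeLeft : A →ₐ[k] A ⊗[k] Aᵐᵒᵖ).toRingHom).map f).hom
    (g.hom.restrictScalars ℤ)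

lemma preTensorMap_mem {M M' : Bimod k A} {N N' : ModuleCat.{u} A} (f : M ⟶ M') (g : N ⟶ N') :
    balanced M N ≤ (balanced M' N').comap (preTensorMap f g) := by
  refine Submodule.span_le.2 ?_
  rintro _ ⟨m, a, y, rfl⟩
  refine Submodule.subset_span ⟨f.hom m, a, g.hom y, ?_⟩
  have h1 : f.hom (rightAct m a) = rightAct (f.hom m) a := f.hom.map_smul _ _
  have h2 : g.hom (a • y) = a • g.hom y := g.hom.map_smul _ _
  rw [← h1, ← h2, map_sub]
  rfl

/-- The map `f ⊗ g : M ⊗_A N → M' ⊗_A N'`. -/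
def tensorMap {M M' : Bimod k A} {N N' : ModuleCat.{u} A} (f : M ⟶ M') (g : N ⟶ N') :
    tensorObj M N ⟶ tensorObj M' N' :=
  ModuleCat.ofHom (Submodule.mapQ _ _ (preTensorMap f g) (preTensorMap_mem f g))

lemma tensorObj_hom_ext {M : Bimod k A} {N L : ModuleCat.{u} A} {f g : tensorObj M N ⟶ L}
    (h : ∀ (m : M) (y : N),
      f.hom (Submodule.Quotient.mk ((show leftMod M from m) ⊗ₜ[ℤ] y)) =
        g.hom (Submodule.Quotient.mk ((show leftMod M from m) ⊗ₜ[ℤ] y))) : f = g := by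
  refine ModuleCat.hom_ext (Submodule.linearMap_qext _ ?_)
  refine TensorProduct.AlgebraTensorModule.ext ?_
  intro m y
  exact h m y

variable (k A)

/-- The bifunctor `(M, N) ↦ M ⊗_A N`. -/
def tensorBifunctor : Bimod k A ⥤ ModuleCat.{u} A ⥤ ModuleCat.{u} A where
  obj M :=
    { obj N := tensorObj M N
      map g := tensorMap (𝟙 M) g
      map_id N := tensorObj_hom_ext fun _ _ => rfl
      map_comp g g' := tensorObj_hom_ext fun _ _ => rfl }
  map f :=
    { app N := tensorMap f (𝟙 N)
      naturality N N' g := tensorObj_hom_ext fun _ _ => rfl }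
  map_id M := by
    ext N : 2
    exact tensorObj_hom_ext fun _ _ => rfl
  map_comp f f' := by
    ext N : 2
    exact tensorObj_hom_ext fun _ _ => rfl

instance : (tensorBifunctor k A).PreservesZeroMorphisms where
  map_zero M M' := by
    ext N : 2
    refine tensorObj_hom_ext fun m y => ?_
    exact congrArg (Submodule.Quotient.mk (p := balanced M' N))
      (TensorProduct.zero_tmul (leftMod M') y)

instance (M : Bimod k A) : ((tensorBifunctor k A).obj M).PreservesZeroMorphisms where
  map_zero N N' := by
    refine tensorObj_hom_ext fun m y => ?_
    exact congrArg (Submodule.Quotient.mk (p := balanced M N'))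
      (TensorProduct.tmul_zero N' (show leftMod M from m))

variable {k A}

/-- The functor `X ⊗_A -` on complexes of left modules, for a complex `X` of bimodules: the total
complex of the `X^p ⊗_A Y^q`, with the differential `d x ⊗ y + (-1)^p x ⊗ d y`. -/
def tensorComplex (X : CochainComplex (Bimod k A) ℤ) :
    CochainComplex (ModuleCat.{u} A) ℤ ⥤ CochainComplex (ModuleCat.{u} A) ℤ :=
  (tensorBifunctor k A).map₂CochainComplex.obj X

/-! ## The bounded derived category -/

variable (A)

/-- Bounded complexes of finitely generated left modules. -/
def isBoundedFG : ObjectProperty (CochainComplex (ModuleCat.{u} A) ℤ) := fun Y =>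
  (∃ p q : ℤ, Y.IsStrictlyGE p ∧ Y.IsStrictlyLE q) ∧ ∀ i : ℤ, Module.Finite A (Y.X i)

/-- The category `Ch^b(A)` of bounded complexes of finitely generated left `A`-modules. -/
abbrev Chb := (isBoundedFG A).FullSubcategory

/-- The quasi-isomorphisms in `Ch^b(A)`. -/
def qisChb : MorphismProperty (Chb A) :=
  (HomologicalComplex.quasiIso (ModuleCat.{u} A) (ComplexShape.up ℤ)).inverseImage
    (isBoundedFG A).ι

/-- The bounded derived category `D^b(A)` of finitely generated left `A`-modules. -/
abbrev Db := (qisChb A).Localization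

variable {A}

/-- `X ⊗_A -` induces a functor on `D^b(A)`: it preserves bounded complexes of finitely generated
modules, and quasi-isomorphisms between them. -/
structure Induces (X : CochainComplex (Bimod k A) ℤ) : Prop where
  bounded (Y : CochainComplex (ModuleCat.{u} A) ℤ) :
    isBoundedFG A Y → isBoundedFG A ((tensorComplex X).obj Y)
  qis {Y Z : Chb A} (f : Y ⟶ Z) : qisChb A f → QuasiIso ((tensorComplex X).map f.hom)

/-- The functor `X ⊗_A -` on `Ch^b(A)`. -/
def tensorChb (X : CochainComplex (Bimod k A) ℤ) (h : Induces X) : Chb A ⥤ Chb A :=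
  (isBoundedFG A).lift ((isBoundedFG A).ι ⋙ tensorComplex X) fun Y => h.bounded _ Y.property

lemma tensorChb_inverts (X : CochainComplex (Bimod k A) ℤ) (h : Induces X) :
    (qisChb A).IsInvertedBy (tensorChb X h ⋙ (qisChb A).Q) :=
  fun _ _ f hf => Localization.inverts (qisChb A).Q (qisChb A) _ (h.qis f hf)

/-- The functor `X ⊗_A - : D^b(A) ⥤ D^b(A)` given by tensoring with a complex `X` of bimodules:
the functor that the universal property of the localization assigns to `X ⊗_A -` on `Ch^b(A)`. -/
def tensorDb (X : CochainComplex (Bimod k A) ℤ) (h : Induces X) : Db A ⥤ Db A :=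
  Localization.lift (tensorChb X h ⋙ (qisChb A).Q) (tensorChb_inverts X h) (qisChb A).Q

end Bimodules

/-! ## The bimodules `P_{i,j} = P_i ⊗_k P_j^∨` -/

section Projectives

variable (k : Type u) [Field k] (n : ℕ)

/-- The projective left module `P_i = Γ_n e_i`. -/
abbrev P (i : ℕ) : Submodule (Gam k n) (Gam k n) := Submodule.span (Gam k n) {e k n i}

/-- The right module `P_i^∨ = Hom(P_i, Γ_n)`, with `(f a)(p) = f(p) a`. -/
abbrev PDual (i : ℕ) : Type u := P k n i →ₗ[Gam k n] Gam k n

/-- The bimodule `P_{i,j} = P_i ⊗_k P_j^∨`. -/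
def PP (i j : ℕ) : Type u := P k n i ⊗[k] PDual k n j

instance (i j : ℕ) : AddCommGroup (PP k n i j) :=
  inferInstanceAs (AddCommGroup (P k n i ⊗[k] PDual k n j))

/-- `a ⊗ b` acts on `p ⊗ f` as `a p ⊗ f b`. -/
def PP.action (i j : ℕ) :
    (Gam k n ⊗[k] (Gam k n)ᵐᵒᵖ) →ₐ[k] Module.End k (P k n i ⊗[k] PDual k n j) :=
  (Module.endTensorEndAlgHom (R := k) (S := k) (A := k)).comp
    (Algebra.TensorProduct.map (Algebra.lsmul k k (P k n i)) (Algebra.lsmul k k (PDual k n j)))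

instance (i j : ℕ) : Module (Gam k n ⊗[k] (Gam k n)ᵐᵒᵖ) (PP k n i j) :=
  Module.compHom (P k n i ⊗[k] PDual k n j) (PP.action k n i j).toRingHom

variable {k n} in
/-- The element `p ⊗ f` of `P_{i,j}`. -/
def PP.tmul {i j : ℕ} (p : P k n i) (f : PDual k n j) : PP k n i j := p ⊗ₜ[k] f

variable {k n} in
lemma PP.smul_tmul {i j : ℕ} (a : Gam k n) (c : (Gam k n)ᵐᵒᵖ) (p : P k n i) (f : PDual k n j) :
    (a ⊗ₜ[k] c : Gam k n ⊗[k] (Gam k n)ᵐᵒᵖ) • PP.tmul p f = PP.tmul (a • p) (c • f) := rfl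

variable {k n} in
lemma PP.induction {i j : ℕ} {motive : PP k n i j → Prop} (t : PP k n i j) (zero : motive 0)
    (tmul : ∀ p f, motive (PP.tmul p f)) (add : ∀ s t, motive s → motive t → motive (s + t)) :
    motive t :=
  TensorProduct.induction_on (motive := motive) t zero tmul add

variable {k n} in
/-- An additive map on `P_{i,j}` that respects the actions of the `a ⊗ b` on the `p ⊗ f` is a
bimodule map. -/
def PP.lift {i j : ℕ} {M : Type u} [AddCommGroup M] [Module (Gam k n ⊗[k] (Gam k n)ᵐᵒᵖ) M]
    (φ : PP k n i j →+ M)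
    (h : ∀ (a : Gam k n) (c : (Gam k n)ᵐᵒᵖ) (p : P k n i) (f : PDual k n j),
      φ (PP.tmul (a • p) (c • f)) =
        (a ⊗ₜ[k] c : Gam k n ⊗[k] (Gam k n)ᵐᵒᵖ) • φ (PP.tmul p f)) :
    PP k n i j →ₗ[Gam k n ⊗[k] (Gam k n)ᵐᵒᵖ] M where
  toFun := φ
  map_add' := φ.map_add
  map_smul' s t := by
    dsimp only [RingHom.id_apply]
    induction s with
    | zero =>
      exact ((congrArg φ (zero_smul (Gam k n ⊗[k] (Gam k n)ᵐᵒᵖ) t)).trans φ.map_zero).trans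
        (zero_smul (Gam k n ⊗[k] (Gam k n)ᵐᵒᵖ) (φ t)).symm
    | add s s' hs hs' => rw [add_smul, map_add, hs, hs', ← add_smul]
    | tmul a c =>
      induction t using PP.induction with
      | zero => rw [map_zero, smul_zero, smul_zero, map_zero]
      | add t t' ht ht' => rw [smul_add, map_add, ht, ht', map_add, smul_add]
      | tmul p f => rw [PP.smul_tmul, h]

variable {k n} in
/-- The bimodule map `f ⊗ g : P_{i,j} → P_{i',j'}`, `p ⊗ q ↦ f(p) ⊗ g(q)`. -/
def PP.map {i j i' j' : ℕ} (f : P k n i →ₗ[Gam k n] P k n i')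
    (g : PDual k n j →ₗ[(Gam k n)ᵐᵒᵖ] PDual k n j') :
    PP k n i j →ₗ[Gam k n ⊗[k] (Gam k n)ᵐᵒᵖ] PP k n i' j' :=
  PP.lift (TensorProduct.map (f.restrictScalars k) (g.restrictScalars k)).toAddMonoidHom
    fun a c p q => by
      change PP.tmul (f (a • p)) (g (c • q)) = PP.tmul (a • f p) (c • g q)
      rw [map_smul, map_smul]

variable {k n} in
lemma PP.map_tmul {i j i' j' : ℕ} (f : P k n i →ₗ[Gam k n] P k n i')
    (g : PDual k n j →ₗ[(Gam k n)ᵐᵒᵖ] PDual k n j') (p : P k n i) (q : PDual k n j) :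
    PP.map f g (PP.tmul p q) = PP.tmul (f p) (g q) := rfl

variable {k n} in
lemma PP.hom_ext {i j : ℕ} {M : Type u} [AddCommGroup M]
    [Module (Gam k n ⊗[k] (Gam k n)ᵐᵒᵖ) M]
    {φ ψ : PP k n i j →ₗ[Gam k n ⊗[k] (Gam k n)ᵐᵒᵖ] M}
    (h : ∀ p f, φ (PP.tmul p f) = ψ (PP.tmul p f)) : φ = ψ := by
  refine LinearMap.ext fun t => ?_
  induction t using PP.induction with
  | zero => rw [map_zero, map_zero]
  | add t t' ht ht' => rw [map_add, map_add, ht, ht']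
  | tmul p f => exact h p f

/-- Right multiplication by `β_{i+1}`, as a map `P_{i+1} → P_i`. -/
def rmulB (i : ℕ) : P k n (i + 1) →ₗ[Gam k n] P k n i :=
  (LinearMap.toSpanSingleton (Gam k n) (Gam k n) (b k n (i + 1))).restrict fun x _ =>
    Submodule.mem_span_singleton.2 ⟨x * b k n (i + 1), by
      rw [LinearMap.toSpanSingleton_apply, smul_eq_mul, smul_eq_mul, mul_assoc, b_mul_e]⟩

lemma coe_rmulB (i : ℕ) (p : P k n (i + 1)) :
    (rmulB k n i p : Gam k n) = (p : Gam k n) * b k n (i + 1) := rfl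

/-- The map `P_j^∨ → P_{j+1}^∨` dual to right multiplication by `β_{j+1}`. Under the isomorphism
`P_j^∨ ≅ e_j Γ_n`, `f ↦ f(e_j)`, it is left multiplication by `β_{j+1}`. -/
def lmulB (j : ℕ) : PDual k n j →ₗ[(Gam k n)ᵐᵒᵖ] PDual k n (j + 1) where
  toFun f := f ∘ₗ rmulB k n j
  map_add' _ _ := rfl
  map_smul' _ _ := rfl

lemma rmulB_rmulB (i : ℕ) : rmulB k n i ∘ₗ rmulB k n (i + 1) = 0 := by
  ext p
  change (p : Gam k n) * b k n (i + 1 + 1) * b k n (i + 1) = 0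
  rw [mul_assoc, b_mul_b, mul_zero]

lemma lmulB_lmulB (j : ℕ) : lmulB k n (j + 1) ∘ₗ lmulB k n j = 0 := by
  refine LinearMap.ext fun f => ?_
  change f ∘ₗ (rmulB k n j ∘ₗ rmulB k n (j + 1)) = 0
  rw [rmulB_rmulB, LinearMap.comp_zero]

/-- `Γ_n` as a bimodule over itself: `a ⊗ b` acts by `x ↦ a x b`. -/
def GamBi : Type u := Gam k n

instance : AddCommGroup (GamBi k n) := inferInstanceAs (AddCommGroup (Gam k n))
instance : Module (Gam k n ⊗[k] (Gam k n)ᵐᵒᵖ) (GamBi k n) :=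
  instModuleTensorProductMop k (Gam k n)

/-- The evaluation map `P_{i,i} = P_i ⊗_k P_i^∨ → Γ_n`, `p ⊗ f ↦ f(p)`. -/
def ev (i : ℕ) : PP k n i i →ₗ[Gam k n ⊗[k] (Gam k n)ᵐᵒᵖ] GamBi k n :=
  PP.lift (M := GamBi k n)
    (TensorProduct.lift
      (LinearMap.mk₂ k (fun (p : P k n i) (f : PDual k n i) => f p)
        (fun _ _ f => f.map_add _ _) (fun c p f => f.map_smul_of_tower c p)
        (fun _ _ _ => rfl) (fun _ _ _ => rfl))).toAddMonoidHom
    fun a c p f => by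
      change f (a • p) * c.unop = a * (f p * c.unop)
      rw [map_smul, smul_eq_mul, mul_assoc]

lemma ev_tmul (i : ℕ) (p : P k n i) (f : PDual k n i) :
    ev k n i (PP.tmul p f) = (show GamBi k n from f p) := rfl

end Projectives

/-! ## The complexes `X_i`, `G_m` and `H_m` -/

section Complexes

variable (k : Type u) [Field k] (n m : ℕ)

/-- The index set of the summands `P_{i,j}` of `G_m` in cohomological degree `p`, that is, in
homological degree `-p`: the pairs `(i, j)` with `1 ≤ j ≤ i ≤ m` and `i - j = -p`. -/
def IsIdx (p : ℤ) (s : ℕ × ℕ) : Prop :=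
  1 ≤ s.2 ∧ s.2 ≤ s.1 ∧ s.1 ≤ m ∧ (s.1 : ℤ) - s.2 = -p

/-- The component of `G_m` in cohomological degree `p`; for `p = -i`, it is
`G_{m,i} = ⊕_{j=1}^{m-i} P_{i+j,j}`. -/
abbrev GX (p : ℤ) : Type u :=
  DirectSum {s : ℕ × ℕ // IsIdx m p s} fun s => PP k n s.1.1 s.1.2

open scoped Classical in
/-- The inclusion of the summand `P_{i,j}` into the degree `p` component of `G_m`, or zero if
`P_{i,j}` is not one of its summands. -/
def GX.incl (p : ℤ) (i j : ℕ) :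
    PP k n i j →ₗ[Gam k n ⊗[k] (Gam k n)ᵐᵒᵖ] GX k n m p :=
  if h : IsIdx m p (i, j) then
    DirectSum.lof _ {s : ℕ × ℕ // IsIdx m p s} (fun s => PP k n s.1.1 s.1.2) ⟨(i, j), h⟩
  else 0

/-- The differential of `G_m` from degree `p` to degree `q`, on the summand `P_{i,j}`:
`x ⊗ y ↦ x β_i ⊗ y + (-1)^p x ⊗ β_{j+1} y`, the first term lying in `P_{i-1,j}` and the second
one in `P_{i,j+1}`, where a term is dropped if this is not a summand in degree `q`. -/
def GX.dComp (p q : ℤ) :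
    (i j : ℕ) → PP k n i j →ₗ[Gam k n ⊗[k] (Gam k n)ᵐᵒᵖ] GX k n m q
  | 0, _ => 0
  | i + 1, j =>
      GX.incl k n m q i j ∘ₗ PP.map (rmulB k n i) LinearMap.id +
        (p.negOnePow : ℤ) • (GX.incl k n m q (i + 1) (j + 1) ∘ₗ
          PP.map LinearMap.id (lmulB k n j))

/-- The differential of `G_m` from degree `p` to degree `q` (zero unless `q = p + 1`). -/
def GX.d (p q : ℤ) : GX k n m p →ₗ[Gam k n ⊗[k] (Gam k n)ᵐᵒᵖ] GX k n m q :=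
  DirectSum.toModule _ _ _ fun s => GX.dComp k n m p q s.1.1 s.1.2

lemma GX.incl_of_not {p : ℤ} {i j : ℕ} (h : ¬ IsIdx m p (i, j)) : GX.incl k n m p i j = 0 :=
  dif_neg h

lemma GX.d_lof {p : ℤ} (q : ℤ) {i j : ℕ} (h : IsIdx m p (i, j)) (t : PP k n i j) :
    GX.d k n m p q (GX.incl k n m p i j t) = GX.dComp k n m p q i j t := by
  rw [GX.incl, dif_pos h]
  exact DirectSum.toModule_lof _ _ _

lemma GX.hom_ext {p : ℤ} {M : Type u} [AddCommGroup M]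
    [Module (Gam k n ⊗[k] (Gam k n)ᵐᵒᵖ) M]
    {φ ψ : GX k n m p →ₗ[Gam k n ⊗[k] (Gam k n)ᵐᵒᵖ] M}
    (h : ∀ i j, IsIdx m p (i, j) → ∀ x y,
      φ (GX.incl k n m p i j (PP.tmul x y)) = ψ (GX.incl k n m p i j (PP.tmul x y))) :
    φ = ψ := by
  refine DirectSum.linearMap_ext _ ?_
  rintro ⟨⟨i, j⟩, hs⟩
  refine PP.hom_ext fun x y => ?_
  have := h i j hs x y
  rw [GX.incl, dif_pos hs] at this
  exact this

lemma GX.d_incl_tmul {p : ℤ} (q : ℤ) {i j : ℕ} (h : IsIdx m p (i + 1, j)) (x : P k n (i + 1))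
    (y : PDual k n j) :
    GX.d k n m p q (GX.incl k n m p (i + 1) j (PP.tmul x y)) =
      GX.incl k n m q i j (PP.tmul (rmulB k n i x) y) +
        (p.negOnePow : ℤ) • GX.incl k n m q (i + 1) (j + 1) (PP.tmul x (lmulB k n j y)) := by
  rw [GX.d_lof k n m q h]
  rfl

lemma GX.shape (p q : ℤ) (h : p + 1 ≠ q) : GX.d k n m p q = 0 := by
  refine GX.hom_ext k n m fun i j hs x y => ?_
  obtain ⟨h1, h2, h3, h4⟩ := hs
  dsimp only at h1 h2 h3 h4
  obtain _ | i := i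
  · omega
  · rw [GX.d_incl_tmul k n m q ⟨h1, h2, h3, h4⟩,
      GX.incl_of_not k n m (p := q) (i := i) (j := j)
        (by rintro ⟨-, -, -, h5⟩; push_cast at h4 h5; omega),
      GX.incl_of_not k n m (p := q) (i := i + 1) (j := j + 1)
        (by rintro ⟨-, -, -, h5⟩; push_cast at h4 h5; omega)]
    simp

lemma PP.tmul_zero' {i j : ℕ} (p : P k n i) : (PP.tmul p 0 : PP k n i j) = 0 :=
  TensorProduct.tmul_zero _ p

lemma PP.zero_tmul' {i j : ℕ} (f : PDual k n j) : (PP.tmul 0 f : PP k n i j) = 0 :=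
  TensorProduct.zero_tmul _ f

lemma GX.d_comp_d (p q r : ℤ) (hpq : p + 1 = q) (hqr : q + 1 = r) :
    GX.d k n m q r ∘ₗ GX.d k n m p q = 0 := by
  subst hpq hqr
  refine GX.hom_ext k n m fun i j hs x y => ?_
  obtain ⟨h1, h2, h3, h4⟩ := hs
  dsimp only at h1 h2 h3 h4
  obtain _ | i := i
  · omega
  rw [LinearMap.comp_apply, GX.d_incl_tmul k n m _ ⟨h1, h2, h3, h4⟩, map_add, map_zsmul,
    LinearMap.zero_apply]
  by_cases hji : j ≤ i
  · have e2 : IsIdx m (p + 1) (i + 1, j + 1) :=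
      ⟨by dsimp only; omega, by dsimp only; omega, h3, by push_cast at h4 ⊢; omega⟩
    obtain _ | i := i
    · omega
    have e1 : IsIdx m (p + 1) (i + 1, j) :=
      ⟨h1, by dsimp only; omega, by dsimp only; omega, by push_cast at h4 ⊢; omega⟩
    have hr : rmulB k n i (rmulB k n (i + 1) x) = 0 := LinearMap.congr_fun (rmulB_rmulB k n i) x
    have hl : lmulB k n (j + 1) (lmulB k n j y) = 0 := LinearMap.congr_fun (lmulB_lmulB k n j) y
    rw [GX.d_incl_tmul k n m _ e1, GX.d_incl_tmul k n m _ e2, hr, hl, PP.tmul_zero',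
      PP.zero_tmul', map_zero, map_zero, Int.negOnePow_succ]
    simp
  · rw [GX.incl_of_not k n m (p := p + 1) (i := i) (j := j)
        (by rintro ⟨-, h5, -, -⟩; exact hji h5),
      GX.incl_of_not k n m (p := p + 1) (i := i + 1) (j := j + 1)
        (by rintro ⟨-, h5, -, -⟩; dsimp only at h5; omega)]
    simp

/-- The complex of bimodules `G_m`. -/
def G : CochainComplex (Bimod k (Gam k n)) ℤ where
  X p := ModuleCat.of _ (GX k n m p)
  d p q := ModuleCat.ofHom (GX.d k n m p q)
  shape p q h := by
    rw [GX.shape k n m p q h]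
    rfl
  d_comp_d' p q r hpq hqr := by
    rw [← ModuleCat.ofHom_comp, GX.d_comp_d k n m p q r hpq hqr]
    rfl

/-- The evaluation map on `P_{i,j}` if `i = j`. -/
def evOfEq : (i j : ℕ) → i = j →
    (PP k n i j →ₗ[Gam k n ⊗[k] (Gam k n)ᵐᵒᵖ] GamBi k n)
  | i, _, rfl => ev k n i

lemma IsIdx.eq_of_zero {i j : ℕ} (h : IsIdx m 0 (i, j)) : i = j := by
  have := h.2.2.2
  dsimp only at this
  omega

/-- The evaluation map `⊕_j P_{j,j} → Γ_n` on the degree `0` component of `G_m`. -/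
def GX.ev : GX k n m 0 →ₗ[Gam k n ⊗[k] (Gam k n)ᵐᵒᵖ] GamBi k n :=
  DirectSum.toModule _ _ _ fun s =>
    evOfEq k n s.1.1 s.1.2 (IsIdx.eq_of_zero m s.2)

lemma GX.ev_incl_tmul {i : ℕ} (h : IsIdx m 0 (i, i)) (x : P k n i) (y : PDual k n i) :
    GX.ev k n m (GX.incl k n m 0 i i (PP.tmul x y)) = (show GamBi k n from y x) := by
  rw [GX.incl, dif_pos h]
  exact DirectSum.toModule_lof _ _ _

lemma GX.ev_comp_d (p : ℤ) (hp : p + 1 = 0) : GX.ev k n m ∘ₗ GX.d k n m p 0 = 0 := by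
  obtain rfl : p = -1 := by omega
  refine GX.hom_ext k n m fun i j hs x y => ?_
  obtain ⟨h1, h2, h3, h4⟩ := hs
  dsimp only at h1 h2 h3 h4
  obtain rfl : i = j + 1 := by omega
  rw [LinearMap.comp_apply, GX.d_incl_tmul k n m _ ⟨h1, h2, h3, h4⟩, map_add, map_zsmul,
    GX.ev_incl_tmul k n m ⟨h1, le_rfl, by dsimp only; omega, by simp⟩,
    GX.ev_incl_tmul k n m ⟨by dsimp only; omega, le_rfl, h3, by simp⟩, LinearMap.zero_apply]
  change (y (rmulB k n j x) : Gam k n) +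
    (((-1 : ℤ).negOnePow : ℤˣ) : ℤ) • (y (rmulB k n j x) : Gam k n) = 0
  simp

/-- The complex of bimodules with `Γ_n` in degree `0`. -/
abbrev GamComplex : CochainComplex (Bimod k (Gam k n)) ℤ :=
  (HomologicalComplex.single _ (ComplexShape.up ℤ) 0).obj (ModuleCat.of _ (GamBi k n))

/-- The evaluation map `G_m → Γ_n`, as a map of complexes of bimodules. -/
def G.ev : G k n m ⟶ GamComplex k n :=
  HomologicalComplex.mkHomToSingle (K := G k n m) (j := 0) (ModuleCat.ofHom (GX.ev k n m))
    fun p hp => by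
      change ModuleCat.ofHom (GX.d k n m p 0) ≫ ModuleCat.ofHom (GX.ev k n m) = 0
      rw [← ModuleCat.ofHom_comp, GX.ev_comp_d k n m p hp]
      rfl

/-- The complex of bimodules `H_m = cone(ev : G_m → Γ_n)`. -/
def H : CochainComplex (Bimod k (Gam k n)) ℤ :=
  CochainComplex.mappingCone (G.ev k n m)

/-- The complex of bimodules `X_i = (ev : P_i ⊗_k P_i^∨ → Γ_n)` concentrated in homological degrees
`1` and `0`, as the cone of `ev`. -/
def X (i : ℕ) : CochainComplex (Bimod k (Gam k n)) ℤ :=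
  CochainComplex.mappingCone
    ((HomologicalComplex.single (Bimod k (Gam k n)) (ComplexShape.up ℤ) 0).map
      (ModuleCat.ofHom (ev k n i) : ModuleCat.of _ (PP k n i i) ⟶ ModuleCat.of _ (GamBi k n)))

variable {k n} in
/-- The spherical twist `F_i = X_i ⊗ -` on `D^b(Γ_n)`. -/
def sphericalTwist (i : ℕ) (h : Induces (X k n i)) : Db (Gam k n) ⥤ Db (Gam k n) :=
  tensorDb (X k n i) h

variable {k n} in
/-- The composition `F_m ∘ F_{m-1} ∘ ⋯ ∘ F_1` of spherical twists (`F_1` is applied first). -/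
def composedTwists (h : ∀ i, 1 ≤ i → i ≤ n → Induces (X k n i)) :
    (m : ℕ) → m ≤ n → (Db (Gam k n) ⥤ Db (Gam k n))
  | 0, _ => 𝟭 _
  | m + 1, hm =>
      composedTwists h m (by omega) ⋙ sphericalTwist (m + 1) (h (m + 1) (by omega) hm)

end Complexes
end SphericalTwist
end

/-!
# Compositions of spherical twists over `Γ_n`

The composition `F_m ⋯ F_1` is computed by induction on `m`, and by isomorphisms of functors on
complexes: at no point does one have to invert a quasi-isomorphism or to work up to homotopy. The
induction starts at `m = 0`, where `G_0 = 0`, so that `H_0 ⊗ -` is the identity (`tensorHZeroIso`).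
The induction step is an isomorphism `H_{m+1} ⊗ - ≅ X_{m+1} ⊗ (H_m ⊗ -)` (`tensorHSuccIso`), which
is obtained as follows.

* In every degree, `G_{m+1}` is the direct sum of `G_m` and of at most one further bimodule
  `P_{m+1,j}` (`G.splitting`). The `P_{m+1,j}` form the quotient complex `Q = G_{m+1} / G_m`, and
  `H_{m+1}` is the cone of a map `Q → H_m` (`G.toH`, `coneToHIso`), which is
  `x ⊗ y ↦ -x β_{m+1} ⊗ y` in negative degrees and evaluation in degree `0`. Tensor products of
  complexes commute with cones (`totConeFunctorIso`), so `H_{m+1} ⊗ Y` is the cone of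
  `Q ⊗ Y → H_m ⊗ Y`.
* Similarly, `X_{m+1} ⊗ Y'` is the cone of the evaluation `P_{m+1,m+1} ⊗ Y' → Y'`
  (`tensorXIso`). It remains to compare `Q ⊗ Y` with `P_{m+1,m+1} ⊗ (H_m ⊗ Y)`, over `H_m ⊗ Y`.
* A bimodule map `φ : P_{i,j} → H` induces a map `P_{i,j} ⊗ N → P_{i,i} ⊗ (H ⊗ N)`,
  `x ⊗ y ⊗ z ↦ x ⊗ e_i ⊗ φ(e_i ⊗ y) ⊗ z`, and this is an isomorphism as soon as
  `y ↦ φ(e_i ⊗ y)` is a bijection from `P_j^∨` to `e_i H` (`adjHom`, `adjIsoOfBijective`). With the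
  components of `Q → H_m` for `φ`, it gives the desired isomorphism (`tensorQuotientIso`,
  `tensorQuotientIso_comp`).
* The bijectivity (`toH_injective`, `toH_surjective`) is a computation in `Γ_n`: in degree `0` it
  is `P_{m+1}^∨ ≅ e_{m+1} Γ_n`, and in the other degrees it follows from `e_{m+1} Γ_n e_i = 0` for
  `i < m` and from the fact that `β_{m+1}` is a basis of `e_{m+1} Γ_n e_m` (`e_mul_mul_e_of_lt`,
  `e_mul_mul_e`). That `β_{m+1}` does not vanish in `Γ_n` is seen from a two-dimensional
  representation of the quiver (`rep`).

The functor `X_i ⊗ -` is the cone of a natural transformation between exact functors that preserve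
finitely generated modules, hence it acts on bounded complexes of finitely generated modules and
preserves quasi-isomorphisms (`preservesDb_tensorX`). By the induction, so does `H_m ⊗ -`
(`preservesDb_tensorH`). The isomorphisms of functors then descend to the bounded derived category
by the universal property of the localization (`tensorDbCompIso`).
-/

noncomputable section

namespace SphericalTwist

/-! ### Total complexes of a bifunctor -/

lemma isZero_obj_obj {C₁ C₂ D : Type*} [Category* C₁] [Category* C₂] [Category* D]
    [Preadditive C₁] [Preadditive D] (F : C₁ ⥤ C₂ ⥤ D) [F.Additive] {M : C₁} (hM : IsZero M)
    (N : C₂) : IsZero ((F.obj M).obj N) := by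
  have h : (F.map (𝟙 M)).app N = 0 := by
    rw [hM.eq_of_src (𝟙 M) 0, F.map_zero, zero_app]
  rw [F.map_id, NatTrans.id_app] at h
  exact (IsZero.iff_id_eq_zero _).2 h

section Bifunctor

open HomologicalComplex CochainComplex CochainComplex.HomComplex

variable {C₁ C₂ D : Type*} [Category* C₁] [Category* C₂] [Category* D]
  [Preadditive C₁] [Preadditive C₂] [Preadditive D]
  (F : C₁ ⥤ C₂ ⥤ D) [F.Additive] [∀ X : C₁, (F.obj X).Additive]
  [∀ (K : CochainComplex C₁ ℤ) (Y : CochainComplex C₂ ℤ), CochainComplex.HasMapBifunctor K Y F]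

/-- The total complex `F(K, Y)` of the `F(K^p, Y^q)`. -/
abbrev tot (K : CochainComplex C₁ ℤ) (Y : CochainComplex C₂ ℤ) : CochainComplex D ℤ :=
  (F.map₂CochainComplex.obj K).obj Y

/-- The inclusion of `F(K^p, Y^q)` into `F(K, Y)`. -/
def ιTot (K : CochainComplex C₁ ℤ) (Y : CochainComplex C₂ ℤ) (p q a : ℤ) (h : p + q = a) :
    (F.obj (K.X p)).obj (Y.X q) ⟶ (tot F K Y).X a :=
  CochainComplex.ιMapBifunctor K Y F p q a h

variable {F} in
/-- The morphism out of `F(K, Y)` with given restrictions to the `F(K^p, Y^q)`. -/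
def totDesc {K : CochainComplex C₁ ℤ} {Y : CochainComplex C₂ ℤ} {a : ℤ} {Z : D}
    (f : ∀ p q : ℤ, p + q = a → ((F.obj (K.X p)).obj (Y.X q) ⟶ Z)) : (tot F K Y).X a ⟶ Z :=
  mapBifunctorDesc f

lemma ιTot_desc {K : CochainComplex C₁ ℤ} {Y : CochainComplex C₂ ℤ} {a : ℤ} {Z : D}
    (f : ∀ p q : ℤ, p + q = a → ((F.obj (K.X p)).obj (Y.X q) ⟶ Z)) (p q : ℤ) (h : p + q = a) :
    ιTot F K Y p q a h ≫ totDesc f = f p q h :=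
  ι_mapBifunctorDesc (K₁ := K) (K₂ := Y) (c := ComplexShape.up ℤ) (F := F) f p q h

lemma ιTot_desc_assoc {K : CochainComplex C₁ ℤ} {Y : CochainComplex C₂ ℤ} {a : ℤ} {Z Z' : D}
    (f : ∀ p q : ℤ, p + q = a → ((F.obj (K.X p)).obj (Y.X q) ⟶ Z)) (p q : ℤ) (h : p + q = a)
    (g : Z ⟶ Z') : ιTot F K Y p q a h ≫ totDesc f ≫ g = f p q h ≫ g := by
  rw [← Category.assoc, ιTot_desc]

variable {F} in
lemma tot_hom_ext {K : CochainComplex C₁ ℤ} {Y : CochainComplex C₂ ℤ} {a : ℤ} {Z : D}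
    {f g : (tot F K Y).X a ⟶ Z}
    (h : ∀ (p q : ℤ) (h : p + q = a), ιTot F K Y p q a h ≫ f = ιTot F K Y p q a h ≫ g) : f = g :=
  mapBifunctor.hom_ext (K₁ := K) (K₂ := Y) (c := ComplexShape.up ℤ) (F := F) h

lemma ιTot_d (K : CochainComplex C₁ ℤ) (Y : CochainComplex C₂ ℤ) {p q a p' q' b : ℤ}
    (h : p + q = a) (hp : p + 1 = p') (hq : q + 1 = q') (hb : a + 1 = b) :
    ιTot F K Y p q a h ≫ (tot F K Y).d a b =
      (F.map (K.d p p')).app (Y.X q) ≫ ιTot F K Y p' q b (by omega) +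
        p.negOnePow • ((F.obj (K.X p)).map (Y.d q q') ≫ ιTot F K Y p q' b (by omega)) := by
  change CochainComplex.ιMapBifunctor K Y F p q a h ≫
    (CochainComplex.mapBifunctor K Y F).d a b = _
  rw [mapBifunctor.d_eq, Preadditive.comp_add, mapBifunctor.ι_D₁, mapBifunctor.ι_D₂,
    mapBifunctor.d₁_eq K Y F (.up ℤ) (i₁ := p) (i₁' := p') hp q b (by dsimp; omega),
    mapBifunctor.d₂_eq K Y F (.up ℤ) p (i₂ := q) (i₂' := q') hq b (by dsimp; omega)]
  simp only [ComplexShape.ε₁_def, ComplexShape.ε₂_def, one_smul, ιTot]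
  rfl

lemma ιTot_map_app {K L : CochainComplex C₁ ℤ} (f : K ⟶ L) (Y : CochainComplex C₂ ℤ)
    (p q a : ℤ) (h : p + q = a) :
    ιTot F K Y p q a h ≫ ((F.map₂CochainComplex.map f).app Y).f a =
      (F.map (f.f p)).app (Y.X q) ≫ ιTot F L Y p q a h := by
  refine (ι_mapBifunctorMap f (𝟙 Y) F (.up ℤ) p q a h).trans ?_
  simp only [CategoryTheory.Functor.map_id, id_f, Category.id_comp]
  rfl

lemma ιTot_map_app_assoc {K L : CochainComplex C₁ ℤ} (f : K ⟶ L) (Y : CochainComplex C₂ ℤ)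
    (p q a : ℤ) (h : p + q = a) {Z : D} (g : (tot F L Y).X a ⟶ Z) :
    ιTot F K Y p q a h ≫ ((F.map₂CochainComplex.map f).app Y).f a ≫ g =
      (F.map (f.f p)).app (Y.X q) ≫ ιTot F L Y p q a h ≫ g := by
  rw [← Category.assoc, ιTot_map_app, Category.assoc]

lemma ιTot_obj_map (K : CochainComplex C₁ ℤ) {Y Z : CochainComplex C₂ ℤ} (g : Y ⟶ Z)
    (p q a : ℤ) (h : p + q = a) :
    ιTot F K Y p q a h ≫ ((F.map₂CochainComplex.obj K).map g).f a =
      (F.obj (K.X p)).map (g.f q) ≫ ιTot F K Z p q a h := by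
  refine (ι_mapBifunctorMap (𝟙 K) g F (.up ℤ) p q a h).trans ?_
  simp only [CategoryTheory.Functor.map_id, id_f, Category.id_comp, NatTrans.id_app]
  rfl

lemma ιTot_obj_map_assoc (K : CochainComplex C₁ ℤ) {Y Z : CochainComplex C₂ ℤ} (g : Y ⟶ Z)
    (p q a : ℤ) (h : p + q = a) {W : D} (g' : (tot F K Z).X a ⟶ W) :
    ιTot F K Y p q a h ≫ ((F.map₂CochainComplex.obj K).map g).f a ≫ g' =
      (F.obj (K.X p)).map (g.f q) ≫ ιTot F K Z p q a h ≫ g' := by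
  rw [← Category.assoc, ιTot_obj_map, Category.assoc]

variable {F} in
/-- The functoriality of `K ↦ F(K, Y)` on cochains: the cochain of degree `n` given by the
`F(z, Y^q)`. No sign appears. -/
def mapCochain {K L : CochainComplex C₁ ℤ} {n : ℤ} (z : Cochain K L n)
    (Y : CochainComplex C₂ ℤ) : Cochain (tot F K Y) (tot F L Y) n :=
  Cochain.mk fun a b hab => totDesc fun p q h =>
    (F.map (z.v p (p + n) rfl)).app (Y.X q) ≫ ιTot F L Y (p + n) q b (by omega)

lemma ιTot_mapCochain_v {K L : CochainComplex C₁ ℤ} {n : ℤ} (z : Cochain K L n)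
    (Y : CochainComplex C₂ ℤ) {p q a p' b : ℤ} (h : p + q = a) (hp : p + n = p')
    (hb : a + n = b) :
    ιTot F K Y p q a h ≫ (mapCochain z Y).v a b hb =
      (F.map (z.v p p' hp)).app (Y.X q) ≫ ιTot F L Y p' q b (by omega) := by
  subst hp
  rw [mapCochain, Cochain.mk_v]
  exact ιTot_desc F _ p q h

lemma ιTot_mapCochain_v_assoc {K L : CochainComplex C₁ ℤ} {n : ℤ} (z : Cochain K L n)
    (Y : CochainComplex C₂ ℤ) {p q a p' b : ℤ} (h : p + q = a) (hp : p + n = p')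
    (hb : a + n = b) {Z : D} (g : (tot F L Y).X b ⟶ Z) :
    ιTot F K Y p q a h ≫ (mapCochain z Y).v a b hb ≫ g =
      (F.map (z.v p p' hp)).app (Y.X q) ≫ ιTot F L Y p' q b (by omega) ≫ g := by
  rw [← Category.assoc, ιTot_mapCochain_v F z Y h hp hb, Category.assoc]

lemma tot_cochain_ext {K : CochainComplex C₁ ℤ} {Y : CochainComplex C₂ ℤ}
    {L : CochainComplex D ℤ} {n : ℤ} {z w : Cochain (tot F K Y) L n}
    (h : ∀ (p q a b : ℤ) (ha : p + q = a) (hb : a + n = b),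
      ιTot F K Y p q a ha ≫ z.v a b hb = ιTot F K Y p q a ha ≫ w.v a b hb) : z = w :=
  Cochain.ext _ _ fun a b hb => tot_hom_ext fun p q ha => h p q a b ha hb

lemma mapCochain_comp {K L M : CochainComplex C₁ ℤ} {n m l : ℤ} (z : Cochain K L n)
    (w : Cochain L M m) (h : n + m = l) (Y : CochainComplex C₂ ℤ) :
    mapCochain (F := F) (z.comp w h) Y = (mapCochain z Y).comp (mapCochain w Y) h := by
  refine tot_cochain_ext F fun p q a b ha hb => ?_
  rw [Cochain.comp_v _ _ h a (a + n) b rfl (by omega),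
    ιTot_mapCochain_v_assoc F z Y ha (p' := p + n) rfl rfl,
    ιTot_mapCochain_v F w Y (a := a + n) (by omega) (p' := p + l) (by omega) (by omega),
    ιTot_mapCochain_v F _ Y ha rfl hb, Cochain.comp_v z w h p (p + n) (p + l) rfl (by omega)]
  simp

lemma mapCochain_add {K L : CochainComplex C₁ ℤ} {n : ℤ} (z w : Cochain K L n)
    (Y : CochainComplex C₂ ℤ) :
    mapCochain (F := F) (z + w) Y = mapCochain z Y + mapCochain w Y := by
  refine tot_cochain_ext F fun p q a b ha hb => ?_
  simp [ιTot_mapCochain_v F _ Y ha rfl hb]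

lemma mapCochain_zero {K L : CochainComplex C₁ ℤ} {n : ℤ} (Y : CochainComplex C₂ ℤ) :
    mapCochain (F := F) (0 : Cochain K L n) Y = 0 := by
  refine tot_cochain_ext F fun p q a b ha hb => ?_
  simp [ιTot_mapCochain_v F _ Y ha rfl hb]

lemma mapCochain_ofHom {K L : CochainComplex C₁ ℤ} (f : K ⟶ L) (Y : CochainComplex C₂ ℤ) :
    mapCochain (F := F) (Cochain.ofHom f) Y =
      Cochain.ofHom ((F.map₂CochainComplex.map f).app Y) := by
  refine tot_cochain_ext F fun p q a b ha hb => ?_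
  obtain rfl : a = b := by omega
  rw [ιTot_mapCochain_v F _ Y ha (add_zero p) hb, Cochain.ofHom_v, Cochain.ofHom_v,
    ιTot_map_app]

lemma mapCochain_naturality {K L : CochainComplex C₁ ℤ} {n : ℤ} (z : Cochain K L n)
    {Y Z : CochainComplex C₂ ℤ} (g : Y ⟶ Z) :
    (Cochain.ofHom ((F.map₂CochainComplex.obj K).map g)).comp (mapCochain z Z) (zero_add n) =
      (mapCochain z Y).comp (Cochain.ofHom ((F.map₂CochainComplex.obj L).map g)) (add_zero n) := by
  refine tot_cochain_ext F fun p q a b ha hb => ?_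
  rw [Cochain.zero_cochain_comp_v, Cochain.comp_zero_cochain_v, Cochain.ofHom_v, Cochain.ofHom_v,
    ιTot_obj_map_assoc, ιTot_mapCochain_v F _ _ ha rfl hb, ιTot_mapCochain_v_assoc F _ _ ha rfl hb,
    ιTot_obj_map, NatTrans.naturality_assoc]

/-- `mapCochain` commutes with the differentials. This is where the absence of signs in
`mapCochain` matters: the sign `(-1)^p` on `F(K^p, d)` in the total differential and the degree `n`
of `z` compensate, so that the terms `F(z, d)` cancel. -/
lemma δ_mapCochain {K L : CochainComplex C₁ ℤ} {n m : ℤ} (z : Cochain K L n)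
    (Y : CochainComplex C₂ ℤ) (hm : n + 1 = m) :
    δ n m (mapCochain (F := F) z Y) = mapCochain (δ n m z) Y := by
  refine tot_cochain_ext F fun p q a b ha hb => ?_
  rw [δ_v n m hm _ a b hb (a + n) (a + 1) (by omega) rfl, ιTot_mapCochain_v F _ Y ha rfl hb,
    δ_v n m hm z p (p + m) rfl (p + n) (p + 1) (by omega) rfl, Preadditive.comp_add,
    ιTot_mapCochain_v_assoc F z Y ha (p' := p + n) rfl rfl,
    ιTot_d F L Y (p := p + n) (q := q) (p' := p + m) (q' := q + 1) (by omega)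
      (by omega) rfl (by omega), Linear.comp_units_smul,
    reassoc_of% (ιTot_d F K Y (p := p) (q := q) (b := a + 1) ha rfl rfl rfl),
    Preadditive.add_comp, Category.assoc,
    ιTot_mapCochain_v F z Y (a := a + 1) (p := p + 1) (by omega) (p' := p + m) (by omega)
      (by omega),
    Linear.units_smul_comp, Category.assoc,
    ιTot_mapCochain_v F z Y (a := a + 1) (p := p) (q := q + 1) (by omega) (p' := p + n) rfl
      (by omega)]
  subst hm
  simp only [Functor.map_add, Functor.map_comp, NatTrans.app_add, NatTrans.comp_app,
    Preadditive.add_comp, Preadditive.comp_add, Category.assoc, Functor.map_units_smul,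
    NatTrans.app_units_zsmul, Linear.units_smul_comp, Linear.comp_units_smul, smul_add, smul_smul,
    NatTrans.naturality_assoc, ← Int.negOnePow_add]
  have : (n + 1 + p).negOnePow = - (p + n).negOnePow := by
    rw [← Int.negOnePow_succ]; congr 1; omega
  rw [this]
  simp only [Units.neg_smul]
  abel

section Cone

open mappingCone

variable [HasBinaryBiproducts C₁] [HasBinaryBiproducts D]

/-- A complex `W` that is the direct sum, as a graded object, of `U[1]` and `V`, with the
inclusions `α`, `β` and the projections `α'`, `β'`, is the cone of `φ : U ⟶ V` as soon as `β` is a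
morphism of complexes and the differential of `α` is given by `φ`. -/
def mappingConeIsoOfSplitting {U V W : CochainComplex D ℤ} (φ : U ⟶ V) (α : Cochain U W (-1))
    (β : V ⟶ W) (α' : Cochain W U 1) (β' : Cochain W V 0)
    (hδ : δ (-1) 0 α = Cochain.ofHom (φ ≫ β))
    (h₁ : α.comp α' (neg_add_cancel 1) = Cochain.ofHom (𝟙 U))
    (h₂ : α.comp β' (add_zero (-1)) = 0)
    (h₃ : (Cochain.ofHom β).comp α' (zero_add 1) = 0)
    (h₄ : (Cochain.ofHom β).comp β' (zero_add 0) = Cochain.ofHom (𝟙 V))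
    (h₅ : α'.comp α (add_neg_cancel 1) + β'.comp (Cochain.ofHom β) (add_zero 0) =
      Cochain.ofHom (𝟙 W)) :
    mappingCone φ ≅ W :=
  Hom.isoOfComponents (fun p =>
    { hom := (desc φ α β hδ).f p
      inv := α'.v p (p + 1) rfl ≫ (inl φ).v (p + 1) p (by omega) +
        β'.v p p (add_zero p) ≫ (inr φ).f p
      hom_inv_id := by
        rw [ext_from_iff φ (p + 1) p rfl]
        have e₁ := Cochain.congr_v h₁ (p + 1) (p + 1) (add_zero _)
        have e₂ := Cochain.congr_v h₂ (p + 1) p (by omega)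
        have e₃ := Cochain.congr_v h₃ p (p + 1) rfl
        have e₄ := Cochain.congr_v h₄ p p (add_zero _)
        rw [Cochain.comp_v _ _ _ (p + 1) p (p + 1) (by omega) rfl] at e₁
        rw [Cochain.comp_v _ _ _ (p + 1) p p (by omega) (add_zero p)] at e₂
        rw [Cochain.comp_v _ _ _ p p (p + 1) (add_zero p) rfl] at e₃
        rw [Cochain.comp_v _ _ _ p p p (add_zero p) (add_zero p)] at e₄
        simp only [Cochain.ofHom_v, id_f, Cochain.zero_v] at e₁ e₂ e₃ e₄
        constructor
        · simp [reassoc_of% e₁, reassoc_of% e₂]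
        · simp [reassoc_of% e₃, reassoc_of% e₄]
      inv_hom_id := by
        have e₅ := Cochain.congr_v h₅ p p (add_zero _)
        rw [Cochain.add_v, Cochain.comp_v _ _ _ p (p + 1) p rfl (by omega),
          Cochain.comp_v _ _ _ p p p (add_zero p) (add_zero p)] at e₅
        simpa using e₅ })
    fun p q _ => (desc φ α β hδ).comm p q

@[simp]
lemma mappingConeIsoOfSplitting_hom {U V W : CochainComplex D ℤ} (φ : U ⟶ V)
    (α : Cochain U W (-1)) (β : V ⟶ W) (α' : Cochain W U 1) (β' : Cochain W V 0)
    (hδ h₁ h₂ h₃ h₄ h₅) :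
    (mappingConeIsoOfSplitting φ α β α' β' hδ h₁ h₂ h₃ h₄ h₅).hom = desc φ α β hδ := by
  ext p : 1
  rfl

variable {F} in
/-- The comparison `cone F(f, Y) ≅ F(cone f, Y)`. -/
def totMappingConeIso {K L : CochainComplex C₁ ℤ} (f : K ⟶ L) (Y : CochainComplex C₂ ℤ) :
    mappingCone ((F.map₂CochainComplex.map f).app Y) ≅ tot F (mappingCone f) Y :=
  mappingConeIsoOfSplitting _ (mapCochain (inl f) Y) ((F.map₂CochainComplex.map (inr f)).app Y)
    (mapCochain (fst f : Cochain _ _ 1) Y) (mapCochain (snd f) Y)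
    (by
      rw [← NatTrans.comp_app, ← Functor.map_comp, ← mapCochain_ofHom, ← δ_inl]
      exact δ_mapCochain F _ _ (by omega))
    (by rw [← mapCochain_comp, inl_fst, mapCochain_ofHom, CategoryTheory.Functor.map_id]; rfl)
    (by rw [← mapCochain_comp, inl_snd, mapCochain_zero])
    (by rw [← mapCochain_ofHom, ← mapCochain_comp, inr_fst, mapCochain_zero])
    (by
      rw [← mapCochain_ofHom, ← mapCochain_comp, inr_snd, mapCochain_ofHom,
        CategoryTheory.Functor.map_id]
      rfl)
    (by
      rw [← mapCochain_ofHom, ← mapCochain_comp, ← mapCochain_comp, ← mapCochain_add,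
        mappingCone.id, mapCochain_ofHom, CategoryTheory.Functor.map_id]
      rfl)

/-- The cone of a natural transformation between functors with values in complexes. -/
@[simps]
def coneFunctor {E : Type*} [Category* E] {U V : E ⥤ CochainComplex D ℤ} (τ : U ⟶ V) :
    E ⥤ CochainComplex D ℤ where
  obj Y := mappingCone (τ.app Y)
  map g := mappingCone.map _ _ (U.map g) (V.map g) (τ.naturality g).symm
  map_id Y := by
    rw [← mappingCone.map_id]
    congr 1 <;> simp
  map_comp g h := by
    rw [← mappingCone.map_comp]
    congr 1 <;> simp

/-- An isomorphism of arrows induces an isomorphism of cones. -/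
@[simps]
def mappingConeIsoOfArrowIso {U V U' V' : CochainComplex D ℤ} {φ : U ⟶ V} {φ' : U' ⟶ V'}
    (e₁ : U ≅ U') (e₂ : V ≅ V') (h : φ ≫ e₂.hom = e₁.hom ≫ φ') :
    mappingCone φ ≅ mappingCone φ' where
  hom := mappingCone.map _ _ e₁.hom e₂.hom h
  inv := mappingCone.map _ _ e₁.inv e₂.inv
    (by rw [Iso.comp_inv_eq, Category.assoc, h, Iso.inv_hom_id_assoc])
  hom_inv_id := by
    rw [← mappingCone.map_comp, ← mappingCone.map_id]
    congr 1 <;> simp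
  inv_hom_id := by
    rw [← mappingCone.map_comp, ← mappingCone.map_id]
    congr 1 <;> simp

/-- Isomorphic natural transformations have isomorphic cones. -/
def coneFunctorIso {E : Type*} [Category* E] {U V U' V' : E ⥤ CochainComplex D ℤ} (τ : U ⟶ V)
    (τ' : U' ⟶ V') (e₁ : U ≅ U') (e₂ : V ≅ V') (h : τ ≫ e₂.hom = e₁.hom ≫ τ') :
    coneFunctor τ ≅ coneFunctor τ' :=
  NatIso.ofComponents (fun Y =>
    mappingConeIsoOfArrowIso (e₁.app Y) (e₂.app Y) (NatTrans.congr_app h Y)) fun g => by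
      refine (mappingCone.map_comp _ _ _ _ _ (τ.naturality g).symm _ _
        (NatTrans.congr_app h _)).symm.trans (Eq.trans ?_ (mappingCone.map_comp _ _ _ _ _
          (NatTrans.congr_app h _) _ _ (τ'.naturality g).symm))
      congr 1
      · exact e₁.hom.naturality g
      · exact e₂.hom.naturality g

variable {F} in
lemma totMappingConeIso_hom_naturality {K L : CochainComplex C₁ ℤ} (f : K ⟶ L)
    {Y Z : CochainComplex C₂ ℤ} (g : Y ⟶ Z) :
    mappingCone.map ((F.map₂CochainComplex.map f).app Y) ((F.map₂CochainComplex.map f).app Z)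
        ((F.map₂CochainComplex.obj K).map g) ((F.map₂CochainComplex.obj L).map g)
        (((F.map₂CochainComplex.map f).naturality g).symm) ≫ (totMappingConeIso f Z).hom =
      (totMappingConeIso f Y).hom ≫ (F.map₂CochainComplex.obj (mappingCone f)).map g := by
  refine Cochain.ofHom_injective ?_
  rw [Cochain.ofHom_comp, Cochain.ofHom_comp, totMappingConeIso, totMappingConeIso,
    mappingConeIsoOfSplitting_hom, mappingConeIsoOfSplitting_hom, mappingCone.map, ofHom_desc,
    ofHom_desc, ofHom_desc, ext_cochain_from_iff _ (-1) 0 (by omega)]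
  constructor
  · rw [← Cochain.comp_assoc_of_third_is_zero_cochain, inl_descCochain,
      ← Cochain.comp_assoc_of_third_is_zero_cochain, inl_descCochain,
      ← mapCochain_naturality, Cochain.comp_assoc_of_first_is_zero_cochain, inl_descCochain]
  · rw [← Cochain.comp_assoc_of_second_is_zero_cochain, inr_descCochain,
      ← Cochain.comp_assoc_of_second_is_zero_cochain, inr_descCochain, Cochain.ofHom_comp,
      Cochain.comp_assoc_of_first_is_zero_cochain, inr_descCochain, ← Cochain.ofHom_comp,
      ← Cochain.ofHom_comp, NatTrans.naturality]

variable {F} in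
/-- The comparison `cone F(f, -) ≅ F(cone f, -)`, naturally in the complex. -/
def totConeFunctorIso {K L : CochainComplex C₁ ℤ} (f : K ⟶ L) :
    coneFunctor (F.map₂CochainComplex.map f) ≅ F.map₂CochainComplex.obj (mappingCone f) :=
  NatIso.ofComponents (fun Y => totMappingConeIso f Y) fun g =>
    totMappingConeIso_hom_naturality f g

end Cone

section Finite

variable {F} in
/-- The projection of `F(K, Y)` onto the summand `F(K^p, Y^q)`. -/
def πTot (K : CochainComplex C₁ ℤ) (Y : CochainComplex C₂ ℤ) (p q a : ℤ) (h : p + q = a) :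
    (tot F K Y).X a ⟶ (F.obj (K.X p)).obj (Y.X q) :=
  totDesc fun p' q' h' =>
    if hp : p' = p then eqToHom (by obtain rfl := hp; obtain rfl : q' = q := by omega
                                    rfl) else 0

lemma ιTot_πTot_self (K : CochainComplex C₁ ℤ) (Y : CochainComplex C₂ ℤ) (p q a : ℤ)
    (h : p + q = a) : ιTot F K Y p q a h ≫ πTot K Y p q a h = 𝟙 _ := by
  simp [πTot, ιTot_desc]

lemma ιTot_πTot_self_assoc (K : CochainComplex C₁ ℤ) (Y : CochainComplex C₂ ℤ) (p q a : ℤ)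
    (h : p + q = a) {Z : D} (g : (F.obj (K.X p)).obj (Y.X q) ⟶ Z) :
    ιTot F K Y p q a h ≫ πTot K Y p q a h ≫ g = g := by
  rw [← Category.assoc, ιTot_πTot_self, Category.id_comp]

lemma ιTot_πTot_of_ne (K : CochainComplex C₁ ℤ) (Y : CochainComplex C₂ ℤ) (p q p' q' a : ℤ)
    (h : p + q = a) (h' : p' + q' = a) (hp : p ≠ p') :
    ιTot F K Y p q a h ≫ πTot K Y p' q' a h' = 0 := by
  simp [πTot, ιTot_desc, hp]

/-- A total complex is the sum of its summands, provided that almost all `K^p` vanish. -/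
lemma sum_πTot_ιTot (K : CochainComplex C₁ ℤ) (Y : CochainComplex C₂ ℤ) (S : Finset ℤ)
    (hS : ∀ p ∉ S, IsZero (K.X p)) (a : ℤ) :
    ∑ p ∈ S, πTot K Y p (a - p) a (by omega) ≫ ιTot F K Y p (a - p) a (by omega) = 𝟙 _ := by
  refine tot_hom_ext fun p q h => ?_
  obtain rfl : q = a - p := by omega
  by_cases hp : p ∈ S
  · rw [Preadditive.comp_sum, Finset.sum_eq_single_of_mem p hp, ιTot_πTot_self_assoc,
      Category.comp_id]
    intro p' _ hne
    rw [← Category.assoc, ιTot_πTot_of_ne F K Y _ _ _ _ _ _ _ hne.symm, zero_comp]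
  · exact (isZero_obj_obj F (hS p hp) _).eq_of_src _ _

variable {F} in
/-- If objects `F(K^p, N)` are isomorphic to `Ψ F(L^p, N)`, compatibly with the differentials
and naturally in `N`, and only finitely many `L^p` are non-zero, then `F(K, Y)` is isomorphic to
`Ψ F(L, Y)`. -/
def totCompIso {K L : CochainComplex C₁ ℤ} (Ψ : D ⥤ D) [Ψ.Additive]
    (θ : ∀ p N, (F.obj (K.X p)).obj N ≅ Ψ.obj ((F.obj (L.X p)).obj N))
    (hθ₁ : ∀ p q N, p + 1 = q →
      (F.map (K.d p q)).app N ≫ (θ q N).hom = (θ p N).hom ≫ Ψ.map ((F.map (L.d p q)).app N))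
    (hθ₂ : ∀ p {N N' : C₂} (g : N ⟶ N'),
      (F.obj (K.X p)).map g ≫ (θ p N').hom = (θ p N).hom ≫ Ψ.map ((F.obj (L.X p)).map g))
    (S : Finset ℤ) (hS : ∀ p ∉ S, IsZero (L.X p)) (Y : CochainComplex C₂ ℤ) :
    tot F K Y ≅ (Ψ.mapHomologicalComplex (.up ℤ)).obj (tot F L Y) :=
  Hom.isoOfComponents (fun a =>
    { hom := totDesc fun p q h => (θ p (Y.X q)).hom ≫ Ψ.map (ιTot F L Y p q a h)
      inv := Finset.sum (M := Ψ.obj ((tot F L Y).X a) ⟶ (tot F K Y).X a) S fun p =>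
        Ψ.map (πTot L Y p (a - p) a (by omega)) ≫ (θ p (Y.X (a - p))).inv ≫
          ιTot F K Y p (a - p) a (by omega)
      hom_inv_id := by
        change totDesc (fun p q h => (θ p (Y.X q)).hom ≫ Ψ.map (ιTot F L Y p q a h)) ≫
          (∑ p ∈ S, Ψ.map (πTot L Y p (a - p) a (by omega)) ≫ (θ p (Y.X (a - p))).inv ≫
            ιTot F K Y p (a - p) a (by omega)) = 𝟙 _
        refine tot_hom_ext fun p q h => ?_
        obtain rfl : q = a - p := by omega
        rw [ιTot_desc_assoc]
        by_cases hp : p ∈ S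
        · rw [Preadditive.comp_sum, Finset.sum_eq_single_of_mem p hp, Category.assoc,
            ← Ψ.map_comp_assoc, ιTot_πTot_self]
          · simp
          · intro p' _ hne
            rw [Category.assoc, ← Ψ.map_comp_assoc, ιTot_πTot_of_ne F L Y _ _ _ _ _ _ _ hne.symm]
            simp
        · -- outside `S`, the isomorphism `θ` shows that `F(K^p, -)` vanishes as well
          have h0 : 𝟙 ((F.obj (K.X p)).obj (Y.X (a - p))) = 0 := by
            rw [← (θ p _).hom_inv_id, ← Category.id_comp (θ p _).inv, ← Ψ.map_id,
              (isZero_obj_obj F (hS p hp) (Y.X (a - p))).eq_of_src (𝟙 _) 0]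
            simp
          exact ((IsZero.iff_id_eq_zero _).2 h0).eq_of_src _ _
      inv_hom_id := by
        change (∑ p ∈ S, Ψ.map (πTot L Y p (a - p) a (by omega)) ≫ (θ p (Y.X (a - p))).inv ≫
            ιTot F K Y p (a - p) a (by omega)) ≫
          totDesc (fun p q h => (θ p (Y.X q)).hom ≫ Ψ.map (ιTot F L Y p q a h)) = 𝟙 _
        rw [Preadditive.sum_comp]
        simp only [Category.assoc, ιTot_desc, Iso.inv_hom_id_assoc]
        simp only [← Ψ.map_comp]
        rw [← Ψ.map_sum, sum_πTot_ιTot F L Y S hS, CategoryTheory.Functor.map_id] })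
    (by
      intro a b hab
      change a + 1 = b at hab
      change totDesc (fun p q h => (θ p (Y.X q)).hom ≫ Ψ.map (ιTot F L Y p q a h)) ≫
        Ψ.map ((tot F L Y).d a b) = (tot F K Y).d a b ≫
          totDesc (fun p q h => (θ p (Y.X q)).hom ≫ Ψ.map (ιTot F L Y p q b h))
      refine tot_hom_ext fun p q h => ?_
      rw [ιTot_desc_assoc, reassoc_of% (ιTot_d F K Y h rfl rfl hab), Preadditive.add_comp,
        Category.assoc, Category.assoc, ιTot_desc, Linear.units_smul_comp, Category.assoc,
        ιTot_desc, ← Ψ.map_comp, ιTot_d F L Y h rfl rfl hab, Ψ.map_add, Preadditive.comp_add,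
        reassoc_of% (hθ₁ p (p + 1) (Y.X q) rfl), Ψ.map_comp, Functor.map_units_smul,
        Linear.comp_units_smul, Ψ.map_comp, reassoc_of% (hθ₂ p (Y.d q (q + 1)))])

variable {F} in
/-- `totCompIso` as an isomorphism of functors. -/
def totCompFunctorIso {K L : CochainComplex C₁ ℤ} (Ψ : D ⥤ D) [Ψ.Additive]
    (θ : ∀ p N, (F.obj (K.X p)).obj N ≅ Ψ.obj ((F.obj (L.X p)).obj N))
    (hθ₁ : ∀ p q N, p + 1 = q →
      (F.map (K.d p q)).app N ≫ (θ q N).hom = (θ p N).hom ≫ Ψ.map ((F.map (L.d p q)).app N))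
    (hθ₂ : ∀ p {N N' : C₂} (g : N ⟶ N'),
      (F.obj (K.X p)).map g ≫ (θ p N').hom = (θ p N).hom ≫ Ψ.map ((F.obj (L.X p)).map g))
    (S : Finset ℤ) (hS : ∀ p ∉ S, IsZero (L.X p)) :
    F.map₂CochainComplex.obj K ≅
      F.map₂CochainComplex.obj L ⋙ Ψ.mapHomologicalComplex (.up ℤ) :=
  NatIso.ofComponents (fun Y => totCompIso Ψ θ hθ₁ hθ₂ S hS Y) fun {Y Z} g => by
    ext a : 1
    change ((F.map₂CochainComplex.obj K).map g).f a ≫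
        totDesc (fun p q h => (θ p (Z.X q)).hom ≫ Ψ.map (ιTot F L Z p q a h)) =
      totDesc (fun p q h => (θ p (Y.X q)).hom ≫ Ψ.map (ιTot F L Y p q a h)) ≫
        Ψ.map (((F.map₂CochainComplex.obj L).map g).f a)
    refine tot_hom_ext fun p q h => ?_
    rw [ιTot_obj_map_assoc, ιTot_desc, ιTot_desc_assoc, Category.assoc, ← Ψ.map_comp,
      ιTot_obj_map, Ψ.map_comp, reassoc_of% (hθ₂ p (g.f q))]

variable {F} in
lemma ιTot_totCompFunctorIso_hom {K L : CochainComplex C₁ ℤ} (Ψ : D ⥤ D) [Ψ.Additive]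
    (θ : ∀ p N, (F.obj (K.X p)).obj N ≅ Ψ.obj ((F.obj (L.X p)).obj N)) (hθ₁ hθ₂)
    (S : Finset ℤ) (hS : ∀ p ∉ S, IsZero (L.X p)) (Y : CochainComplex C₂ ℤ) (p q a : ℤ)
    (h : p + q = a) :
    ιTot F K Y p q a h ≫ ((totCompFunctorIso Ψ θ hθ₁ hθ₂ S hS).hom.app Y).f a =
      (θ p (Y.X q)).hom ≫ Ψ.map (ιTot F L Y p q a h) := by
  change ιTot F K Y p q a h ≫
    totDesc (fun p q h => (θ p (Y.X q)).hom ≫ Ψ.map (ιTot F L Y p q a h)) = _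
  rw [ιTot_desc]

variable {F} in
/-- Suppose that the isomorphisms `θ` come from a morphism `f : K ⟶ L`, in the sense that
`F(K^p, N) ≅ Ψ F(L^p, N) ⟶ Ψ' F(L^p, N)` is `F(f, N)` followed by `η`. Then the same holds for the
induced isomorphism `F(K, -) ≅ Ψ F(L, -)` of total complexes. -/
lemma totCompFunctorIso_hom_comp {K L : CochainComplex C₁ ℤ} (f : K ⟶ L) (Ψ Ψ' : D ⥤ D)
    [Ψ.Additive] [Ψ'.Additive]
    (θ : ∀ p N, (F.obj (K.X p)).obj N ≅ Ψ.obj ((F.obj (L.X p)).obj N)) (hθ₁ hθ₂)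
    (S : Finset ℤ) (hS : ∀ p ∉ S, IsZero (L.X p)) (ε : Ψ ⟶ Ψ') (η : 𝟭 D ⟶ Ψ')
    (h : ∀ p N, (θ p N).hom ≫ ε.app _ = (F.map (f.f p)).app N ≫ η.app _) :
    F.map₂CochainComplex.map f ≫ Functor.whiskerLeft (F.map₂CochainComplex.obj L)
        ((Functor.mapHomologicalComplexIdIso D (.up ℤ)).inv ≫
          NatTrans.mapHomologicalComplex η (.up ℤ)) =
      (totCompFunctorIso Ψ θ hθ₁ hθ₂ S hS).hom ≫ Functor.whiskerLeft (F.map₂CochainComplex.obj L)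
        (NatTrans.mapHomologicalComplex ε (.up ℤ)) := by
  ext Y a
  refine tot_hom_ext fun p q hpq => ?_
  have hl : (((Functor.mapHomologicalComplexIdIso D (.up ℤ)).inv ≫
      NatTrans.mapHomologicalComplex η (.up ℤ)).app (tot F L Y)).f a = η.app ((tot F L Y).X a) :=
    Category.id_comp _
  refine (ιTot_map_app_assoc F f Y p q a hpq _).trans ?_
  refine Eq.trans ?_ ((Category.assoc _ _ _).symm.trans
    (congrArg (· ≫ ε.app ((tot F L Y).X a))
      (ιTot_totCompFunctorIso_hom Ψ θ hθ₁ hθ₂ S hS Y p q a hpq))).symm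
  refine (congrArg (fun g => _ ≫ ιTot F L Y p q a hpq ≫ g) hl).trans ?_
  have h₁ : ιTot F L Y p q a hpq ≫ η.app ((tot F L Y).X a) =
      η.app _ ≫ Ψ'.map (ιTot F L Y p q a hpq) := η.naturality _
  have h₂ : Ψ.map (ιTot F L Y p q a hpq) ≫ ε.app ((tot F L Y).X a) =
      ε.app _ ≫ Ψ'.map (ιTot F L Y p q a hpq) := ε.naturality _
  change _ ≫ ιTot F L Y p q a hpq ≫ η.app ((tot F L Y).X a) =
    ((θ p (Y.X q)).hom ≫ Ψ.map (ιTot F L Y p q a hpq)) ≫ ε.app ((tot F L Y).X a)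
  rw [Category.assoc, h₁, h₂, reassoc_of% (h p (Y.X q))]

section Single

variable [HasZeroObject C₁]

variable {F} in
/-- For a complex concentrated in degree `0`, the total complex is computed termwise. -/
def singleTotIso (M : C₁) (Y : CochainComplex C₂ ℤ) :
    ((F.obj M).mapHomologicalComplex (.up ℤ)).obj Y ≅
      tot F ((HomologicalComplex.single C₁ (.up ℤ) 0).obj M) Y :=
  have hS : ∀ p ∉ ({0} : Finset ℤ),
      IsZero (((HomologicalComplex.single C₁ (.up ℤ) 0).obj M).X p) := fun p hp =>
    isZero_single_obj_X _ _ _ _ (by simpa using hp)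
  Hom.isoOfComponents (fun a =>
    { hom := (F.map (singleObjXSelf (.up ℤ) 0 M).inv).app (Y.X a) ≫
        ιTot F _ Y 0 a a (zero_add a)
      inv := πTot _ Y 0 a a (zero_add a) ≫ (F.map (singleObjXSelf (.up ℤ) 0 M).hom).app (Y.X a)
      hom_inv_id := by
        change ((F.map (singleObjXSelf (.up ℤ) 0 M).inv).app (Y.X a) ≫
          ιTot F _ Y 0 a a (zero_add a)) ≫ πTot _ Y 0 a a (zero_add a) ≫
            (F.map (singleObjXSelf (.up ℤ) 0 M).hom).app (Y.X a) = 𝟙 ((F.obj M).obj (Y.X a))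
        rw [Category.assoc, ιTot_πTot_self_assoc, ← NatTrans.comp_app, ← F.map_comp,
          Iso.inv_hom_id, F.map_id]
        rfl
      inv_hom_id := by
        change (πTot _ Y 0 a a (zero_add a) ≫
            (F.map (singleObjXSelf (.up ℤ) 0 M).hom).app (Y.X a)) ≫
          (F.map (singleObjXSelf (.up ℤ) 0 M).inv).app (Y.X a) ≫
            ιTot F _ Y 0 a a (zero_add a) = 𝟙 _
        rw [Category.assoc, ← NatTrans.comp_app_assoc, ← F.map_comp, Iso.hom_inv_id, F.map_id,
          NatTrans.id_app, Category.id_comp]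
        have key : ∀ q (hq : 0 + q = a),
            πTot (F := F) ((HomologicalComplex.single C₁ (.up ℤ) 0).obj M) Y 0 q a hq ≫
              ιTot F _ Y 0 q a hq = 𝟙 _ := by
          intro q hq
          obtain rfl : q = a - 0 := by omega
          simpa only [Finset.sum_singleton] using sum_πTot_ιTot F _ Y {0} hS a
        exact key a (zero_add a) })
    (by
      intro a b hab
      change a + 1 = b at hab
      change ((F.map (singleObjXSelf (.up ℤ) 0 M).inv).app (Y.X a) ≫
          ιTot F _ Y 0 a a (zero_add a)) ≫ (tot F _ Y).d a b = (F.obj M).map (Y.d a b) ≫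
        (F.map (singleObjXSelf (.up ℤ) 0 M).inv).app (Y.X b) ≫ ιTot F _ Y 0 b b (zero_add b)
      rw [Category.assoc, ιTot_d F _ Y (zero_add a) rfl hab hab, single_obj_d, F.map_zero,
        zero_app, zero_comp, zero_add, Int.negOnePow_zero, one_smul, NatTrans.naturality_assoc])

variable {F} in
/-- `singleTotIso` as an isomorphism of functors. -/
def singleTotFunctorIso (M : C₁) :
    (F.obj M).mapHomologicalComplex (.up ℤ) ≅
      F.map₂CochainComplex.obj ((HomologicalComplex.single C₁ (.up ℤ) 0).obj M) :=
  NatIso.ofComponents (fun Y => singleTotIso M Y) fun {Y Z} g => by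
    ext a : 1
    change (F.obj M).map (g.f a) ≫ (F.map (singleObjXSelf (.up ℤ) 0 M).inv).app (Z.X a) ≫
        ιTot F _ Z 0 a a (zero_add a) =
      ((F.map (singleObjXSelf (.up ℤ) 0 M).inv).app (Y.X a) ≫
        ιTot F _ Y 0 a a (zero_add a)) ≫ ((F.map₂CochainComplex.obj _).map g).f a
    rw [Category.assoc, ιTot_obj_map, NatTrans.naturality_assoc]

variable {F} in
lemma singleTotFunctorIso_naturality {M M' : C₁} (f : M ⟶ M') :
    NatTrans.mapHomologicalComplex (F.map f) (.up ℤ) ≫ (singleTotFunctorIso M').hom =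
      (singleTotFunctorIso M).hom ≫
        F.map₂CochainComplex.map ((HomologicalComplex.single C₁ (.up ℤ) 0).map f) := by
  ext Y a
  change (F.map f).app (Y.X a) ≫ (F.map (singleObjXSelf (.up ℤ) 0 M').inv).app (Y.X a) ≫
      ιTot F _ Y 0 a a (zero_add a) =
    ((F.map (singleObjXSelf (.up ℤ) 0 M).inv).app (Y.X a) ≫ ιTot F _ Y 0 a a (zero_add a)) ≫
      ((F.map₂CochainComplex.map ((HomologicalComplex.single C₁ (.up ℤ) 0).map f)).app Y).f a
  rw [Category.assoc, ιTot_map_app, ← NatTrans.comp_app_assoc, ← NatTrans.comp_app_assoc,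
    ← F.map_comp, ← F.map_comp, single_map_f_self, Iso.inv_hom_id_assoc]

end Single

end Finite

end Bifunctor

/-! ### Tensor products over `Γ_n` -/

section Tensor

variable {k : Type u} [Field k] {A : Type u} [Ring A] [Algebra k A]

/-- The element `m ⊗ y` of `M ⊗_A N`. -/
def tmk {M : Bimod k A} {N : ModuleCat.{u} A} (m : M) (y : N) : tensorObj M N :=
  Submodule.Quotient.mk ((show leftMod M from m) ⊗ₜ[ℤ] y)

lemma add_tmk {M : Bimod k A} {N : ModuleCat.{u} A} (m m' : M) (y : N) :
    tmk (m + m') y = tmk m y + tmk m' y :=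
  congrArg (Submodule.Quotient.mk (p := balanced M N))
    (TensorProduct.add_tmul (R := ℤ) (show leftMod M from m) (show leftMod M from m') y)

lemma tmk_add {M : Bimod k A} {N : ModuleCat.{u} A} (m : M) (y y' : N) :
    tmk m (y + y') = tmk m y + tmk m y' :=
  congrArg (Submodule.Quotient.mk (p := balanced M N))
    (TensorProduct.tmul_add (R := ℤ) (show leftMod M from m) y y')

lemma smul_tmk {M : Bimod k A} {N : ModuleCat.{u} A} (a : A) (m : M) (y : N) :
    a • tmk m y = tmk ((a ⊗ₜ[k] 1 : A ⊗[k] Aᵐᵒᵖ) • m) y := rfl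

lemma tmk_smul {M : Bimod k A} {N : ModuleCat.{u} A} (m : M) (a : A) (y : N) :
    tmk m (a • y) = tmk (rightAct m a) y :=
  ((Submodule.Quotient.eq (balanced M N)).2 (Submodule.subset_span ⟨m, a, y, rfl⟩)).symm

lemma zero_tmk {M : Bimod k A} {N : ModuleCat.{u} A} (y : N) : tmk (0 : M) y = 0 :=
  congrArg (Submodule.Quotient.mk (p := balanced M N))
    (TensorProduct.zero_tmul (R := ℤ) (leftMod M) y)

lemma tmk_zero {M : Bimod k A} {N : ModuleCat.{u} A} (m : M) : tmk m (0 : N) = 0 :=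
  congrArg (Submodule.Quotient.mk (p := balanced M N))
    (TensorProduct.tmul_zero (R := ℤ) N (show leftMod M from m))

lemma tmk_induction {M : Bimod k A} {N : ModuleCat.{u} A} {motive : tensorObj M N → Prop}
    (t : tensorObj M N) (zero : motive 0) (tmk : ∀ m y, motive (tmk m y))
    (add : ∀ s t, motive s → motive t → motive (s + t)) : motive t := by
  obtain ⟨t, rfl⟩ := Submodule.Quotient.mk_surjective _ t
  induction t using TensorProduct.induction_on with
  | zero => exact zero
  | tmul m y => exact tmk m y
  | add s t hs ht => exact add _ _ hs ht

/-- The left action of `a : A` on an element `m` of a bimodule: `m ↦ a m`. -/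
def leftAct {M : Bimod k A} (a : A) (m : M) : M := (a ⊗ₜ[k] (1 : Aᵐᵒᵖ) : A ⊗[k] Aᵐᵒᵖ) • m

lemma leftAct_rightAct {M : Bimod k A} (a b : A) (m : M) :
    leftAct a (rightAct m b) = rightAct (leftAct a m) b := by
  rw [leftAct, leftAct, rightAct, rightAct, smul_smul, smul_smul,
    Algebra.TensorProduct.tmul_mul_tmul, Algebra.TensorProduct.tmul_mul_tmul]
  simp

/-- The additive map out of `M ⊗_ℤ N` given by a biadditive map. -/
def preTensorLift {M : Bimod k A} {N : ModuleCat.{u} A} {L : Type*} [AddCommGroup L]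
    (f : M →+ N →+ L) : leftMod M ⊗[ℤ] N →+ L :=
  TensorProduct.liftAddHom (R := ℤ) (M := leftMod M) (N := N) (show leftMod M →+ N →+ L from f)
    (fun r m y => by rw [map_zsmul, map_zsmul]; rfl)

/-- The submodule `balanced M N` is spanned over `A`, while `preTensorLift f` is only additive,
hence the additional factor `a`. -/
lemma preTensorLift_eq_zero {M : Bimod k A} {N : ModuleCat.{u} A} {L : Type*} [AddCommGroup L]
    (f : M →+ N →+ L) (hf : ∀ m a y, f (rightAct m a) y = f m (a • y))
    (t : leftMod M ⊗[ℤ] N) (ht : t ∈ balanced M N) (a : A) : preTensorLift f (a • t) = 0 := by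
  induction ht using Submodule.span_induction generalizing a with
  | mem t ht =>
    obtain ⟨m, r, y, rfl⟩ := ht
    rw [smul_sub, map_sub, sub_eq_zero]
    change f (leftAct a (rightAct m r)) y = f (leftAct a m) (r • y)
    rw [leftAct_rightAct, hf]
  | zero => rw [smul_zero, map_zero]
  | add s t _ _ hs ht => rw [smul_add, map_add, hs, ht, add_zero]
  | smul b t _ ht => rw [smul_smul, ht]

/-- The additive map out of `M ⊗_A N` given by a balanced biadditive map. -/
def tensorLiftAdd {M : Bimod k A} {N : ModuleCat.{u} A} {L : Type*} [AddCommGroup L]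
    (f : M →+ N →+ L) (hf : ∀ m a y, f (rightAct m a) y = f m (a • y)) : tensorObj M N →+ L :=
  QuotientAddGroup.lift (balanced M N).toAddSubgroup (preTensorLift f) fun t ht => by
    simpa using preTensorLift_eq_zero f hf t ht 1

lemma tensorLiftAdd_smul {M : Bimod k A} {N L : ModuleCat.{u} A} (f : M →+ N →+ L)
    (hf : ∀ m a y, f (rightAct m a) y = f m (a • y))
    (hl : ∀ a m y, f (leftAct a m) y = a • f m y) (a : A) (t : tensorObj M N) :
    tensorLiftAdd f hf (a • t) = a • tensorLiftAdd f hf t := by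
  induction t using tmk_induction with
  | zero => rw [smul_zero, map_zero, smul_zero]
  | add s t hs ht => rw [smul_add, map_add, hs, ht, map_add, smul_add]
  | tmk m y => exact hl a m y

/-- The `A`-linear map out of `M ⊗_A N` given by a balanced biadditive map that is linear in its
first argument. -/
def tensorLift {M : Bimod k A} {N L : ModuleCat.{u} A} (f : M →+ N →+ L)
    (hf : ∀ m a y, f (rightAct m a) y = f m (a • y))
    (hl : ∀ a m y, f (leftAct a m) y = a • f m y) : tensorObj M N ⟶ L :=
  ModuleCat.ofHom
    { toFun := tensorLiftAdd f hf
      map_add' := map_add _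
      map_smul' := tensorLiftAdd_smul f hf hl }

instance : (tensorBifunctor k A).Additive where
  map_add {M M' f g} := by
    ext N : 2
    refine tensorObj_hom_ext fun m y => ?_
    exact add_tmk (f.hom m) (g.hom m) y

instance (M : Bimod k A) : ((tensorBifunctor k A).obj M).Additive where
  map_add {N N' f g} := by
    refine tensorObj_hom_ext fun m y => ?_
    exact tmk_add m (f.hom y) (g.hom y)

/-- If `M` is finitely generated as a left module, then so is `M ⊗_A N` for every finitely
generated `N`. -/
lemma finite_tensorObj (M : Bimod k A) (N : ModuleCat.{u} A) (s : Finset M)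
    (hs : ∀ m : M, ∃ c : M → A, m = ∑ i ∈ s, leftAct (c i) i) [Module.Finite A N] :
    Module.Finite A (tensorObj M N) := by
  classical
  obtain ⟨t, ht⟩ := Module.Finite.fg_top (R := A) (M := N)
  refine ⟨⟨(s ×ˢ t).image fun p => tmk p.1 p.2, ?_⟩⟩
  rw [eq_top_iff]
  rintro x -
  induction x using tmk_induction with
  | zero => exact zero_mem _
  | add x y hx hy => exact add_mem hx hy
  | tmk m y =>
    have hy : y ∈ Submodule.span A (t : Set N) := by rw [ht]; trivial
    induction hy using Submodule.span_induction generalizing m with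
    | zero => rw [tmk_zero]; exact zero_mem _
    | add y y' _ _ h h' => rw [tmk_add]; exact add_mem (h m) (h' m)
    | smul a y _ h => rw [tmk_smul]; exact h _
    | mem y hy =>
      obtain ⟨c, hc⟩ := hs m
      have : tmk m y = ∑ i ∈ s, c i • tmk i y := by
        conv_lhs => rw [hc]
        exact map_sum (AddMonoidHom.mk' (fun m : M => tmk m y) fun m m' => add_tmk m m' y) _ _
      rw [this]
      refine sum_mem fun i hi => Submodule.smul_mem _ _ (Submodule.subset_span ?_)
      exact Finset.mem_coe.2 (Finset.mem_image.2 ⟨(i, y), Finset.mem_product.2 ⟨hi, hy⟩, rfl⟩)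

end Tensor

section Unit

variable (k : Type u) [Field k] (n : ℕ)

/-- The bimodule `Γ_n`. -/
abbrev gamBimod : Bimod k (Gam k n) := ModuleCat.of _ (GamBi k n)

variable {k n}

/-- The element `a` of the bimodule `Γ_n`. -/
def toBi (a : Gam k n) : gamBimod k n := (show GamBi k n from a)

lemma smul_toBi (a b : Gam k n) (c : (Gam k n)ᵐᵒᵖ) :
    (a ⊗ₜ[k] c : Gam k n ⊗[k] (Gam k n)ᵐᵒᵖ) • toBi b = toBi (a * (b * c.unop)) := rfl

lemma rightAct_toBi (a b : Gam k n) : rightAct (toBi a) b = toBi (a * b) := by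
  rw [rightAct, smul_toBi, one_mul, unop_op]

lemma leftAct_toBi (a b : Gam k n) : leftAct a (toBi b) = toBi (a * b) := by
  rw [leftAct, smul_toBi, unop_one, mul_one]

lemma tmk_one_smul {N : ModuleCat.{u} (Gam k n)} (a : Gam k n) (y : N) :
    tmk (toBi 1) (a • y) = a • tmk (toBi 1) y := by
  rw [tmk_smul, rightAct_toBi, one_mul, smul_tmk]
  exact congrArg (tmk · y) ((leftAct_toBi a 1).trans (by rw [mul_one])).symm

/-- The biadditive map `(a, y) ↦ a y`. -/
def gamSMul (N : ModuleCat.{u} (Gam k n)) : gamBimod k n →+ N →+ N :=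
  let φ : Gam k n →+ N →+ N := (Module.toAddMonoidEnd (Gam k n) N).toAddMonoidHom
  φ

lemma gamSMul_toBi (N : ModuleCat.{u} (Gam k n)) (a : Gam k n) (y : N) :
    gamSMul N (toBi a) y = a • y := rfl

/-- The isomorphism `Γ_n ⊗ N ≅ N`. -/
def unitIso (N : ModuleCat.{u} (Gam k n)) : tensorObj (gamBimod k n) N ≅ N where
  hom := tensorLift (gamSMul N)
    (fun m a y =>
      have h (c : Gam k n) : gamSMul N (rightAct (toBi c) a) y = gamSMul N (toBi c) (a • y) := by
        rw [rightAct_toBi, gamSMul_toBi, gamSMul_toBi, mul_smul]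
      h m)
    (fun a m y =>
      have h (c : Gam k n) : gamSMul N (leftAct a (toBi c)) y = a • gamSMul N (toBi c) y := by
        rw [leftAct_toBi, gamSMul_toBi, gamSMul_toBi, mul_smul]
      h m)
  inv := ModuleCat.ofHom
    { toFun y := tmk (toBi 1) y
      map_add' y y' := tmk_add _ y y'
      map_smul' := tmk_one_smul }
  hom_inv_id := tensorObj_hom_ext fun m y => by
    change tmk (toBi 1) ((show Gam k n from m) • y) = tmk m y
    rw [tmk_smul, rightAct_toBi, one_mul]
    rfl
  inv_hom_id := by
    ext y
    exact one_smul (Gam k n) y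

/-- The natural isomorphism `Γ_n ⊗ - ≅ 𝟭`. -/
def unitNatIso : (tensorBifunctor k (Gam k n)).obj (gamBimod k n) ≅ 𝟭 _ :=
  NatIso.ofComponents unitIso fun g => tensorObj_hom_ext fun m y =>
    (g.hom.map_smul (show Gam k n from m) y).symm

end Unit

section Projective

variable {k : Type u} [Field k] {n : ℕ} {i j : ℕ}

variable (k n i j) in
/-- The bimodule `P_{i,j}`. -/
abbrev ppBimod : Bimod k (Gam k n) := ModuleCat.of _ (PP k n i j)

/-- The element `p ⊗ f` of the bimodule `P_{i,j}`. -/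
abbrev toPP (p : P k n i) (f : PDual k n j) : ppBimod k n i j := PP.tmul p f

lemma leftAct_toPP (a : Gam k n) (p : P k n i) (f : PDual k n j) :
    leftAct a (toPP p f) = toPP (a • p) f :=
  (PP.smul_tmul a 1 p f).trans (by rw [one_smul])

lemma rightAct_toPP (a : Gam k n) (p : P k n i) (f : PDual k n j) :
    rightAct (toPP p f) a = toPP p (op a • f) :=
  (PP.smul_tmul 1 (op a) p f).trans (by rw [one_smul])

/-- The biadditive map on `P_{i,j}` and `N` with given values on the `p ⊗ f` and `y`. -/
def ppBiadditive {N : ModuleCat.{u} (Gam k n)} {L : Type*} [AddCommGroup L]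
    (φ : P k n i → PDual k n j → N → L)
    (hp : ∀ p p' f y, φ (p + p') f y = φ p f y + φ p' f y)
    (hf : ∀ p f f' y, φ p (f + f') y = φ p f y + φ p f' y)
    (hy : ∀ p f y y', φ p f (y + y') = φ p f y + φ p f y')
    (hk : ∀ (c : k) p f y, φ (c • p) f y = φ p (c • f) y) : ppBimod k n i j →+ N →+ L :=
  let ψ : P k n i ⊗[k] PDual k n j →+ N →+ L := TensorProduct.liftAddHom
    (AddMonoidHom.mk' (fun p => AddMonoidHom.mk' (fun f => AddMonoidHom.mk' (φ p f) (hy p f))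
      fun f f' => AddMonoidHom.ext fun y => hf p f f' y)
      fun p p' => AddMonoidHom.ext fun f => AddMonoidHom.ext fun y => hp p p' f y)
    fun c p f => AddMonoidHom.ext fun y => hk c p f y
  ψ

/-- The additive map out of `P_{i,j} ⊗ N` with given values on the `p ⊗ f ⊗ y`. -/
def ppLiftAdd {N : ModuleCat.{u} (Gam k n)} {L : Type*} [AddCommGroup L]
    (φ : P k n i → PDual k n j → N → L)
    (hp : ∀ p p' f y, φ (p + p') f y = φ p f y + φ p' f y)
    (hf : ∀ p f f' y, φ p (f + f') y = φ p f y + φ p f' y)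
    (hy : ∀ p f y y', φ p f (y + y') = φ p f y + φ p f y')
    (hk : ∀ (c : k) p f y, φ (c • p) f y = φ p (c • f) y)
    (ha : ∀ (a : Gam k n) p f y, φ p (op a • f) y = φ p f (a • y)) :
    tensorObj (ppBimod k n i j) N →+ L :=
  tensorLiftAdd (ppBiadditive φ hp hf hy hk) fun m a y => by
    induction m using PP.induction with
    | zero =>
      have h : rightAct (0 : ppBimod k n i j) a = 0 := smul_zero _
      exact (congrArg (ppBiadditive φ hp hf hy hk · y) h).trans
        ((congrArg (· y) (map_zero (ppBiadditive φ hp hf hy hk))).trans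
          (congrArg (· (a • y)) (map_zero (ppBiadditive φ hp hf hy hk))).symm)
    | add s t hs ht =>
      have h : rightAct (show ppBimod k n i j from s + t) a =
        rightAct (show ppBimod k n i j from s) a + rightAct (show ppBimod k n i j from t) a :=
          smul_add _ _ _
      refine (congrArg (ppBiadditive φ hp hf hy hk · y) h).trans
        ((congrArg (· y) (map_add (ppBiadditive φ hp hf hy hk) _ _)).trans
          ((congrArg₂ (· + ·) hs ht).trans
            (congrArg (· (a • y)) (map_add (ppBiadditive φ hp hf hy hk) _ _)).symm))
    | tmul p f =>
      refine Eq.trans ?_ (ha a p f y)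
      rw [rightAct_toPP]
      rfl

lemma ppLiftAdd_tmk {N : ModuleCat.{u} (Gam k n)} {L : Type*} [AddCommGroup L]
    (φ : P k n i → PDual k n j → N → L) (hp hf hy hk ha) (p : P k n i) (f : PDual k n j) (y : N) :
    ppLiftAdd φ hp hf hy hk ha (tmk (toPP p f) y) = φ p f y := rfl

lemma ppTensor_induction {N : ModuleCat.{u} (Gam k n)}
    {motive : tensorObj (ppBimod k n i j) N → Prop} (t : tensorObj (ppBimod k n i j) N)
    (zero : motive 0) (tmk : ∀ p f y, motive (tmk (toPP p f) y))
    (add : ∀ s t, motive s → motive t → motive (s + t)) : motive t := by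
  induction t using tmk_induction with
  | zero => exact zero
  | add s t hs ht => exact add s t hs ht
  | tmk m y =>
    induction m using PP.induction with
    | zero => rw [zero_tmk]; exact zero
    | add s t hs ht => rw [add_tmk]; exact add _ _ hs ht
    | tmul p f => exact tmk p f y

lemma ppTensor_hom_ext {N L : ModuleCat.{u} (Gam k n)} {φ ψ : tensorObj (ppBimod k n i j) N ⟶ L}
    (h : ∀ p f y, φ.hom (tmk (toPP p f) y) = ψ.hom (tmk (toPP p f) y)) : φ = ψ := by
  ext t
  induction t using ppTensor_induction with
  | zero => rw [map_zero, map_zero]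
  | add s t hs ht => rw [map_add, map_add, hs, ht]
  | tmk p f y => exact h p f y

lemma ppLiftAdd_smul {N L : ModuleCat.{u} (Gam k n)} (φ : P k n i → PDual k n j → N → L)
    (hp hf hy hk ha) (hl : ∀ (a : Gam k n) p f y, φ (a • p) f y = a • φ p f y) (a : Gam k n)
    (t : tensorObj (ppBimod k n i j) N) :
    ppLiftAdd φ hp hf hy hk ha (a • t) = a • ppLiftAdd φ hp hf hy hk ha t := by
  induction t using ppTensor_induction with
  | zero => rw [smul_zero, map_zero, smul_zero]
  | add s t hs ht => rw [smul_add, map_add, hs, ht, map_add, smul_add]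
  | tmk p f y =>
    refine Eq.trans ?_ (hl a p f y)
    rw [← ppLiftAdd_tmk φ hp hf hy hk ha, ← leftAct_toPP]
    rfl

/-- The linear map out of `P_{i,j} ⊗ N` with given values on the `p ⊗ f ⊗ y`. -/
def ppLift {N L : ModuleCat.{u} (Gam k n)} (φ : P k n i → PDual k n j → N → L)
    (hp : ∀ p p' f y, φ (p + p') f y = φ p f y + φ p' f y)
    (hf : ∀ p f f' y, φ p (f + f') y = φ p f y + φ p f' y)
    (hy : ∀ p f y y', φ p f (y + y') = φ p f y + φ p f y')
    (hk : ∀ (c : k) p f y, φ (c • p) f y = φ p (c • f) y)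
    (ha : ∀ (a : Gam k n) p f y, φ p (op a • f) y = φ p f (a • y))
    (hl : ∀ (a : Gam k n) p f y, φ (a • p) f y = a • φ p f y) :
    tensorObj (ppBimod k n i j) N ⟶ L :=
  ModuleCat.ofHom
    { toFun := ppLiftAdd φ hp hf hy hk ha
      map_add' := map_add _
      map_smul' := ppLiftAdd_smul φ hp hf hy hk ha hl }

lemma add_toPP_tmk {N : ModuleCat.{u} (Gam k n)} (p p' : P k n i) (f : PDual k n j) (y : N) :
    tmk (toPP (p + p') f) y = tmk (toPP p f) y + tmk (toPP p' f) y := by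
  rw [← add_tmk]
  exact congrArg (fun t : ppBimod k n i j => tmk t y) (TensorProduct.add_tmul p p' f)

lemma toPP_add_tmk {N : ModuleCat.{u} (Gam k n)} (p : P k n i) (f f' : PDual k n j) (y : N) :
    tmk (toPP p (f + f')) y = tmk (toPP p f) y + tmk (toPP p f') y := by
  rw [← add_tmk]
  exact congrArg (fun t : ppBimod k n i j => tmk t y) (TensorProduct.tmul_add p f f')

lemma toPP_smul_left (c : k) (p : P k n i) (f : PDual k n j) :
    toPP (c • p) f = toPP p (c • f) := TensorProduct.smul_tmul c p f

lemma tmk_toPP_smul {N : ModuleCat.{u} (Gam k n)} (p : P k n i) (f : PDual k n j) (a : Gam k n)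
    (y : N) : tmk (toPP p f) (a • y) = tmk (toPP p (op a • f)) y := by
  rw [tmk_smul, rightAct_toPP]

lemma smul_tmk_toPP {N : ModuleCat.{u} (Gam k n)} (p : P k n i) (f : PDual k n j) (a : Gam k n)
    (y : N) : a • tmk (toPP p f) y = tmk (toPP (a • p) f) y := by
  rw [← leftAct_toPP]
  exact smul_tmk a _ y

lemma e_mul_self (i : ℕ) : e k n i * e k n i = e k n i := by
  simpa [e] using mk_rel k n (Rel.e_mul_self (n := n) i)

lemma e_mul_e {i j : ℕ} (h : i ≠ j) : e k n i * e k n j = 0 := by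
  simpa [e] using mk_rel k n (Rel.e_mul_e (n := n) i j h)

variable (k n i) in
/-- The generator `e_i` of `P_i`. -/
def eP : P k n i := ⟨e k n i, Submodule.mem_span_singleton_self _⟩

lemma coe_mul_e (p : P k n i) : (p : Gam k n) * e k n i = p := by
  obtain ⟨a, ha⟩ := Submodule.mem_span_singleton.1 p.2
  rw [← ha, smul_eq_mul, mul_assoc, e_mul_self]

lemma coe_smul_eP (p : P k n i) : (p : Gam k n) • eP k n i = p :=
  Subtype.ext (coe_mul_e p)

lemma e_smul_eP : e k n i • eP k n i = eP k n i := coe_smul_eP (eP k n i)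

/-- The inclusion `P_j → Γ_n`, which corresponds to `e_j ∈ e_j Γ_n`. -/
abbrev inclP (k : Type u) [Field k] (n j : ℕ) : PDual k n j := (P k n j).subtype

lemma op_smul_inclP (f : PDual k n j) : op (f (eP k n j)) • inclP k n j = f := by
  ext p
  change (p : Gam k n) * f (eP k n j) = f p
  rw [← smul_eq_mul, ← map_smul, coe_smul_eP]

lemma e_mul_dual (f : PDual k n j) : e k n j * f (eP k n j) = f (eP k n j) := by
  rw [← smul_eq_mul, ← map_smul, e_smul_eP]

section Exact

open scoped ModuleCat

/-- The map `P_{i,j} ⊗ N → P_i ⊗_k N`, `p ⊗ f ⊗ y ↦ p ⊗ f(e_j) y`. -/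
def ppToTensor (N : ModuleCat.{u} (Gam k n)) :
    tensorObj (ppBimod k n i j) N →+ P k n i ⊗[k] N :=
  ppLiftAdd (fun p f y => p ⊗ₜ (f (eP k n j) • y))
    (fun p p' f y => TensorProduct.add_tmul _ _ _)
    (fun p f f' y => by rw [← TensorProduct.tmul_add, ← add_smul]; rfl)
    (fun p f y y' => by rw [← TensorProduct.tmul_add, ← smul_add])
    (fun c p f y => by
      rw [TensorProduct.smul_tmul, ← smul_assoc]; rfl)
    (fun a p f y => by rw [smul_smul]; rfl)

/-- The map `P_i ⊗_k N → P_{i,j} ⊗ N`, `p ⊗ y ↦ p ⊗ e_j ⊗ y`. -/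
def tensorToPP (N : ModuleCat.{u} (Gam k n)) :
    P k n i ⊗[k] N →+ tensorObj (ppBimod k n i j) N :=
  TensorProduct.liftAddHom
    (AddMonoidHom.mk' (fun p => AddMonoidHom.mk' (fun y => tmk (toPP p (inclP k n j)) y)
      fun y y' => tmk_add _ y y') fun p p' => AddMonoidHom.ext fun y => add_toPP_tmk p p' _ y)
    fun c p y => by
      change tmk (toPP (c • p) (inclP k n j)) y = tmk (toPP p (inclP k n j)) (c • y)
      rw [toPP_smul_left, ← algebraMap_smul (Gam k n) c y, tmk_toPP_smul]
      congr 2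
      ext x
      change c • (x : Gam k n) = (x : Gam k n) * algebraMap k _ c
      rw [Algebra.smul_def, Algebra.commutes]

lemma tensorToPP_ppToTensor (N : ModuleCat.{u} (Gam k n)) (t : tensorObj (ppBimod k n i j) N) :
    tensorToPP N (ppToTensor N t) = t := by
  induction t using ppTensor_induction with
  | zero => rw [map_zero, map_zero]
  | add s t hs ht => rw [map_add, map_add, hs, ht]
  | tmk p f y =>
    change tmk (toPP p (inclP k n j)) (f (eP k n j) • y) = _
    rw [tmk_toPP_smul, op_smul_inclP]

variable (k n i j) in
/-- The functor `P_{i,j} ⊗ -` is exact, being a retract of `P_i ⊗_k -`. -/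
lemma exact_map_pp (S : ShortComplex (ModuleCat.{u} (Gam k n))) (hS : S.Exact) :
    (S.map ((tensorBifunctor k (Gam k n)).obj (ppBimod k n i j))).Exact := by
  rw [ShortComplex.moduleCat_exact_iff] at hS ⊢
  have hS' : Function.Exact (S.f.hom.restrictScalars k) (S.g.hom.restrictScalars k) := by
    intro y
    refine ⟨fun hy => hS y hy, ?_⟩
    rintro ⟨x, rfl⟩
    exact S.moduleCat_zero_apply x
  have hE := Module.Flat.lTensor_exact (P k n i) hS'
  intro t ht
  have h₁ : ∀ t : tensorObj (ppBimod k n i j) S.X₂,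
      ppToTensor S.X₃ ((tensorMap (𝟙 _) S.g).hom t) =
        (S.g.hom.restrictScalars k).lTensor (P k n i) (ppToTensor S.X₂ t) := fun t => by
    induction t using ppTensor_induction with
    | zero => simp only [map_zero]
    | add s t hs ht => simp only [map_add, hs, ht]
    | tmk p f y =>
      change p ⊗ₜ[k] (f (eP k n j) • S.g.hom y) = p ⊗ₜ[k] (S.g.hom (f (eP k n j) • y))
      rw [map_smul]
  have h₂ : ∀ t : P k n i ⊗[k] S.X₁,
      (tensorMap (𝟙 _) S.f).hom (tensorToPP (j := j) S.X₁ t) =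
        tensorToPP S.X₂ ((S.f.hom.restrictScalars k).lTensor (P k n i) t) := fun t => by
    induction t using TensorProduct.induction_on with
    | zero => simp only [map_zero]
    | add s t hs ht => simp only [map_add, hs, ht]
    | tmul p y => rfl
  have ht' : (S.g.hom.restrictScalars k).lTensor (P k n i) (ppToTensor (j := j) S.X₂ t) = 0 := by
    exact (h₁ t).symm.trans ((congrArg (ppToTensor S.X₃) ht).trans (map_zero _))
  obtain ⟨w, hw⟩ := (hE _).1 ht'
  exact ⟨tensorToPP S.X₁ w, (h₂ w).trans (by rw [hw]; exact tensorToPP_ppToTensor S.X₂ t)⟩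

end Exact

instance : ((tensorBifunctor k (Gam k n)).obj (ppBimod k n i j)).PreservesHomology :=
  Functor.preservesHomology_of_map_exact _ fun S hS => exact_map_pp k n i j S hS

end Projective

/-! ### Maps out of `P_{i,j} ⊗ N` -/

section Adjoint

variable {k : Type u} [Field k] {n : ℕ} {i j : ℕ}

lemma leftAct_mul {A : Type u} [Ring A] [Algebra k A] {M : Bimod k A} (a b : A) (m : M) :
    leftAct (a * b) m = leftAct a (leftAct b m) := by
  rw [leftAct, leftAct, leftAct, smul_smul, Algebra.TensorProduct.tmul_mul_tmul, one_mul]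

lemma leftAct_add {A : Type u} [Ring A] [Algebra k A] {M : Bimod k A} (a : A) (m m' : M) :
    leftAct a (m + m') = leftAct a m + leftAct a m' := smul_add _ _ _

lemma add_leftAct {A : Type u} [Ring A] [Algebra k A] {M : Bimod k A} (a b : A) (m : M) :
    leftAct (a + b) m = leftAct a m + leftAct b m := by
  rw [leftAct, leftAct, leftAct, ← add_smul, TensorProduct.add_tmul]

lemma leftAct_algebraMap {A : Type u} [Ring A] [Algebra k A] {M : Bimod k A} (c : k) (m : M) :
    leftAct (algebraMap k A c) m = rightAct m (algebraMap k A c) := by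
  rw [leftAct, rightAct, Algebra.algebraMap_eq_smul_one, op_smul, op_one, TensorProduct.smul_tmul]

lemma hom_leftAct {A : Type u} [Ring A] [Algebra k A] {M M' : Bimod k A} (φ : M ⟶ M') (a : A)
    (m : M) : φ.hom (leftAct a m) = leftAct a (φ.hom m) := φ.hom.map_smul _ _

lemma hom_rightAct {A : Type u} [Ring A] [Algebra k A] {M M' : Bimod k A} (φ : M ⟶ M') (a : A)
    (m : M) : φ.hom (rightAct m a) = rightAct (φ.hom m) a := φ.hom.map_smul _ _

lemma toPP_add (p : P k n i) (f f' : PDual k n j) : toPP p (f + f') = toPP p f + toPP p f' :=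
  TensorProduct.tmul_add p f f'

lemma algebraMap_smul_P (c : k) (p : P k n i) : algebraMap k (Gam k n) c • p = c • p :=
  algebraMap_smul (Gam k n) c p

lemma op_algebraMap_smul_PDual (c : k) (f : PDual k n j) :
    op (algebraMap k (Gam k n) c) • f = c • f := by
  ext x
  change f x * algebraMap k _ c = c • f x
  rw [Algebra.smul_def, Algebra.commutes]

variable {H : Bimod k (Gam k n)} (φ : ppBimod k n i j ⟶ H)

/-- The map `P_{i,j} ⊗ N → P_{i,i} ⊗ (H ⊗ N)` induced by a bimodule map `φ : P_{i,j} → H`: the map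
`x ⊗ y ⊗ z ↦ x ⊗ e_i ⊗ φ(e_i ⊗ y) ⊗ z`. -/
def adjHom (N : ModuleCat.{u} (Gam k n)) :
    tensorObj (ppBimod k n i j) N ⟶ tensorObj (ppBimod k n i i) (tensorObj H N) :=
  ppLift (fun x y z => tmk (toPP x (inclP k n i)) (tmk (φ.hom (toPP (eP k n i) y)) z))
    (fun x x' y z => add_toPP_tmk _ _ _ _)
    (fun x y y' z => by rw [toPP_add, map_add, add_tmk, tmk_add])
    (fun x y z z' => by rw [tmk_add, tmk_add])
    (fun c x y z => by
      have h : φ.hom (toPP (eP k n i) (c • y)) =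
          leftAct (algebraMap k (Gam k n) c) (φ.hom (toPP (eP k n i) y)) := by
        rw [← toPP_smul_left, ← algebraMap_smul_P, ← leftAct_toPP, hom_leftAct]
      rw [h]
      change _ = tmk (toPP x (inclP k n i)) (algebraMap k (Gam k n) c •
        tmk (φ.hom (toPP (eP k n i) y)) z)
      rw [tmk_toPP_smul, op_algebraMap_smul_PDual, ← toPP_smul_left])
    (fun a x y z => by rw [tmk_smul, ← rightAct_toPP, hom_rightAct])
    (fun a x y z => by rw [smul_tmk_toPP])

lemma adjHom_tmk (N : ModuleCat.{u} (Gam k n)) (x : P k n i) (y : PDual k n j) (z : N) :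
    (adjHom φ N).hom (tmk (toPP x y) z) =
      tmk (toPP x (inclP k n i)) (tmk (φ.hom (toPP (eP k n i) y)) z) := rfl

lemma adjHom_naturality {N N' : ModuleCat.{u} (Gam k n)} (g : N ⟶ N') :
    tensorMap (𝟙 _) g ≫ adjHom φ N' = adjHom φ N ≫ tensorMap (𝟙 _) (tensorMap (𝟙 _) g) :=
  ppTensor_hom_ext fun _ _ _ => rfl

/-- Applied to the differentials of complexes, this makes the maps `adjHom` commute with them. The
map `u` has to be of the form `id ⊗ g`, since `adjHom` reads off `φ` on the `e_i ⊗ y` only. -/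
lemma adjHom_comm {j' : ℕ} {H' : Bimod k (Gam k n)} (φ' : ppBimod k n i j' ⟶ H')
    (u : ppBimod k n i j ⟶ ppBimod k n i j') (g : PDual k n j → PDual k n j')
    (hu : ∀ x y, u.hom (toPP x y) = toPP x (g y)) (v : H ⟶ H') (h : φ ≫ v = u ≫ φ')
    (N : ModuleCat.{u} (Gam k n)) :
    tensorMap u (𝟙 N) ≫ adjHom φ' N =
      adjHom φ N ≫ tensorMap (𝟙 _) (tensorMap v (𝟙 N)) := by
  refine ppTensor_hom_ext fun x y z => ?_
  change (adjHom φ' N).hom (tmk (u.hom (toPP x y)) z) =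
    tmk (toPP x (inclP k n i)) (tmk ((φ ≫ v).hom (toPP (eP k n i) y)) z)
  rw [hu, adjHom_tmk, h, ← hu]
  rfl

/-- The evaluation `P_{i,i} → Γ_n` as a morphism of bimodules. -/
abbrev evHom (k : Type u) [Field k] (n i : ℕ) : ppBimod k n i i ⟶ gamBimod k n :=
  ModuleCat.ofHom (ev k n i)

/-- Up to `Γ_n ⊗ - ≅ 𝟭`, evaluation after `adjHom φ` is `φ ⊗ -`. -/
lemma adjHom_ev (N : ModuleCat.{u} (Gam k n)) :
    adjHom φ N ≫ tensorMap (evHom k n i) (𝟙 _) ≫ (unitIso _).hom = tensorMap φ (𝟙 N) := by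
  refine ppTensor_hom_ext fun x y z => ?_
  change (x : Gam k n) • tmk (φ.hom (toPP (eP k n i) y)) z = tmk (φ.hom (toPP x y)) z
  rw [smul_tmk]
  change tmk (leftAct (x : Gam k n) (φ.hom (toPP (eP k n i) y))) z = _
  rw [← hom_leftAct, leftAct_toPP, coe_smul_eP]

variable (ψ : H →+ PDual k n j) (hψ : ∀ h a, ψ (rightAct h a) = op a • ψ h)

/-- For `x ∈ P_i` and `f ∈ P_i^∨`, the map `H ⊗ N → P_{i,j} ⊗ N`,
`h ⊗ z ↦ x ⊗ ψ(f(e_i) h) ⊗ z`. -/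
def adjInvAux (N : ModuleCat.{u} (Gam k n)) (x : P k n i) (f : PDual k n i) :
    tensorObj H N →+ tensorObj (ppBimod k n i j) N :=
  tensorLiftAdd
    (AddMonoidHom.mk' (fun h => AddMonoidHom.mk'
      (fun z => tmk (toPP x (ψ (leftAct (f (eP k n i)) h))) z) fun z z' => tmk_add _ z z')
      fun h h' => AddMonoidHom.ext fun z => by
        change tmk (toPP x (ψ (leftAct (f (eP k n i)) (h + h')))) z = _
        rw [leftAct_add, map_add, toPP_add_tmk]
        rfl)
    fun h a z => by
      change tmk (toPP x (ψ (leftAct (f (eP k n i)) (rightAct h a)))) z =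
        tmk (toPP x (ψ (leftAct (f (eP k n i)) h))) (a • z)
      rw [leftAct_rightAct, hψ, tmk_toPP_smul]

lemma adjInvAux_tmk (N : ModuleCat.{u} (Gam k n)) (x : P k n i) (f : PDual k n i) (h : H)
    (z : N) : adjInvAux ψ hψ N x f (tmk h z) = tmk (toPP x (ψ (leftAct (f (eP k n i)) h))) z := rfl

/-- The inverse of `adjHom`, for a suitable map `ψ : H → P_j^∨` of right modules: the map
`x ⊗ f ⊗ h ⊗ z ↦ x ⊗ ψ(f(e_i) h) ⊗ z`. -/
def adjInv (N : ModuleCat.{u} (Gam k n)) :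
    tensorObj (ppBimod k n i i) (tensorObj H N) ⟶ tensorObj (ppBimod k n i j) N :=
  ppLift (fun x f t => adjInvAux ψ hψ N x f t)
    (fun x x' f t => by
      induction t using tmk_induction with
      | zero => simp only [map_zero, add_zero]
      | add s t hs ht => rw [map_add, hs, ht, map_add, map_add]; abel
      | tmk h z => simp only [adjInvAux_tmk, add_toPP_tmk])
    (fun x f f' t => by
      induction t using tmk_induction with
      | zero => simp only [map_zero, add_zero]
      | add s t hs ht => rw [map_add, hs, ht, map_add, map_add]; abel
      | tmk h z =>
        simp only [adjInvAux_tmk]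
        rw [LinearMap.add_apply, add_leftAct, map_add, toPP_add_tmk])
    (fun x f t t' => map_add _ _ _)
    (fun c x f t => by
      induction t using tmk_induction with
      | zero => simp only [map_zero]
      | add s t hs ht => rw [map_add, hs, ht, map_add]
      | tmk h z =>
        rw [adjInvAux_tmk, adjInvAux_tmk, LinearMap.smul_apply, Algebra.smul_def, leftAct_mul,
          leftAct_algebraMap, hψ, op_algebraMap_smul_PDual, toPP_smul_left])
    (fun a x f t => by
      induction t using tmk_induction with
      | zero => simp only [map_zero, smul_zero]
      | add s t hs ht => rw [map_add, hs, ht, smul_add, map_add]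
      | tmk h z =>
        rw [adjInvAux_tmk, smul_tmk]
        change _ = adjInvAux ψ hψ N x f (tmk (leftAct a h) z)
        rw [adjInvAux_tmk, ← leftAct_mul]
        rfl)
    (fun a x f t => by
      induction t using tmk_induction with
      | zero => simp only [map_zero, smul_zero]
      | add s t hs ht => rw [map_add, hs, ht, map_add, smul_add]
      | tmk h z => rw [adjInvAux_tmk, adjInvAux_tmk, smul_tmk_toPP])

lemma adjInv_tmk (N : ModuleCat.{u} (Gam k n)) (x : P k n i) (f : PDual k n i)
    (t : tensorObj H N) :
    (adjInv ψ hψ N).hom (tmk (toPP x f) t) = adjInvAux ψ hψ N x f t := rfl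

/-- If `φ(e_i ⊗ -) : P_j^∨ → e_i H` is bijective, with inverse `ψ`, then `adjHom φ` is an
isomorphism. -/
def adjIso (h₁ : ∀ y, ψ (φ.hom (toPP (eP k n i) y)) = y)
    (h₂ : ∀ h, φ.hom (toPP (eP k n i) (ψ (leftAct (e k n i) h))) = leftAct (e k n i) h)
    (N : ModuleCat.{u} (Gam k n)) :
    tensorObj (ppBimod k n i j) N ≅ tensorObj (ppBimod k n i i) (tensorObj H N) where
  hom := adjHom φ N
  inv := adjInv ψ hψ N
  hom_inv_id := ppTensor_hom_ext fun x y z => by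
    change (adjInv ψ hψ N).hom ((adjHom φ N).hom (tmk (toPP x y) z)) = tmk (toPP x y) z
    rw [adjHom_tmk, adjInv_tmk, adjInvAux_tmk]
    change tmk (toPP x (ψ (leftAct (e k n i) (φ.hom (toPP (eP k n i) y))))) z = _
    rw [← hom_leftAct, leftAct_toPP, e_smul_eP, h₁]
  inv_hom_id := ppTensor_hom_ext fun x f t => by
    change (adjHom φ N).hom (adjInvAux ψ hψ N x f t) = tmk (toPP x f) t
    induction t using tmk_induction with
    | zero => rw [map_zero, map_zero, tmk_zero]
    | add s t hs ht => rw [map_add, map_add, hs, ht, tmk_add]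
    | tmk h z =>
      rw [adjInvAux_tmk, adjHom_tmk, ← e_mul_dual, leftAct_mul, h₂, ← leftAct_mul, e_mul_dual]
      change tmk (toPP x (inclP k n i)) (f (eP k n i) • tmk h z) = _
      rw [tmk_toPP_smul, op_smul_inclP]

end Adjoint

/-! ### The standard basis of `Γ_n` -/

section Basis

variable (k : Type u) [Field k] (n : ℕ)

/-- The arrow `α_i : i → i + 1` of `Γ_n`, for `1 ≤ i ≤ n - 1` (and `0` otherwise). -/
def a (i : ℕ) : Gam k n := Gam.mk k n (fa k i)
/-- The generator `x` of `Γ_1` (and `0` for `n ≠ 1`). -/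
def x : Gam k n := Gam.mk k n (fx k)

lemma e_eq_zero {i : ℕ} (h : ¬ (1 ≤ i ∧ i ≤ n)) : e k n i = 0 := by
  simpa [e] using mk_rel k n (Rel.e_range i h)

lemma a_eq_zero {i : ℕ} (h : ¬ (1 ≤ i ∧ i + 1 ≤ n)) : a k n i = 0 := by
  simpa [a] using mk_rel k n (Rel.a_range i h)

lemma b_eq_zero {i : ℕ} (h : ¬ (2 ≤ i ∧ i ≤ n)) : b k n i = 0 := by
  simpa [b] using mk_rel k n (Rel.b_range i h)

lemma x_eq_zero (h : n ≠ 1) : x k n = 0 := by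
  simpa [x] using mk_rel k n (Rel.x_range h)

lemma sum_e : ∑ i ∈ Finset.Icc 1 n, e k n i = 1 := by
  simpa [e] using mk_rel k n (Rel.e_sum (k := k) (n := n))

lemma e_mul_a (i : ℕ) : e k n i * a k n i = a k n i := by
  simpa [e, a] using mk_rel k n (Rel.e_mul_a (n := n) i)

lemma a_mul_e (i : ℕ) : a k n i * e k n (i + 1) = a k n i := by
  simpa [e, a] using mk_rel k n (Rel.a_mul_e (n := n) i)

lemma e_mul_b (i : ℕ) : e k n (i + 1) * b k n (i + 1) = b k n (i + 1) := by
  simpa [e, b] using mk_rel k n (Rel.e_mul_b (n := n) i)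

lemma x_mul_x : x k n * x k n = 0 := by
  simpa [x] using mk_rel k n (Rel.x_sq (k := k) (n := n))

variable {k n}

lemma e_one_of_eq_one (h : n = 1) : e k n 1 = 1 := by
  subst h
  simpa using sum_e k 1

lemma e_mul_x (i : ℕ) : e k n i * x k n = if i = 1 then x k n else 0 := by
  by_cases h : n = 1
  · split_ifs with hi
    · rw [hi, e_one_of_eq_one h, one_mul]
    · rw [e_eq_zero k n (by omega), zero_mul]
  · rw [x_eq_zero k n h, mul_zero, ite_self]

lemma x_mul_e (i : ℕ) : x k n * e k n i = if i = 1 then x k n else 0 := by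
  by_cases h : n = 1
  · split_ifs with hi
    · rw [hi, e_one_of_eq_one h, mul_one]
    · rw [e_eq_zero k n (by omega), mul_zero]
  · rw [x_eq_zero k n h, zero_mul, ite_self]

lemma mul_eq_zero_of_ne {u v : Gam k n} {i j : ℕ} (hu : u * e k n i = u) (hv : e k n j * v = v)
    (h : i ≠ j) : u * v = 0 := by
  rw [← hu, ← hv, mul_assoc, ← mul_assoc (e k n i), e_mul_e h, zero_mul, mul_zero]

lemma a_mul_a (i j : ℕ) : a k n i * a k n j = 0 := by
  by_cases hj : i + 1 = j
  · by_cases h : 2 ≤ j ∧ j + 1 ≤ n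
    · obtain rfl : i = j - 1 := by omega
      simpa [a] using mk_rel k n (Rel.aa (k := k) j h.1 h.2)
    · by_cases h' : 1 ≤ j ∧ j + 1 ≤ n
      · rw [a_eq_zero k n (i := i) (by omega), zero_mul]
      · rw [a_eq_zero k n h', mul_zero]
  · exact mul_eq_zero_of_ne (a_mul_e k n i) (e_mul_a k n j) hj

lemma b_mul_b' (i j : ℕ) : b k n i * b k n j = 0 := by
  obtain _ | i := i
  · rw [b_eq_zero k n (by omega), zero_mul]
  obtain _ | j := j
  · rw [b_eq_zero k n (i := 0) (by omega), mul_zero]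
  by_cases hj : i = j + 1
  · subst hj
    exact b_mul_b k n _
  · exact mul_eq_zero_of_ne (b_mul_e k n i) (e_mul_b k n j) hj

lemma a_mul_b_eq {i : ℕ} (h : 2 ≤ i) (h' : i + 1 ≤ n) :
    a k n i * b k n (i + 1) = b k n i * a k n (i - 1) := by
  simpa [a, b] using mk_rel k n (Rel.ab (k := k) i h h')

/-- For `n ≥ 3` and `i = 1`, this follows from the relation `α_2 β_3 = β_2 α_1`; for `n = 2`, it is
one of the defining relations. -/
lemma a_mul_b_mul_a (i : ℕ) : a k n i * b k n (i + 1) * a k n i = 0 := by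
  by_cases h : 1 ≤ i ∧ i + 1 ≤ n
  · by_cases h2 : 2 ≤ i
    · rw [a_mul_b_eq h2 h.2, mul_assoc, a_mul_a, mul_zero]
    · obtain rfl : i = 1 := by omega
      by_cases hn : n = 2
      · simpa [a, b] using mk_rel k n (Rel.aba (k := k) hn)
      · have := a_mul_b_eq (k := k) (n := n) (i := 2) le_rfl (by omega)
        rw [mul_assoc, ← this, ← mul_assoc, a_mul_a, zero_mul]
  · rw [a_eq_zero k n h, mul_zero]

lemma b_mul_a_mul_b (i : ℕ) : b k n (i + 1) * a k n i * b k n (i + 1) = 0 := by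
  by_cases h : 1 ≤ i ∧ i + 1 ≤ n
  · by_cases h2 : 2 ≤ i
    · rw [mul_assoc, a_mul_b_eq h2 h.2, ← mul_assoc, b_mul_b', zero_mul]
    · obtain rfl : i = 1 := by omega
      by_cases hn : n = 2
      · simpa [a, b] using mk_rel k n (Rel.bab (k := k) hn)
      · have := a_mul_b_eq (k := k) (n := n) (i := 2) le_rfl (by omega)
        rw [← this, mul_assoc, b_mul_b', mul_zero]
  · rw [a_eq_zero k n h, mul_zero, zero_mul]

variable (k n) in
/-- The paths `e_i`, `α_i`, `β_i`, `α_i β_{i+1}`, `β_{i+1} α_i`, and `x` for `n = 1`. The nonzero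
ones among them form the standard basis of `Γ_n`, up to the repetitions that the relations
`α_i β_{i+1} = β_i α_{i-1}` cause. Only that they span `Γ_n` is needed. -/
inductive IsPath : Gam k n → Prop
  | e (i : ℕ) : IsPath (e k n i)
  | a (i : ℕ) : IsPath (a k n i)
  | b (i : ℕ) : IsPath (b k n (i + 1))
  | ab (i : ℕ) : IsPath (a k n i * b k n (i + 1))
  | ba (i : ℕ) : IsPath (b k n (i + 1) * a k n i)
  | x : IsPath (x k n)

lemma IsPath.exists_e_mul {w : Gam k n} (h : IsPath k n w) :
    ∃ i, SphericalTwist.e k n i * w = w := by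
  induction h with
  | e i => exact ⟨i, e_mul_self i⟩
  | a i => exact ⟨i, e_mul_a k n i⟩
  | b i => exact ⟨i + 1, e_mul_b k n i⟩
  | ab i => exact ⟨i, by rw [← mul_assoc, e_mul_a]⟩
  | ba i => exact ⟨i + 1, by rw [← mul_assoc, e_mul_b]⟩
  | x => exact ⟨1, by rw [e_mul_x, if_pos rfl]⟩

lemma IsPath.e_mul {w : Gam k n} (h : IsPath k n w) (i : ℕ) :
    SphericalTwist.e k n i * w = w ∨ SphericalTwist.e k n i * w = 0 := by
  obtain ⟨j, hj⟩ := h.exists_e_mul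
  by_cases hij : i = j
  · exact Or.inl (hij ▸ hj)
  · exact Or.inr (mul_eq_zero_of_ne (e_mul_self i) hj hij)

lemma IsPath.a_mul {w : Gam k n} (h : IsPath k n w) (i : ℕ) :
    IsPath k n (SphericalTwist.a k n i * w) ∨ SphericalTwist.a k n i * w = 0 := by
  induction h with
  | e j =>
    by_cases hj : i + 1 = j
    · exact Or.inl (by rw [← hj, a_mul_e]; exact .a i)
    · exact Or.inr (mul_eq_zero_of_ne (a_mul_e k n i) (e_mul_self j) hj)
  | a j => exact Or.inr (a_mul_a i j)
  | b j =>
    by_cases hj : i = j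
    · exact Or.inl (hj ▸ .ab i)
    · exact Or.inr (mul_eq_zero_of_ne (a_mul_e k n i) (e_mul_b k n j) (by omega))
  | ab j => exact Or.inr (by rw [← mul_assoc, a_mul_a, zero_mul])
  | ba j =>
    right
    by_cases hj : i = j
    · rw [← mul_assoc, hj, a_mul_b_mul_a]
    · rw [← mul_assoc, mul_eq_zero_of_ne (a_mul_e k n i) (e_mul_b k n j) (by omega), zero_mul]
  | x =>
    right
    by_cases hn : n = 1
    · rw [a_eq_zero k n (by omega), zero_mul]
    · rw [x_eq_zero k n hn, mul_zero]

lemma IsPath.b_mul {w : Gam k n} (h : IsPath k n w) (i : ℕ) :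
    IsPath k n (SphericalTwist.b k n i * w) ∨ SphericalTwist.b k n i * w = 0 := by
  obtain _ | i := i
  · exact Or.inr (by rw [b_eq_zero k n (by omega), zero_mul])
  induction h with
  | e j =>
    by_cases hj : i = j
    · exact Or.inl (by rw [← hj, b_mul_e]; exact .b i)
    · exact Or.inr (mul_eq_zero_of_ne (b_mul_e k n i) (e_mul_self j) hj)
  | a j =>
    by_cases hj : i = j
    · exact Or.inl (hj ▸ .ba i)
    · exact Or.inr (mul_eq_zero_of_ne (b_mul_e k n i) (e_mul_a k n j) hj)
  | b j => exact Or.inr (b_mul_b' _ _)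
  | ab j =>
    right
    by_cases hj : i = j
    · rw [← mul_assoc, hj, b_mul_a_mul_b]
    · rw [← mul_assoc, mul_eq_zero_of_ne (b_mul_e k n i) (e_mul_a k n j) hj, zero_mul]
  | ba j => exact Or.inr (by rw [← mul_assoc, b_mul_b', zero_mul])
  | x =>
    right
    by_cases hn : n = 1
    · rw [b_eq_zero k n (by omega), zero_mul]
    · rw [x_eq_zero k n hn, mul_zero]

lemma IsPath.x_mul {w : Gam k n} (h : IsPath k n w) :
    IsPath k n (SphericalTwist.x k n * w) ∨ SphericalTwist.x k n * w = 0 := by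
  by_cases hn : n = 1
  · induction h with
    | e j =>
      rw [x_mul_e]
      split_ifs
      · exact Or.inl .x
      · exact Or.inr rfl
    | a j => exact Or.inr (by rw [a_eq_zero k n (by omega), mul_zero])
    | b j => exact Or.inr (by rw [b_eq_zero k n (by omega), mul_zero])
    | ab j => exact Or.inr (by rw [b_eq_zero k n (by omega), mul_zero, mul_zero])
    | ba j => exact Or.inr (by rw [b_eq_zero k n (by omega), zero_mul, mul_zero])
    | x => exact Or.inr (x_mul_x k n)
  · exact Or.inr (by rw [x_eq_zero k n hn, zero_mul])

/-- The span of the paths is stable under left multiplication by the generators of `Γ_n`. -/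
lemma IsPath.gen_mul {w : Gam k n} (h : IsPath k n w) (g : Gen) :
    Gam.mk k n (FreeAlgebra.ι k g) * w ∈ Submodule.span k {w | IsPath k n w} := by
  have key : ∀ v : Gam k n, IsPath k n v ∨ v = 0 → v ∈ Submodule.span k {w | IsPath k n w} := by
    rintro v (hv | rfl)
    · exact Submodule.subset_span hv
    · exact zero_mem _
  refine key _ ?_
  cases g with
  | e i => exact (h.e_mul i).imp (fun h' => (congrArg _ h').mpr h) id
  | a i => exact h.a_mul i
  | b i => exact h.b_mul i
  | x => exact h.x_mul

lemma Gam.mk_surjective : Function.Surjective (Gam.mk k n) :=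
  RingQuot.mkAlgHom_surjective k (Rel k n)

variable (k n) in
lemma span_isPath : Submodule.span k {w | IsPath k n w} = ⊤ := by
  have key : ∀ (t : FreeAlgebra k Gen), ∀ w ∈ Submodule.span k {w | IsPath k n w},
      Gam.mk k n t * w ∈ Submodule.span k {w | IsPath k n w} := by
    intro t
    induction t using FreeAlgebra.induction with
    | grade0 c =>
      intro w hw
      rw [AlgHom.commutes, ← Algebra.smul_def]
      exact Submodule.smul_mem _ c hw
    | grade1 g =>
      intro w hw
      induction hw using Submodule.span_induction with
      | mem w hw => exact IsPath.gen_mul hw g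
      | zero => rw [mul_zero]; exact zero_mem _
      | add _ _ _ _ h h' => rw [mul_add]; exact add_mem h h'
      | smul c _ _ h => rw [mul_smul_comm]; exact Submodule.smul_mem _ c h
    | mul s t hs ht =>
      intro w hw
      rw [map_mul, mul_assoc]
      exact hs _ (ht _ hw)
    | add s t hs ht =>
      intro w hw
      rw [map_add, add_mul]
      exact add_mem (hs _ hw) (ht _ hw)
  refine eq_top_iff.2 fun w _ => ?_
  obtain ⟨t, rfl⟩ := Gam.mk_surjective w
  rw [← mul_one (Gam.mk k n t), ← sum_e]
  exact key t _ (sum_mem fun i _ => Submodule.subset_span (IsPath.e i))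

lemma finite_range_of_eq_zero {R : Type*} [Zero R] (f : ℕ → R) (N : ℕ)
    (h : ∀ i, N < i → f i = 0) : (Set.range f).Finite := by
  refine (((Set.finite_Iic N).image f).union (Set.finite_singleton 0)).subset ?_
  rintro _ ⟨i, rfl⟩
  by_cases hi : i ≤ N
  · exact Or.inl ⟨i, hi, rfl⟩
  · exact Or.inr (h i (by omega))

variable (k n) in
lemma finite_isPath : {w | IsPath k n w}.Finite := by
  have ha : ∀ i, n < i → a k n i = 0 := fun i hi => a_eq_zero k n (by omega)
  refine ((finite_range_of_eq_zero (e k n) n fun i hi => e_eq_zero k n (by omega)).union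
    ((finite_range_of_eq_zero (a k n) n ha).union
    ((finite_range_of_eq_zero (fun i => b k n (i + 1)) n fun i hi => b_eq_zero k n (by omega)).union
    ((finite_range_of_eq_zero (fun i => a k n i * b k n (i + 1)) n fun i hi => by
      rw [ha i hi, zero_mul]).union
    ((finite_range_of_eq_zero (fun i => b k n (i + 1) * a k n i) n fun i hi => by
      rw [ha i hi, mul_zero]).union (Set.finite_singleton (x k n))))))).subset ?_
  rintro _ (i | i | i | i | i | _) <;> simp

instance : Module.Finite k (Gam k n) :=
  ⟨⟨(finite_isPath k n).toFinset, by rw [Set.Finite.coe_toFinset]; exact span_isPath k n⟩⟩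

end Basis

section Coefficient

variable (k : Type u) [Field k] {n m : ℕ}

/-- The values on the generators of the representation `k → k` of the arrow `β_{m+1}`, as a
representation of the quiver that vanishes at all vertices other than `m` and `m + 1`. -/
def repGen (m : ℕ) : Gen → Matrix (Fin 2) (Fin 2) k
  | .e i => if i = m + 1 then .single 0 0 1 else if i = m then .single 1 1 1 else 0
  | .a _ => 0
  | .b i => if i = m + 1 then .single 0 1 1 else 0
  | .x => 0

lemma single_add_single : (Matrix.single 0 0 1 + Matrix.single 1 1 1 : Matrix (Fin 2) (Fin 2) k) =
    1 := by
  ext i j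
  fin_cases i <;> fin_cases j <;> simp

lemma repGen_rel (h1 : 1 ≤ m) (h2 : m + 1 ≤ n) ⦃s t : FreeAlgebra k Gen⦄ (h : Rel k n s t) :
    FreeAlgebra.lift k (repGen k m) s = FreeAlgebra.lift k (repGen k m) t := by
  induction h with
  | e_range i h =>
    simp only [FreeAlgebra.lift_ι_apply, map_zero, repGen]
    rw [if_neg (by omega), if_neg (by omega)]
  | a_range i h => simp [repGen]
  | b_range i h =>
    simp only [FreeAlgebra.lift_ι_apply, map_zero, repGen]
    rw [if_neg (by omega)]
  | x_range h => simp [repGen]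
  | e_sum =>
    have hm : ∀ i, (repGen k m (.e i) : Matrix (Fin 2) (Fin 2) k) =
        (if i = m + 1 then .single 0 0 1 else 0) + (if i = m then .single 1 1 1 else 0) := by
      intro i
      by_cases h : i = m + 1
      · simp [repGen, h]
      · simp [repGen, h]
    simp only [map_sum, FreeAlgebra.lift_ι_apply, map_one, hm, Finset.sum_add_distrib,
      Finset.sum_ite_eq']
    rw [if_pos (Finset.mem_Icc.2 (by omega)), if_pos (Finset.mem_Icc.2 (by omega)),
      single_add_single]
  | e_mul_self i =>
    simp only [map_mul, FreeAlgebra.lift_ι_apply, repGen]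
    split_ifs <;> simp
  | e_mul_e i j h =>
    simp only [map_mul, FreeAlgebra.lift_ι_apply, repGen, map_zero]
    split_ifs <;> first | omega | simp
  | e_mul_a i => simp [repGen]
  | a_mul_e i => simp [repGen]
  | e_mul_b i =>
    simp only [map_mul, FreeAlgebra.lift_ι_apply, repGen]
    split_ifs <;> simp
  | b_mul_e i =>
    simp only [map_mul, FreeAlgebra.lift_ι_apply, repGen]
    split_ifs <;> first | omega | simp
  | x_sq => simp [repGen]
  | aba h => simp [repGen]
  | bab h => simp [repGen]
  | aa i _ _ => simp [repGen]
  | bb i _ _ =>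
    simp only [map_mul, FreeAlgebra.lift_ι_apply, repGen, map_zero]
    split_ifs <;> first | omega | simp
  | ab i _ _ => simp [repGen]

/-- The representation `k → k` of the arrow `β_{m+1}`, as an algebra map to matrices. -/
def rep (h1 : 1 ≤ m) (h2 : m + 1 ≤ n) : Gam k n →ₐ[k] Matrix (Fin 2) (Fin 2) k :=
  RingQuot.liftAlgHom k ⟨FreeAlgebra.lift k (repGen k m), repGen_rel k h1 h2⟩

lemma rep_mk (h1 : 1 ≤ m) (h2 : m + 1 ≤ n) (t : FreeAlgebra k Gen) :
    rep k h1 h2 (Gam.mk k n t) = FreeAlgebra.lift k (repGen k m) t :=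
  RingQuot.liftAlgHom_mkAlgHom_apply ..

/-- The coefficient of `β_{m+1}` in an element of `Γ_n`, read off from the representation `rep`. It
shows in particular that `β_{m+1}` is not zero in `Γ_n`. -/
def coeffB (h1 : 1 ≤ m) (h2 : m + 1 ≤ n) : Gam k n →ₗ[k] k where
  toFun w := rep k h1 h2 w 0 1
  map_add' u v := by rw [map_add]; rfl
  map_smul' c u := by rw [map_smul]; rfl

lemma coeffB_b (h1 : 1 ≤ m) (h2 : m + 1 ≤ n) : coeffB k h1 h2 (b k n (m + 1)) = 1 := by
  change rep k h1 h2 (Gam.mk k n _) 0 1 = 1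
  rw [rep_mk]
  simp [repGen]

lemma coeffB_e (h1 : 1 ≤ m) (h2 : m + 1 ≤ n) (i : ℕ) : coeffB k h1 h2 (e k n i) = 0 := by
  change rep k h1 h2 (Gam.mk k n _) 0 1 = 0
  rw [rep_mk]
  simp only [FreeAlgebra.lift_ι_apply, repGen]
  split_ifs <;> simp

lemma coeffB_b_of_ne (h1 : 1 ≤ m) (h2 : m + 1 ≤ n) {i : ℕ} (h : i ≠ m + 1) :
    coeffB k h1 h2 (b k n i) = 0 := by
  change rep k h1 h2 (Gam.mk k n _) 0 1 = 0
  rw [rep_mk]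
  simp [repGen, h]

lemma rep_a (h1 : 1 ≤ m) (h2 : m + 1 ≤ n) (i : ℕ) : rep k h1 h2 (a k n i) = 0 := by
  rw [a, rep_mk]
  simp [repGen]

/-- `e_{m+1} Γ_n e_m` is spanned by `β_{m+1}`. -/
lemma e_mul_mul_e (h1 : 1 ≤ m) (h2 : m + 1 ≤ n) (w : Gam k n) :
    e k n (m + 1) * w * e k n m = coeffB k h1 h2 w • b k n (m + 1) := by
  have hw : w ∈ Submodule.span k {w | IsPath k n w} := span_isPath k n ▸ Submodule.mem_top
  induction hw using Submodule.span_induction with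
  | zero => simp
  | add u v _ _ hu hv => rw [mul_add, add_mul, hu, hv, map_add, add_smul]
  | smul c u _ hu => rw [mul_smul_comm, smul_mul_assoc, hu, map_smul, smul_assoc]
  | mem w hw =>
    have hab : ∀ i, coeffB k h1 h2 (a k n i) = 0 := fun i => by
      change rep k h1 h2 _ 0 1 = 0
      rw [rep_a]
      rfl
    cases hw with
    | e i =>
      rw [coeffB_e, zero_smul]
      by_cases hi : m + 1 = i
      · rw [← hi, e_mul_self, e_mul_e (by omega)]
      · rw [e_mul_e hi, zero_mul]
    | a i =>
      rw [hab, zero_smul]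
      by_cases hi : m + 1 = i
      · rw [mul_assoc, mul_eq_zero_of_ne (a_mul_e k n i) (e_mul_self m) (by omega), mul_zero]
      · rw [mul_eq_zero_of_ne (e_mul_self _) (e_mul_a k n i) hi, zero_mul]
    | b i =>
      by_cases hi : m = i
      · rw [← hi, e_mul_b, b_mul_e, coeffB_b, one_smul]
      · rw [coeffB_b_of_ne k h1 h2 (by omega), zero_smul, mul_assoc,
          mul_eq_zero_of_ne (b_mul_e k n i) (e_mul_self m) (by omega), mul_zero]
    | ab i =>
      have : coeffB k h1 h2 (a k n i * b k n (i + 1)) = 0 := by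
        change rep k h1 h2 _ 0 1 = 0
        rw [map_mul, rep_a, zero_mul]
        rfl
      rw [this, zero_smul]
      by_cases hi : m = i
      · rw [← mul_assoc, mul_eq_zero_of_ne (e_mul_self _) (e_mul_a k n i) (by omega), zero_mul,
          zero_mul]
      · rw [mul_assoc, mul_assoc,
          mul_eq_zero_of_ne (b_mul_e k n i) (e_mul_self m) (by omega), mul_zero, mul_zero]
    | ba i =>
      have : coeffB k h1 h2 (b k n (i + 1) * a k n i) = 0 := by
        change rep k h1 h2 _ 0 1 = 0
        rw [map_mul, rep_a, mul_zero]
        rfl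
      rw [this, zero_smul]
      by_cases hi : m = i
      · rw [mul_assoc, mul_assoc,
          mul_eq_zero_of_ne (a_mul_e k n i) (e_mul_self m) (by omega), mul_zero, mul_zero]
      · rw [← mul_assoc, mul_eq_zero_of_ne (e_mul_self _) (e_mul_b k n i) (by omega), zero_mul,
          zero_mul]
    | x => rw [x_eq_zero k n (by omega), map_zero, zero_smul, mul_zero, zero_mul]

/-- `e_{m+1} Γ_n e_i = 0` for `i < m`. -/
lemma e_mul_mul_e_of_lt {i : ℕ} (h : i < m) (w : Gam k n) : e k n (m + 1) * w * e k n i = 0 := by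
  have hw : w ∈ Submodule.span k {w | IsPath k n w} := span_isPath k n ▸ Submodule.mem_top
  induction hw using Submodule.span_induction with
  | zero => simp
  | add u v _ _ hu hv => rw [mul_add, add_mul, hu, hv, add_zero]
  | smul c u _ hu => rw [mul_smul_comm, smul_mul_assoc, hu, smul_zero]
  | mem w hw =>
    -- a path from `s` to `t` with `s = m + 1` has `t ≥ m`
    have key : ∀ (w : Gam k n) (s t : ℕ), e k n s * w = w → w * e k n t = w →
        (s = m + 1 → t ≠ i) → e k n (m + 1) * w * e k n i = 0 := by
      intro w s t hs ht hst
      by_cases h : m + 1 = s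
      · rw [mul_assoc, mul_eq_zero_of_ne ht (e_mul_self i) (hst h.symm), mul_zero]
      · rw [mul_eq_zero_of_ne (e_mul_self _) hs h, zero_mul]
    cases hw with
    | e j => exact key _ j j (e_mul_self j) (e_mul_self j) (by omega)
    | a j => exact key _ j (j + 1) (e_mul_a k n j) (a_mul_e k n j) (by omega)
    | b j => exact key _ (j + 1) j (e_mul_b k n j) (b_mul_e k n j) (by omega)
    | ab j =>
      exact key _ j j (by rw [← mul_assoc, e_mul_a]) (by rw [mul_assoc, b_mul_e]) (by omega)
    | ba j =>
      exact key _ (j + 1) (j + 1) (by rw [← mul_assoc, e_mul_b]) (by rw [mul_assoc, a_mul_e])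
        (by omega)
    | x =>
      exact key _ 1 1 (by rw [e_mul_x, if_pos rfl]) (by rw [x_mul_e, if_pos rfl]) (by omega)

end Coefficient

/-! ### Cones and degreewise split extensions of complexes -/

section Enlarge

open CochainComplex HomComplex mappingCone

variable {C : Type*} [Category* C] [Preadditive C]

/-- A degreewise splitting of a morphism of complexes `ι : L ⟶ L'`: in every degree, `L'` is the
direct sum of `L` and of an object `obj p`. -/
structure DegreewiseSplitting {L L' : CochainComplex C ℤ} (ι : L ⟶ L') where
  /-- the complement of `L` in degree `p` -/
  obj (p : ℤ) : C
  /-- the inclusion of the complement -/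
  incl (p : ℤ) : obj p ⟶ L'.X p
  /-- the projection to the complement -/
  proj (p : ℤ) : L'.X p ⟶ obj p
  /-- the projection to `L` -/
  retr (p : ℤ) : L'.X p ⟶ L.X p
  incl_proj (p : ℤ) : incl p ≫ proj p = 𝟙 _
  ι_retr (p : ℤ) : ι.f p ≫ retr p = 𝟙 _
  incl_retr (p : ℤ) : incl p ≫ retr p = 0
  ι_proj (p : ℤ) : ι.f p ≫ proj p = 0
  total (p : ℤ) : proj p ≫ incl p + retr p ≫ ι.f p = 𝟙 _

namespace DegreewiseSplitting

variable {L L' : CochainComplex C ℤ} {ι : L ⟶ L'} (S : DegreewiseSplitting ι)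

lemma proj_incl (p : ℤ) : S.proj p ≫ S.incl p = 𝟙 _ - S.retr p ≫ ι.f p :=
  eq_sub_of_add_eq (S.total p)

/-- The complements of `L` in `L'` form the quotient complex of `L'` by `L`. -/
def quotient : CochainComplex C ℤ where
  X := S.obj
  d p q := S.incl p ≫ L'.d p q ≫ S.proj q
  shape p q h := by rw [L'.shape p q h, zero_comp, comp_zero]
  d_comp_d' p q r _ _ := by
    simp only [Category.assoc]
    rw [← Category.assoc (S.proj q), proj_incl, Preadditive.sub_comp, Preadditive.comp_sub,
      Category.id_comp, L'.d_comp_d_assoc, Category.assoc, ι.comm_assoc, ι_proj]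
    simp

/-- The inclusion of the quotient into `L'`, in every degree. -/
def inclQ (p : ℤ) : S.quotient.X p ⟶ L'.X p := S.incl p

/-- The projection of `L'` to the quotient, in every degree. -/
def projQ (p : ℤ) : L'.X p ⟶ S.quotient.X p := S.proj p

lemma quotient_d (p q : ℤ) : S.quotient.d p q = S.inclQ p ≫ L'.d p q ≫ S.projQ q := rfl

lemma inclQ_projQ (p : ℤ) : S.inclQ p ≫ S.projQ p = 𝟙 _ := S.incl_proj p

lemma inclQ_retr (p : ℤ) : S.inclQ p ≫ S.retr p = 0 := S.incl_retr p

lemma ι_projQ (p : ℤ) : ι.f p ≫ S.projQ p = 0 := S.ι_proj p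

lemma projQ_inclQ (p : ℤ) : S.projQ p ≫ S.inclQ p = 𝟙 _ - S.retr p ≫ ι.f p := S.proj_incl p

/-- The inclusion of the quotient into `L'`, as a cochain. -/
def inclCochain : Cochain S.quotient L' 0 := Cochain.ofHoms S.inclQ

/-- The projection of `L'` to the quotient, as a cochain. -/
def projCochain : Cochain L' S.quotient 0 := Cochain.ofHoms S.projQ

/-- The projection of `L'` to `L`, as a cochain. -/
def retrCochain : Cochain L' L 0 := Cochain.ofHoms S.retr

/-- The component `S.quotient ⟶ L` of degree `1` of the differential of `L'`. -/
def connecting : Cochain S.quotient L 1 :=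
  Cochain.mk fun p q _ => S.inclQ p ≫ L'.d p q ≫ S.retr q

lemma inclCochain_comp_projCochain :
    S.inclCochain.comp S.projCochain (add_zero 0) = Cochain.ofHom (𝟙 S.quotient) := by
  ext p
  simp [inclCochain, projCochain, inclQ_projQ]

lemma inclCochain_comp_retrCochain : S.inclCochain.comp S.retrCochain (add_zero 0) = 0 := by
  ext p
  simp [inclCochain, retrCochain, inclQ_retr]

lemma ofHom_comp_projCochain : (Cochain.ofHom ι).comp S.projCochain (add_zero 0) = 0 := by
  ext p
  simp [projCochain, ι_projQ]

lemma ofHom_comp_retrCochain :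
    (Cochain.ofHom ι).comp S.retrCochain (add_zero 0) = Cochain.ofHom (𝟙 L) := by
  ext p
  simp [retrCochain, ι_retr]

lemma projCochain_comp_add :
    S.projCochain.comp S.inclCochain (add_zero 0) +
      S.retrCochain.comp (Cochain.ofHom ι) (add_zero 0) = Cochain.ofHom (𝟙 L') := by
  ext p
  simp [projCochain, inclCochain, retrCochain, projQ_inclQ]

/-- The inclusion of the quotient is a morphism of complexes up to `connecting`. -/
lemma δ_inclCochain :
    δ 0 1 S.inclCochain = S.connecting.comp (Cochain.ofHom ι) (add_zero 1) := by
  ext p q hpq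
  rw [δ_v 0 1 rfl _ p q hpq p q (by omega) hpq, Cochain.comp_v _ _ _ p q q hpq (add_zero q)]
  simp [inclCochain, connecting, quotient_d, projQ_inclQ, Int.negOnePow_one]

lemma comp_ofHom_injective (S : DegreewiseSplitting ι) {K : CochainComplex C ℤ} {N : ℤ}
    {z z' : Cochain K L N}
    (h : z.comp (Cochain.ofHom ι) (add_zero N) = z'.comp (Cochain.ofHom ι) (add_zero N)) :
    z = z' := by
  ext p q hpq
  have := Cochain.congr_v h p q hpq
  rw [Cochain.comp_v _ _ _ p q q hpq (add_zero q), Cochain.comp_v _ _ _ p q q hpq (add_zero q),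
    Cochain.ofHom_v] at this
  simpa [S.ι_retr] using congrArg (· ≫ S.retr q) this

/-- Checked after composition with `ι`, where `connecting` becomes a coboundary. -/
lemma δ_connecting : δ 1 2 S.connecting = 0 := by
  refine S.comp_ofHom_injective ?_
  rw [← δ_comp_ofHom, ← δ_inclCochain, δ_δ, Cochain.zero_comp]

variable [HasBinaryBiproducts C] {A : CochainComplex C ℤ} {f : L ⟶ A} {f' : L' ⟶ A}
  (hf : ι ≫ f' = f)

/-- The morphism of complexes, from the quotient of `L'` by `L` to the cone of `f : L ⟶ A`, whose
cone is the cone of the extension `f'` of `f` to `L'`. -/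
def toCone : S.quotient ⟶ mappingCone f :=
  mappingCone.lift f (-Cocycle.mk S.connecting 2 rfl S.δ_connecting)
    (S.inclCochain.comp (Cochain.ofHom f') (add_zero 0))
    (by
      rw [δ_comp_ofHom, δ_inclCochain, Cochain.comp_assoc_of_third_is_zero_cochain,
        ← Cochain.ofHom_comp, hf]
      simp)

lemma toCone_f (p q : ℤ) (h : p + 1 = q) :
    (S.toCone hf).f p = -(S.inclQ p ≫ L'.d p q ≫ S.retr q) ≫ (inl f).v q p (by omega) +
      (S.inclQ p ≫ f'.f p) ≫ (inr f).f p := by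
  rw [toCone, mappingCone.lift_f _ _ _ _ p q h,
    Cochain.comp_v _ _ _ p p p (add_zero p) (add_zero p), inclCochain, Cochain.ofHoms_v]
  simp [connecting]

/-- The cone of `f'` is the cone of `toCone`: as graded objects, both are the direct sum of
`S.quotient[1]`, `L[1]` and `A`. -/
def coneToConeIso : mappingCone (S.toCone hf) ≅ mappingCone f' :=
  have hf' : f ≫ 𝟙 A = ι ≫ f' := by rw [hf, Category.comp_id]
  have h₀ : (Cochain.ofHom (mappingCone.map f f' ι (𝟙 A) hf')).comp (fst f' : Cochain _ _ 1)
      (zero_add 1) = (fst f : Cochain _ _ 1).comp (Cochain.ofHom ι) (add_zero 1) := by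
    rw [mappingCone.map, ofHom_desc, ext_cochain_from_iff _ 0 1 (by omega)]
    constructor
    · rw [← Cochain.comp_assoc_of_second_is_zero_cochain, inl_descCochain, inl_fst_assoc,
        Cochain.comp_assoc_of_first_is_zero_cochain, inl_fst, Cochain.comp_id]
    · rw [← Cochain.comp_assoc_of_first_is_zero_cochain, inr_descCochain, inr_fst_assoc,
        Cochain.ofHom_comp, Cochain.comp_assoc_of_first_is_zero_cochain, inr_fst, Cochain.comp_zero]
  have h₀' : (Cochain.ofHom (mappingCone.map f f' ι (𝟙 A) hf')).comp (snd f') (zero_add 0) =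
      snd f := by
    rw [mappingCone.map, ofHom_desc, ext_cochain_from_iff _ (-1) 0 (by omega)]
    constructor
    · rw [← Cochain.comp_assoc_of_third_is_zero_cochain, inl_descCochain, inl_snd,
        Cochain.comp_assoc_of_first_is_zero_cochain, inl_snd, Cochain.comp_zero]
    · rw [← Cochain.comp_assoc_of_first_is_zero_cochain, inr_descCochain, inr_snd,
        Cochain.ofHom_comp, Cochain.comp_assoc_of_first_is_zero_cochain, inr_snd, Cochain.comp_id]
  mappingConeIsoOfSplitting _ (S.inclCochain.comp (inl f') (zero_add (-1)))
    (mappingCone.map f f' ι (𝟙 A) hf')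
    ((fst f' : Cochain _ _ 1).comp S.projCochain (add_zero 1))
    (((fst f' : Cochain _ _ 1).comp S.retrCochain (add_zero 1)).comp (inl f) (add_neg_cancel 1) +
      (snd f').comp (Cochain.ofHom (inr f)) (add_zero 0))
    (by
      rw [δ_comp _ _ (zero_add (-1)) 1 0 0 (by omega) (by omega) (by omega), δ_inl, δ_inclCochain,
        Cochain.ofHom_comp f', Cochain.ofHom_comp (S.toCone hf), toCone, ofHom_lift,
        mappingCone.map, ofHom_desc, liftCochain_descCochain]
      simp [Cochain.comp_assoc_of_second_is_zero_cochain]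
      abel)
    (by
      rw [Cochain.comp_assoc_of_first_is_zero_cochain, inl_fst_assoc,
        inclCochain_comp_projCochain])
    (by
      rw [Cochain.comp_assoc_of_first_is_zero_cochain, Cochain.comp_add,
        Cochain.comp_assoc_of_second_is_zero_cochain, inl_fst_assoc, inl_snd_assoc, add_zero,
        ← Cochain.comp_assoc_of_first_is_zero_cochain, inclCochain_comp_retrCochain,
        Cochain.zero_comp])
    (by
      rw [← Cochain.comp_assoc_of_first_is_zero_cochain, h₀,
        Cochain.comp_assoc_of_second_is_zero_cochain, ofHom_comp_projCochain, Cochain.comp_zero])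
    (by
      rw [Cochain.comp_add, ← Cochain.comp_assoc_of_first_is_zero_cochain,
        ← Cochain.comp_assoc_of_first_is_zero_cochain,
        ← Cochain.comp_assoc_of_first_is_zero_cochain, h₀, h₀',
        Cochain.comp_assoc_of_second_is_zero_cochain,
        Cochain.comp_assoc_of_second_is_zero_cochain,
        ← Cochain.comp_assoc_of_first_is_zero_cochain (Cochain.ofHom ι), ofHom_comp_retrCochain,
        Cochain.id_comp, mappingCone.id])
    (by
      have hm : (inl f).comp (Cochain.ofHom (mappingCone.map f f' ι (𝟙 A) hf')) (add_zero (-1)) =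
          (Cochain.ofHom ι).comp (inl f') (zero_add (-1)) := by
        rw [mappingCone.map, ofHom_desc, inl_descCochain]
      have hm' : (Cochain.ofHom (inr f)).comp (Cochain.ofHom (mappingCone.map f f' ι (𝟙 A) hf'))
          (add_zero 0) = Cochain.ofHom (inr f') := by
        rw [mappingCone.map, ofHom_desc, inr_descCochain, Category.id_comp]
      rw [Cochain.add_comp, Cochain.comp_assoc_of_third_is_zero_cochain, hm,
        Cochain.comp_assoc_of_third_is_zero_cochain, hm', ← add_assoc,
        Cochain.comp_assoc_of_second_is_zero_cochain,
        Cochain.comp_assoc_of_second_is_zero_cochain,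
        ← Cochain.comp_add, ← Cochain.comp_assoc_of_first_is_zero_cochain,
        ← Cochain.comp_assoc_of_first_is_zero_cochain, ← Cochain.add_comp, projCochain_comp_add,
        Cochain.id_comp, mappingCone.id])

end DegreewiseSplitting
end Enlarge

/-! ### The quotients `G_{m+1} / G_m` -/

section Bijective

variable {k : Type u} [Field k] {n : ℕ} {i j : ℕ} {H : Bimod k (Gam k n)}
  (φ : ppBimod k n i j ⟶ H)

lemma toPP_sub (p : P k n i) (f f' : PDual k n j) : toPP p (f - f') = toPP p f - toPP p f' :=
  TensorProduct.tmul_sub p f f'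

lemma eq_of_hom_toPP_eq (hinj : ∀ y, φ.hom (toPP (eP k n i) y) = 0 → y = 0) {y y' : PDual k n j}
    (h : φ.hom (toPP (eP k n i) y) = φ.hom (toPP (eP k n i) y')) : y = y' :=
  sub_eq_zero.1 (hinj _ (by rw [toPP_sub, map_sub, h, sub_self]))

variable (hinj : ∀ y, φ.hom (toPP (eP k n i) y) = 0 → y = 0)
  (hsurj : ∀ h : H, ∃ y, φ.hom (toPP (eP k n i) y) = leftAct (e k n i) h)

/-- If `φ(e_i ⊗ -) : P_j^∨ → e_i H` is bijective, then `P_{i,j} ⊗ N ≅ P_{i,i} ⊗ (H ⊗ N)`. -/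
def adjIsoOfBijective (N : ModuleCat.{u} (Gam k n)) :
    tensorObj (ppBimod k n i j) N ≅ tensorObj (ppBimod k n i i) (tensorObj H N) :=
  adjIso φ
    (AddMonoidHom.mk' (fun h => (hsurj h).choose) fun h h' =>
      eq_of_hom_toPP_eq φ hinj (by
        rw [toPP_add, map_add, (hsurj _).choose_spec, (hsurj _).choose_spec,
          (hsurj _).choose_spec, leftAct_add]))
    (fun h a => eq_of_hom_toPP_eq φ hinj (by
      change φ.hom (toPP (eP k n i) (hsurj _).choose) = _
      rw [(hsurj _).choose_spec, ← rightAct_toPP, hom_rightAct]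
      change _ = rightAct (φ.hom (toPP (eP k n i) (hsurj h).choose)) a
      rw [(hsurj _).choose_spec, leftAct_rightAct]))
    (fun y => eq_of_hom_toPP_eq φ hinj (by
      change φ.hom (toPP (eP k n i) (hsurj _).choose) = _
      rw [(hsurj _).choose_spec, ← hom_leftAct, leftAct_toPP, e_smul_eP]))
    (fun h => by
      change φ.hom (toPP (eP k n i) (hsurj _).choose) = _
      rw [(hsurj _).choose_spec, ← leftAct_mul, e_mul_self])
    N

end Bijective

section Filtration

variable (k : Type u) [Field k] (n m : ℕ)

/-- The map from `G_m` to `G_{m'}` in degree `p` that is the identity on the common summands and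
zero on the other ones. -/
def GX.change (m m' : ℕ) (p : ℤ) :
    GX k n m p →ₗ[Gam k n ⊗[k] (Gam k n)ᵐᵒᵖ] GX k n m' p :=
  DirectSum.toModule _ _ _ fun s => GX.incl k n m' p s.1.1 s.1.2

variable {m} in
lemma GX.change_incl (m' : ℕ) {p : ℤ} {i j : ℕ} (h : IsIdx m p (i, j)) (t : PP k n i j) :
    GX.change k n m m' p (GX.incl k n m p i j t) = GX.incl k n m' p i j t := by
  rw [GX.incl, dif_pos h]
  exact DirectSum.toModule_lof _ _ _

open scoped Classical in
/-- The projection to the summand `P_{i,j}` of `G_m` in degree `p`, or zero if `P_{i,j}` is not a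
summand. -/
def GX.proj (p : ℤ) (i j : ℕ) :
    GX k n m p →ₗ[Gam k n ⊗[k] (Gam k n)ᵐᵒᵖ] PP k n i j :=
  if h : IsIdx m p (i, j) then
    DirectSum.component _ {s : ℕ × ℕ // IsIdx m p s} (fun s => PP k n s.1.1 s.1.2) ⟨(i, j), h⟩
  else 0

variable {m} in
lemma GX.proj_incl {p : ℤ} {i j : ℕ} (h : IsIdx m p (i, j)) (t : PP k n i j) :
    GX.proj k n m p i j (GX.incl k n m p i j t) = t := by
  rw [GX.incl, GX.proj, dif_pos h, dif_pos h]
  exact DirectSum.component.lof_self _ _ _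

lemma GX.proj_incl_of_ne {p : ℤ} {i j i' j' : ℕ} (h : (i, j) ≠ (i', j')) (t : PP k n i j) :
    GX.proj k n m p i' j' (GX.incl k n m p i j t) = 0 := by
  by_cases h₁ : IsIdx m p (i, j)
  · by_cases h₂ : IsIdx m p (i', j')
    · rw [GX.incl, GX.proj, dif_pos h₁, dif_pos h₂]
      refine (DirectSum.component.of ..).trans (dif_neg fun h' => h ?_)
      exact congrArg Subtype.val h'
    · rw [GX.proj, dif_neg h₂, LinearMap.zero_apply]
  · rw [GX.incl_of_not k n m h₁, LinearMap.zero_apply, map_zero]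

variable {m} in
lemma isIdx_succ_iff {p : ℤ} {i j : ℕ} (h : i ≤ m) : IsIdx (m + 1) p (i, j) ↔ IsIdx m p (i, j) := by
  simp only [IsIdx]
  omega

variable {m} in
lemma GX.change_incl_of_le {p : ℤ} {i j : ℕ} (h : i ≤ m) (t : PP k n i j) :
    GX.change k n m (m + 1) p (GX.incl k n m p i j t) = GX.incl k n (m + 1) p i j t := by
  by_cases h' : IsIdx m p (i, j)
  · rw [GX.change_incl k n _ h']
  · rw [GX.incl_of_not k n m h', GX.incl_of_not k n (m + 1) (by rwa [isIdx_succ_iff h]),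
      LinearMap.zero_apply, LinearMap.zero_apply, map_zero]

/-- The inclusion of `G_m` into `G_{m+1}`. -/
def G.incl : G k n m ⟶ G k n (m + 1) where
  f p := ModuleCat.ofHom (GX.change k n m (m + 1) p)
  comm' p q _ := by
    change ModuleCat.ofHom _ ≫ ModuleCat.ofHom (GX.d k n (m + 1) p q) =
      ModuleCat.ofHom (GX.d k n m p q) ≫ ModuleCat.ofHom _
    rw [← ModuleCat.ofHom_comp, ← ModuleCat.ofHom_comp]
    refine congrArg ModuleCat.ofHom (GX.hom_ext k n m fun i j hs x y => ?_)
    obtain ⟨h1, h2, h3, h4⟩ := hs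
    dsimp only at h1 h2 h3 h4
    obtain _ | i := i
    · omega
    have hs : IsIdx m p (i + 1, j) := ⟨h1, h2, h3, h4⟩
    rw [LinearMap.comp_apply, LinearMap.comp_apply, GX.change_incl k n _ hs,
      GX.d_incl_tmul k n m _ hs, GX.d_incl_tmul k n (m + 1) _ ((isIdx_succ_iff h3).2 hs), map_add,
      map_zsmul, GX.change_incl_of_le k n (by omega), GX.change_incl_of_le k n h3]

/-- The evaluation map in degree `0`, as a morphism of bimodules. -/
def G.evZero : (G k n m).X 0 ⟶ ModuleCat.of _ (GamBi k n) := ModuleCat.ofHom (GX.ev k n m)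

lemma G.ev_f_zero : (G.ev k n m).f 0 =
    G.evZero k n m ≫
      (HomologicalComplex.singleObjXSelf (.up ℤ) 0 (ModuleCat.of _ (GamBi k n))).inv :=
  HomologicalComplex.mkHomToSingle_f _ _

lemma G.incl_f_evZero : (G.incl k n m).f 0 ≫ G.evZero k n (m + 1) = G.evZero k n m := by
  refine ModuleCat.hom_ext (GX.hom_ext k n m fun i j hs x y => ?_)
  obtain rfl := IsIdx.eq_of_zero m hs
  change GX.ev k n (m + 1) (GX.change k n m (m + 1) 0 _) = GX.ev k n m _
  rw [GX.change_incl k n _ hs, GX.ev_incl_tmul k n m hs,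
    GX.ev_incl_tmul k n (m + 1) ((isIdx_succ_iff hs.2.2.1).2 hs)]

lemma G.incl_ev : G.incl k n m ≫ G.ev k n (m + 1) = G.ev k n m := by
  refine HomologicalComplex.to_single_hom_ext ?_
  rw [HomologicalComplex.comp_f, G.ev_f_zero, G.ev_f_zero, ← Category.assoc, G.incl_f_evZero]

/-- The index `j` such that `P_{m+1,j}` is a summand of `G_{m+1}` in degree `p`, or `0` if there is
none. -/
def quotIdx (p : ℤ) : ℕ := if p ≤ 0 then (m + 1 + p).toNat else 0

lemma quotIdx_eq_zero_or (p : ℤ) :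
    quotIdx m p = 0 ∨ IsIdx (m + 1) p (m + 1, quotIdx m p) := by
  simp only [quotIdx, IsIdx]
  split_ifs <;> omega

variable {m} in
lemma eq_quotIdx {p : ℤ} {j : ℕ} (h : IsIdx (m + 1) p (m + 1, j)) : j = quotIdx m p := by
  simp only [quotIdx, IsIdx] at h ⊢
  split_ifs <;> omega

/-- As `e_0 = 0`, also `P_0 = 0`. -/
lemma eq_zero_of_index_zero {y : PDual k n 0} : y = 0 := by
  refine LinearMap.ext fun p => ?_
  have : p = 0 := by
    obtain ⟨a, ha⟩ := Submodule.mem_span_singleton.1 p.2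
    rw [e_eq_zero k n (by omega), smul_zero] at ha
    exact Subtype.ext ha.symm
  rw [this, map_zero, map_zero]

lemma PP.eq_zero_of_index_zero {i : ℕ} (t : PP k n i 0) : t = 0 := by
  induction t using PP.induction with
  | zero => rfl
  | tmul p f => rw [SphericalTwist.eq_zero_of_index_zero k n (y := f), PP.tmul_zero']
  | add s t hs ht => rw [hs, ht, add_zero]

/-- In every degree, `G_{m+1}` is the direct sum of `G_m` and of a bimodule `P_{m+1,j}`, where
`P_{m+1,0} = 0` serves in the degrees in which there is no such summand. -/
def G.splitting : DegreewiseSplitting (G.incl k n m) where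
  obj p := ppBimod k n (m + 1) (quotIdx m p)
  incl p := ModuleCat.ofHom (GX.incl k n (m + 1) p (m + 1) (quotIdx m p))
  proj p := ModuleCat.ofHom (GX.proj k n (m + 1) p (m + 1) (quotIdx m p))
  retr p := ModuleCat.ofHom (GX.change k n (m + 1) m p)
  incl_proj p := ModuleCat.hom_ext (LinearMap.ext fun t => by
    obtain h | h := quotIdx_eq_zero_or m p
    · change (_ : PP k n (m + 1) (quotIdx m p)) = t
      generalize quotIdx m p = j at *
      subst h
      rw [PP.eq_zero_of_index_zero k n t, map_zero]
    · exact GX.proj_incl k n h t)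
  ι_retr p := ModuleCat.hom_ext (GX.hom_ext k n m fun i j hs x y => by
    change GX.change k n (m + 1) m p (GX.change k n m (m + 1) p _) = _
    rw [GX.change_incl k n _ hs, GX.change_incl k n _ ((isIdx_succ_iff hs.2.2.1).2 hs)]
    rfl)
  incl_retr p := ModuleCat.hom_ext (LinearMap.ext fun t => by
    change GX.change k n (m + 1) m p (GX.incl k n (m + 1) p (m + 1) (quotIdx m p) t) = 0
    by_cases h : IsIdx (m + 1) p (m + 1, quotIdx m p)
    · rw [GX.change_incl k n _ h, GX.incl_of_not k n m (fun h' => by simp [IsIdx] at h')]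
      rfl
    · rw [GX.incl_of_not k n (m + 1) h, LinearMap.zero_apply, map_zero])
  ι_proj p := ModuleCat.hom_ext (GX.hom_ext k n m fun i j hs x y => by
    change GX.proj k n (m + 1) p (m + 1) (quotIdx m p) (GX.change k n m (m + 1) p _) = 0
    have h : i ≤ m := hs.2.2.1
    rw [GX.change_incl k n _ hs, GX.proj_incl_of_ne]
    intro h'
    simp only [Prod.mk.injEq] at h'
    omega)
  total p := ModuleCat.hom_ext (GX.hom_ext k n (m + 1) fun i j hs x y => by
    change GX.incl k n (m + 1) p (m + 1) (quotIdx m p)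
        (GX.proj k n (m + 1) p (m + 1) (quotIdx m p) _) +
      GX.change k n m (m + 1) p (GX.change k n (m + 1) m p _) =
        GX.incl k n (m + 1) p i j (PP.tmul x y)
    rw [GX.change_incl k n _ hs]
    by_cases h : i = m + 1
    · subst h
      obtain rfl := eq_quotIdx hs
      rw [GX.proj_incl k n hs, GX.incl_of_not k n m (fun h' => by simp [IsIdx] at h'),
        LinearMap.zero_apply, map_zero, add_zero]
    · have h' : i ≤ m := by
        have := hs.2.2.1
        dsimp only at this
        omega
      rw [GX.proj_incl_of_ne, map_zero, zero_add, GX.change_incl_of_le k n h']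
      simpa using fun h' => absurd h' h)

/-- The quotient of `G_{m+1}` by `G_m`, the complex of the bimodules `P_{m+1,j}`. -/
abbrev G.quotient : CochainComplex (Bimod k (Gam k n)) ℤ := (G.splitting k n m).quotient

/-- The map `G_{m+1} / G_m → H_m`, whose cone is `H_{m+1}`. -/
def G.toH : G.quotient k n m ⟶ H k n m := (G.splitting k n m).toCone (G.incl_ev k n m)

/-- `H_{m+1}` is the cone of the map `G_{m+1} / G_m → H_m`. -/
def coneToHIso : CochainComplex.mappingCone (G.toH k n m) ≅ H k n (m + 1) :=
  (G.splitting k n m).coneToConeIso (G.incl_ev k n m)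

lemma GX.exists_proj_d_incl {p : ℤ} (q : ℤ) {j : ℕ} (j' : ℕ) (h : IsIdx (m + 1) p (m + 1, j)) :
    ∃ g : PDual k n j → PDual k n j', ∀ x y,
      GX.proj k n (m + 1) q (m + 1) j' (GX.d k n (m + 1) p q
        (GX.incl k n (m + 1) p (m + 1) j (PP.tmul x y))) = PP.tmul x (g y) := by
  have h₁ : ∀ x y, GX.proj k n (m + 1) q (m + 1) j' (GX.d k n (m + 1) p q
        (GX.incl k n (m + 1) p (m + 1) j (PP.tmul x y))) =
      (p.negOnePow : ℤ) • GX.proj k n (m + 1) q (m + 1) j'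
        (GX.incl k n (m + 1) q (m + 1) (j + 1) (PP.tmul x (lmulB k n j y))) := by
    intro x y
    rw [GX.d_incl_tmul k n _ _ h, map_add, map_zsmul, GX.proj_incl_of_ne, zero_add]
    simp
  by_cases hj : IsIdx (m + 1) q (m + 1, j + 1) ∧ j' = j + 1
  · obtain ⟨hj, rfl⟩ := hj
    refine ⟨fun y => (p.negOnePow : ℤ) • lmulB k n j y, fun x y => ?_⟩
    rw [h₁, GX.proj_incl k n hj]
    exact (map_zsmul (TensorProduct.mk k (P k n (m + 1)) (PDual k n (j + 1)) x) _ _).symm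
  · refine ⟨fun _ => 0, fun x y => ?_⟩
    rw [h₁, PP.tmul_zero']
    by_cases hj' : j' = j + 1
    · rw [GX.incl_of_not k n _ fun h => hj ⟨h, hj'⟩, LinearMap.zero_apply, map_zero, smul_zero]
    · rw [GX.proj_incl_of_ne, smul_zero]
      simpa using Ne.symm hj'

/-- The differential of `G_{m+1} / G_m` is of the form `x ⊗ y ↦ x ⊗ g(y)`: the other component of
the differential of `G_{m+1}` maps to `G_m`. -/
lemma exists_quotient_d (p q : ℤ) :
    ∃ g : PDual k n (quotIdx m p) → PDual k n (quotIdx m q), ∀ x y,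
      ((G.quotient k n m).d p q).hom (toPP x y) = toPP x (g y) := by
  obtain h | h := quotIdx_eq_zero_or m p
  · refine ⟨fun _ => 0, fun x y => ?_⟩
    have : toPP x y = 0 := by
      generalize quotIdx m p = j at *
      subst h
      exact PP.eq_zero_of_index_zero k n _
    rw [this]
    exact (map_zero _).trans (PP.tmul_zero' k n x).symm
  · exact GX.exists_proj_d_incl k n m q _ h

end Filtration

/-! ### The bijection behind the comparison map -/

section Bijectivity

open CochainComplex mappingCone

variable (k : Type u) [Field k] (n m : ℕ)

/-- The component in `G_m` of the differential of `G_{m+1}` on a summand `P_{m+1,j}`. -/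
lemma map_d_incl {p q : ℤ} {j : ℕ} (h : IsIdx (m + 1) p (m + 1, j)) (x : P k n (m + 1))
    (y : PDual k n j) :
    GX.change k n (m + 1) m q (GX.d k n (m + 1) p q
        (GX.incl k n (m + 1) p (m + 1) j (PP.tmul x y))) =
      GX.incl k n m q m j (PP.tmul (rmulB k n m x) y) := by
  have h₁ : GX.change k n (m + 1) m q (GX.incl k n (m + 1) q (m + 1) (j + 1)
      (PP.tmul x (lmulB k n j y))) = 0 := by
    by_cases h' : IsIdx (m + 1) q (m + 1, j + 1)
    · rw [GX.change_incl k n _ h', GX.incl_of_not k n m (fun h' => by simp [IsIdx] at h')]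
      rfl
    · rw [GX.incl_of_not k n (m + 1) h', LinearMap.zero_apply, map_zero]
  rw [GX.d_incl_tmul k n _ _ h, map_add, map_zsmul, h₁, smul_zero, add_zero]
  by_cases h' : IsIdx (m + 1) q (m, j)
  · rw [GX.change_incl k n _ h']
  · rw [GX.incl_of_not k n (m + 1) h', GX.incl_of_not k n m (by rwa [← isIdx_succ_iff le_rfl]),
      LinearMap.zero_apply, LinearMap.zero_apply, map_zero]

/-- The inclusion of `G_m` in degree `q = p + 1` into `H_m` in degree `p`. -/
def H.inl {p q : ℤ} (h : p + 1 = q) :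
    GX k n m q →ₗ[Gam k n ⊗[k] (Gam k n)ᵐᵒᵖ] (H k n m).X p :=
  ((mappingCone.inl (G.ev k n m)).v q p (by omega)).hom

/-- The inclusion of `Γ_n` into `H_m` in degree `0`. -/
def H.inr : GamBi k n →ₗ[Gam k n ⊗[k] (Gam k n)ᵐᵒᵖ] (H k n m).X 0 :=
  ((HomologicalComplex.singleObjXSelf (.up ℤ) 0 (ModuleCat.of _ (GamBi k n))).inv ≫
    (mappingCone.inr (G.ev k n m)).f 0).hom

lemma H.inl_injective {p q : ℤ} (h : p + 1 = q) : Function.Injective (H.inl k n m h) := by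
  refine Function.LeftInverse.injective (g := ((fst (G.ev k n m)).1.v p q h).hom) fun t => ?_
  exact congrArg (fun f => f.hom t) (inl_v_fst_v (G.ev k n m) q p h)

lemma H.inr_injective : Function.Injective (H.inr k n m) := by
  refine Function.LeftInverse.injective (g := ((snd (G.ev k n m)).v 0 0 (add_zero 0) ≫
    (HomologicalComplex.singleObjXSelf (.up ℤ) 0 (ModuleCat.of _ (GamBi k n))).hom).hom)
    fun t => ?_
  have : ((HomologicalComplex.singleObjXSelf (.up ℤ) 0 (ModuleCat.of _ (GamBi k n))).inv ≫
    (mappingCone.inr (G.ev k n m)).f 0) ≫ ((snd (G.ev k n m)).v 0 0 (add_zero 0) ≫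
    (HomologicalComplex.singleObjXSelf (.up ℤ) 0 (ModuleCat.of _ (GamBi k n))).hom) = 𝟙 _ := by
    simp
  exact congrArg (fun f => f.hom t) this

lemma subsingleton_GX {p : ℤ} (h : ∀ i j, ¬ IsIdx m p (i, j)) : Subsingleton (GX k n m p) := by
  have : IsEmpty {s : ℕ × ℕ // IsIdx m p s} := ⟨fun s => h _ _ s.2⟩
  infer_instance

lemma isZero_G {p : ℤ} (h : ∀ i j, ¬ IsIdx m p (i, j)) : IsZero ((G k n m).X p) :=
  @ModuleCat.isZero_of_subsingleton _ _ _ (subsingleton_GX k n m h)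

lemma H.exists_inl {p q : ℤ} (h : p + 1 = q) (hp : p ≠ 0) (t : (H k n m).X p) :
    ∃ g, H.inl k n m h g = t := by
  have hz : (mappingCone.inr (G.ev k n m)).f p = 0 :=
    (HomologicalComplex.isZero_single_obj_X _ _ _ _ hp).eq_of_src _ _
  have := id_X (G.ev k n m) p q h
  rw [hz, comp_zero, add_zero] at this
  exact ⟨_, congrArg (fun f => f.hom t) this⟩

lemma H.exists_inr (t : (H k n m).X 0) : ∃ a, H.inr k n m a = t := by
  have hz : (mappingCone.inl (G.ev k n m)).v 1 0 (by omega) = 0 :=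
    (isZero_G k n m fun i j => by simp only [IsIdx]; omega).eq_of_src _ _
  have := id_X (G.ev k n m) 0 1 (by omega)
  rw [hz, comp_zero, zero_add] at this
  have h' : ((snd (G.ev k n m)).v 0 0 (add_zero 0) ≫
    (HomologicalComplex.singleObjXSelf (.up ℤ) 0 (ModuleCat.of _ (GamBi k n))).hom) ≫
      ((HomologicalComplex.singleObjXSelf (.up ℤ) 0 (ModuleCat.of _ (GamBi k n))).inv ≫
    (mappingCone.inr (G.ev k n m)).f 0) = 𝟙 _ := by
    rw [← this]
    simp
  exact ⟨_, congrArg (fun f => f.hom t) h'⟩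

/-- The complex `H_m` is concentrated in cohomological degrees `-m, …, 0`. -/
lemma isZero_H {p : ℤ} (hp : p ∉ Finset.Icc (-(m : ℤ)) 0) : IsZero ((H k n m).X p) := by
  have := subsingleton_GX k n m (p := p + 1) fun i j => by
    simp only [IsIdx, Finset.mem_Icc] at hp ⊢
    omega
  refine @ModuleCat.isZero_of_subsingleton _ _ _ ⟨fun s t => ?_⟩
  have hp' : p ≠ 0 := by
    rintro rfl
    simp at hp
  obtain ⟨s, rfl⟩ := H.exists_inl k n m rfl hp' s
  obtain ⟨t, rfl⟩ := H.exists_inl k n m rfl hp' t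
  rw [Subsingleton.elim s t]

/-- In negative degrees, `G_{m+1} / G_m → H_m` is given by `x ⊗ y ↦ - x β_{m+1} ⊗ y`. -/
lemma toH_f_of_neg {p q : ℤ} (hpq : p + 1 = q) (hp : p < 0)
    (h : IsIdx (m + 1) p (m + 1, quotIdx m p)) (x : P k n (m + 1)) (y : PDual k n (quotIdx m p)) :
    ((G.toH k n m).f p).hom (toPP x y) =
      -H.inl k n m hpq (GX.incl k n m q m (quotIdx m p) (PP.tmul (rmulB k n m x) y)) := by
  have hz : (mappingCone.inr (G.ev k n m)).f p = 0 :=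
    (HomologicalComplex.isZero_single_obj_X _ _ _ _ hp.ne).eq_of_src _ _
  rw [G.toH, DegreewiseSplitting.toCone_f _ _ p q hpq, hz, comp_zero, add_zero,
    ← map_d_incl k n m h]
  rfl

/-- In degree zero, `G_{m+1} / G_m → H_m` is given by `x ⊗ y ↦ y(x)`. -/
lemma toH_f_zero (t : ppBimod k n (m + 1) (quotIdx m 0)) :
    ((G.toH k n m).f 0).hom t =
      H.inr k n m (GX.ev k n (m + 1) (GX.incl k n (m + 1) 0 (m + 1) (quotIdx m 0) t)) := by
  have h₁ : (G.toH k n m).f 0 = ((G.splitting k n m).inclQ 0 ≫ (G.ev k n (m + 1)).f 0) ≫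
      (mappingCone.inr (G.ev k n m)).f 0 := by
    have hz : (mappingCone.inl (G.ev k n m)).v 1 0 (by omega) = 0 :=
      (isZero_G k n m fun i j => by simp only [IsIdx]; omega).eq_of_src _ _
    refine (DegreewiseSplitting.toCone_f _ _ 0 1 (by omega)).trans ?_
    rw [hz, comp_zero, neg_zero, zero_add]
  rw [h₁, G.ev_f_zero]
  rfl

/-- In degree zero, the bijectivity behind the comparison map is `P_{m+1}^∨ ≅ e_{m+1} Γ_n`,
`y ↦ y(e_{m+1})`. The index `j` is kept variable for the use with `quotIdx m 0`. -/
lemma ev_incl_eP {j : ℕ} (h : j = m + 1) :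
    (∀ y : PDual k n j, GX.ev k n (m + 1) (GX.incl k n (m + 1) 0 (m + 1) j
      (PP.tmul (eP k n (m + 1)) y)) = 0 → y = 0) ∧
    ∀ a : GamBi k n, ∃ y : PDual k n j, GX.ev k n (m + 1) (GX.incl k n (m + 1) 0 (m + 1) j
      (PP.tmul (eP k n (m + 1)) y)) = leftAct (M := gamBimod k n) (e k n (m + 1)) a := by
  subst h
  have hs : IsIdx (m + 1) 0 (m + 1, m + 1) := by simp [IsIdx]
  constructor
  · intro y hy
    rw [GX.ev_incl_tmul k n (m + 1) hs] at hy
    refine LinearMap.ext fun x => ?_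
    rw [← coe_smul_eP x, map_smul]
    exact (congrArg (fun t : Gam k n => (x : Gam k n) * t) hy).trans (mul_zero _)
  · intro a
    refine ⟨op (show Gam k n from a) • inclP k n (m + 1), ?_⟩
    rw [GX.ev_incl_tmul k n (m + 1) hs]
    exact (leftAct_toBi _ _).symm

/-- The map `y ↦ β_{m+1} ⊗ y` from `P_j^∨` to `P_{m,j}` is injective. -/
lemma eq_zero_of_tmul_eq_zero (h1 : 1 ≤ m) (h2 : m + 1 ≤ n) {j : ℕ} (y : PDual k n j)
    (h : PP.tmul (rmulB k n m (eP k n (m + 1))) y = 0) : y = 0 := by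
  -- `c` takes the coefficient of `β_{m+1}` in the first factor
  let c : P k n m ⊗[k] PDual k n j →ₗ[k] PDual k n j :=
    TensorProduct.lift ((LinearMap.lsmul k (PDual k n j)) ∘ₗ
      (coeffB k h1 h2 ∘ₗ (Submodule.subtype (P k n m)).restrictScalars k))
  have hc : c (rmulB k n m (eP k n (m + 1)) ⊗ₜ y) = y := by
    change coeffB k h1 h2 (e k n (m + 1) * b k n (m + 1)) • y = y
    rw [e_mul_b, coeffB_b, one_smul]
  rw [← hc]
  exact (congrArg c h).trans (map_zero c)

/-- The map `G_{m+1} / G_m → H_m` restricts to an injective map `P_j^∨ → e_{m+1} H_m`,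
`y ↦ e_{m+1} ⊗ y`, in every degree. -/
lemma toH_injective (hm : m + 1 ≤ n) (p : ℤ) (y : PDual k n (quotIdx m p))
    (hy : ((G.toH k n m).f p).hom (toPP (eP k n (m + 1)) y) = 0) : y = 0 := by
  obtain h | h := quotIdx_eq_zero_or m p
  · clear hy
    generalize quotIdx m p = j at *
    subst h
    exact eq_zero_of_index_zero k n
  · obtain hp | rfl : p < 0 ∨ p = 0 := by
      simp only [IsIdx] at h
      omega
    · have h' : IsIdx m (p + 1) (m, quotIdx m p) := by
        simp only [IsIdx] at h ⊢
        omega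
      have hy' := (toH_f_of_neg k n m rfl hp h _ _).symm.trans hy
      have hy'' := congrArg (GX.proj k n m (p + 1) m (quotIdx m p))
        (H.inl_injective k n m rfl ((neg_eq_zero.1 hy').trans (map_zero _).symm))
      rw [GX.proj_incl k n h', map_zero] at hy''
      exact eq_zero_of_tmul_eq_zero k n m (h'.1.trans h'.2.1) hm y hy''
    · refine (ev_incl_eP k n m ?_).1 y ?_
      · simp [quotIdx]
      · exact H.inr_injective k n m
          (((toH_f_zero k n m _).symm.trans hy).trans (map_zero _).symm)

/-- As `e_{m+1} Γ_n e_m = k β_{m+1}`, the elements of `e_{m+1} P_m` are multiples of `β_{m+1}`. -/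
lemma rmulB_smul (h1 : 1 ≤ m) (h2 : m + 1 ≤ n) (u : P k n m) :
    ∃ c : k, e k n (m + 1) • u = rmulB k n m (c • eP k n (m + 1)) := by
  obtain ⟨w, hw⟩ := Submodule.mem_span_singleton.1 u.2
  refine ⟨coeffB k h1 h2 w, Subtype.ext ?_⟩
  rw [coe_rmulB]
  change e k n (m + 1) * (u : Gam k n) = coeffB k h1 h2 w • e k n (m + 1) * b k n (m + 1)
  rw [← hw, smul_eq_mul, ← mul_assoc, e_mul_mul_e k h1 h2, smul_mul_assoc, e_mul_b]

lemma e_smul_eq_zero {i : ℕ} (hi : i < m) (u : P k n i) : e k n (m + 1) • u = 0 := by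
  obtain ⟨w, hw⟩ := Submodule.mem_span_singleton.1 u.2
  refine Subtype.ext ?_
  change e k n (m + 1) * (u : Gam k n) = 0
  rw [← hw, smul_eq_mul, ← mul_assoc, e_mul_mul_e_of_lt k hi]

/-- The part of `toH_surjective` that concerns `G_m`. On a summand `P_{i,j}` with `i < m` there is
nothing to hit, as `e_{m+1} P_i = 0`; on `P_{m,j}`, the elements `β_{m+1} ⊗ f` are hit. -/
lemma exists_toH_inl (hm : m + 1 ≤ n) {p q : ℤ} (hpq : p + 1 = q) (g : GX k n m q) :
    ∃ y, ((G.toH k n m).f p).hom (toPP (eP k n (m + 1)) y) =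
      leftAct (e k n (m + 1)) (H.inl k n m hpq g) := by
  have hzero : ∃ y, ((G.toH k n m).f p).hom (toPP (eP k n (m + 1)) y) = 0 :=
    ⟨0, (congrArg _ (PP.tmul_zero' k n _)).trans (map_zero _)⟩
  have hadd : ∀ s t : (H k n m).X p,
      (∃ y, ((G.toH k n m).f p).hom (toPP (eP k n (m + 1)) y) = s) →
      (∃ y, ((G.toH k n m).f p).hom (toPP (eP k n (m + 1)) y) = t) →
      ∃ y, ((G.toH k n m).f p).hom (toPP (eP k n (m + 1)) y) = s + t := by
    rintro _ _ ⟨y, rfl⟩ ⟨y', rfl⟩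
    exact ⟨y + y', (congrArg _ (toPP_add _ _ _)).trans (map_add _ _ _)⟩
  induction g using DirectSum.induction_on with
  | zero => rw [map_zero, leftAct, smul_zero]; exact hzero
  | add s t hs ht => rw [map_add, leftAct_add]; exact hadd _ _ hs ht
  | of s t =>
    obtain ⟨⟨i, j⟩, h⟩ := s
    have hincl : DirectSum.of (fun s : {s : ℕ × ℕ // IsIdx m q s} => PP k n s.1.1 s.1.2)
        ⟨(i, j), h⟩ t = GX.incl k n m q i j t := by
      rw [GX.incl, dif_pos h]
      rfl
    rw [hincl]
    clear hincl
    induction t using PP.induction with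
    | zero => rw [map_zero, map_zero, leftAct, smul_zero]; exact hzero
    | add s t hs ht => rw [map_add, map_add, leftAct_add]; exact hadd _ _ hs ht
    | tmul u f =>
      have h₁ : leftAct (e k n (m + 1)) (H.inl k n m hpq (GX.incl k n m q i j (PP.tmul u f))) =
          H.inl k n m hpq (GX.incl k n m q i j (PP.tmul (e k n (m + 1) • u) f)) := by
        rw [leftAct, ← map_smul, ← map_smul, PP.smul_tmul, one_smul]
      rw [h₁]
      by_cases hi : i < m
      · rw [e_smul_eq_zero k n m hi, PP.zero_tmul', map_zero, map_zero]
        exact hzero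
      · have him : i ≤ m := h.2.2.1
        obtain rfl : i = m := by omega
        have hp : IsIdx (i + 1) p (i + 1, j) := by
          simp only [IsIdx] at h ⊢
          omega
        have hp' : p < 0 := by
          simp only [IsIdx] at h
          omega
        obtain rfl := eq_quotIdx hp
        obtain ⟨c, hc⟩ := rmulB_smul k n i (h.1.trans h.2.1) hm u
        refine ⟨-(c • f), (toH_f_of_neg k n i hpq hp' hp _ _).trans ?_⟩
        have h₂ : PP.tmul (rmulB k n i (eP k n (i + 1))) (-(c • f)) =
            -PP.tmul (rmulB k n i (c • eP k n (i + 1))) f := by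
          have : rmulB k n i (c • eP k n (i + 1)) = c • rmulB k n i (eP k n (i + 1)) :=
            map_smul ((rmulB k n i).restrictScalars k) _ _
          rw [this]
          exact (TensorProduct.tmul_neg _ _).trans
            (congrArg _ (TensorProduct.smul_tmul _ _ _).symm)
        rw [h₂, hc, map_neg, map_neg, neg_neg]

/-- The map `P_j^∨ → e_{m+1} H_m`, `y ↦ e_{m+1} ⊗ y`, given by `G_{m+1} / G_m → H_m` is surjective
in every degree. -/
lemma toH_surjective (hm : m + 1 ≤ n) (p : ℤ) (h : (H k n m).X p) :
    ∃ y, ((G.toH k n m).f p).hom (toPP (eP k n (m + 1)) y) =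
      leftAct (e k n (m + 1)) h := by
  by_cases hp : p = 0
  · subst hp
    obtain ⟨a, rfl⟩ := H.exists_inr k n m h
    obtain ⟨y, hy⟩ := (ev_incl_eP k n m (j := quotIdx m 0) (by simp [quotIdx])).2 a
    refine ⟨y, (toH_f_zero k n m _).trans ?_⟩
    rw [hy]
    exact (H.inr k n m).map_smul _ _
  · obtain ⟨g, rfl⟩ := H.exists_inl k n m rfl hp h
    exact exists_toH_inl k n m hm rfl g

end Bijectivity

section Finiteness

variable (k : Type u) [Field k] (n : ℕ)

/-- By `y ↦ y(e_j)`, the dual `P_j^∨` embeds into `Γ_n`. -/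
instance (j : ℕ) : Module.Finite k (PDual k n j) := by
  let f : PDual k n j →ₗ[k] Gam k n :=
    { toFun := fun y => y (eP k n j)
      map_add' := fun _ _ => rfl
      map_smul' := fun _ _ => rfl }
  refine Module.Finite.of_injective f fun y y' h => LinearMap.ext fun x => ?_
  rw [← coe_smul_eP x, map_smul, map_smul]
  exact congrArg _ h

lemma zero_leftAct {k A : Type u} [Field k] [Ring A] [Algebra k A] {M : Bimod k A} (m : M) :
    leftAct (0 : A) m = 0 := by
  rw [leftAct, TensorProduct.zero_tmul]
  exact zero_smul (A ⊗[k] Aᵐᵒᵖ) m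

/-- `P_{i,j} ⊗ N` is finitely generated if `N` is. -/
lemma finite_ppTensor (i j : ℕ) (N : ModuleCat.{u} (Gam k n)) [Module.Finite (Gam k n) N] :
    Module.Finite (Gam k n) (tensorObj (ppBimod k n i j) N) := by
  classical
  obtain ⟨s, hs⟩ := Module.Finite.fg_top (R := k) (M := PDual k n j)
  refine finite_tensorObj _ _ (s.image (toPP (eP k n i))) fun t => ?_
  have hadd : ∀ t t' : ppBimod k n i j,
      (∃ c : ppBimod k n i j → Gam k n, t = ∑ r ∈ s.image (toPP (eP k n i)), leftAct (c r) r) →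
      (∃ c : ppBimod k n i j → Gam k n, t' = ∑ r ∈ s.image (toPP (eP k n i)), leftAct (c r) r) →
      ∃ c : ppBimod k n i j → Gam k n,
        t + t' = ∑ r ∈ s.image (toPP (eP k n i)), leftAct (c r) r := by
    rintro t t' ⟨c, rfl⟩ ⟨c', rfl⟩
    exact ⟨c + c', by rw [← Finset.sum_add_distrib]; simp only [Pi.add_apply, add_leftAct]⟩
  have hzero : ∃ c : ppBimod k n i j → Gam k n,
      (0 : ppBimod k n i j) = ∑ r ∈ s.image (toPP (eP k n i)), leftAct (c r) r :=
    ⟨0, (Finset.sum_eq_zero fun r _ => zero_leftAct r).symm⟩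
  induction t using PP.induction with
  | zero => exact hzero
  | add t t' ht ht' => exact hadd t t' ht ht'
  | tmul p f =>
    have hf : f ∈ Submodule.span k (s : Set (PDual k n j)) := hs ▸ Submodule.mem_top
    induction hf using Submodule.span_induction generalizing p with
    | zero => rw [PP.tmul_zero']; exact hzero
    | add f f' _ _ h h' =>
      have : PP.tmul p (f + f') = PP.tmul p f + PP.tmul p f' := TensorProduct.tmul_add p f f'
      rw [this]
      exact hadd _ _ (h p) (h' p)
    | smul c f _ h =>
      have : PP.tmul p (c • f) = PP.tmul (c • p) f := (toPP_smul_left c p f).symm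
      rw [this]
      exact h _
    | mem f hf =>
      refine ⟨fun r => if r = toPP (eP k n i) f then (p : Gam k n) else 0, ?_⟩
      rw [Finset.sum_eq_single (toPP (eP k n i) f)]
      · dsimp only
        rw [if_pos rfl, leftAct_toPP, coe_smul_eP]
      · intro r _ hr
        dsimp only
        rw [if_neg hr, zero_leftAct]
      · intro h
        exact absurd (Finset.mem_image_of_mem _ hf) h

end Finiteness

/-! ### Functors on the bounded derived category -/

section ConeQuasiIso

open CochainComplex

/-- A morphism of cones induced by two quasi-isomorphisms is a quasi-isomorphism. -/
lemma quasiIso_mappingCone_map {C : Type*} [Category* C] [Abelian C]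
    {K₁ L₁ K₂ L₂ : CochainComplex C ℤ} (φ₁ : K₁ ⟶ L₁) (φ₂ : K₂ ⟶ L₂) (f : K₁ ⟶ K₂) (g : L₁ ⟶ L₂)
    (h : φ₁ ≫ g = f ≫ φ₂) (hf : QuasiIso f) (hg : QuasiIso g) :
    QuasiIso (mappingCone.map φ₁ φ₂ f g h) := by
  let := HasDerivedCategory.standard C
  rw [← DerivedCategory.isIso_Q_map_iff_quasiIso] at hf hg ⊢
  exact Pretriangulated.isIso₃_of_isIso₁₂
    (DerivedCategory.Q.mapTriangle.map (mappingCone.triangleMap φ₁ φ₂ f g h))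
    (DerivedCategory.mappingCone_triangle_distinguished φ₁)
    (DerivedCategory.mappingCone_triangle_distinguished φ₂) hf hg

end ConeQuasiIso

section Preserves

variable {A : Type u} [Ring A]

/-- A functor on complexes of modules that preserves bounded complexes of finitely generated modules
and quasi-isomorphisms. -/
structure PreservesDb
    (S : CochainComplex (ModuleCat.{u} A) ℤ ⥤ CochainComplex (ModuleCat.{u} A) ℤ) : Prop where
  bounded (Y : CochainComplex (ModuleCat.{u} A) ℤ) : isBoundedFG A Y → isBoundedFG A (S.obj Y)
  qis {Y Z : CochainComplex (ModuleCat.{u} A) ℤ} (f : Y ⟶ Z) : QuasiIso f → QuasiIso (S.map f)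

lemma isBoundedFG_of_iso {Y Z : CochainComplex (ModuleCat.{u} A) ℤ} (α : Y ≅ Z)
    (h : isBoundedFG A Y) : isBoundedFG A Z := by
  obtain ⟨⟨p, q, hp, hq⟩, hf⟩ := h
  refine ⟨⟨p, q, ?_, ?_⟩, fun i => ?_⟩
  · rw [CochainComplex.isStrictlyGE_iff] at hp ⊢
    exact fun i hi => (hp i hi).of_iso ((HomologicalComplex.eval _ _ i).mapIso α.symm)
  · rw [CochainComplex.isStrictlyLE_iff] at hq ⊢
    exact fun i hi => (hq i hi).of_iso ((HomologicalComplex.eval _ _ i).mapIso α.symm)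
  · have : Module.Finite A ((HomologicalComplex.eval (ModuleCat.{u} A) (.up ℤ) i).obj Y) := hf i
    exact Module.Finite.equiv ((HomologicalComplex.eval _ _ i).mapIso α).toLinearEquiv

lemma isBoundedFG_mappingCone {Y Z : CochainComplex (ModuleCat.{u} A) ℤ} (φ : Y ⟶ Z)
    (hY : isBoundedFG A Y) (hZ : isBoundedFG A Z) :
    isBoundedFG A (CochainComplex.mappingCone φ) := by
  obtain ⟨⟨p, q, hp, hq⟩, hf⟩ := hY
  obtain ⟨⟨p', q', hp', hq'⟩, hf'⟩ := hZ
  rw [CochainComplex.isStrictlyGE_iff] at hp hp'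
  rw [CochainComplex.isStrictlyLE_iff] at hq hq'
  refine ⟨⟨min (p - 1) p', max (q - 1) q', ?_, ?_⟩, fun i => ?_⟩
  · rw [CochainComplex.isStrictlyGE_iff]
    intro i hi
    rw [CochainComplex.mappingCone.isZero_X_iff]
    rw [lt_min_iff] at hi
    exact ⟨hp _ (by omega), hp' _ hi.2⟩
  · rw [CochainComplex.isStrictlyLE_iff]
    intro i hi
    rw [CochainComplex.mappingCone.isZero_X_iff]
    rw [max_lt_iff] at hi
    exact ⟨hq _ (by omega), hq' _ hi.2⟩
  · have := hf (i + 1)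
    have := hf' i
    let l : (Y.X (i + 1) × Z.X i) →ₗ[A] (CochainComplex.mappingCone φ).X i :=
      LinearMap.coprod ((CochainComplex.mappingCone.inl φ).v (i + 1) i (by omega)).hom
        ((CochainComplex.mappingCone.inr φ).f i).hom
    refine Module.Finite.of_surjective l fun t => ?_
    exact ⟨(_, _), congrArg (fun f => f.hom t) (CochainComplex.mappingCone.id_X φ i (i + 1) rfl)⟩

variable {S S' : CochainComplex (ModuleCat.{u} A) ℤ ⥤ CochainComplex (ModuleCat.{u} A) ℤ}

lemma PreservesDb.of_iso (h : PreservesDb S) (α : S ≅ S') : PreservesDb S' where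
  bounded Y hY := isBoundedFG_of_iso (α.app Y) (h.bounded Y hY)
  qis f hf := by
    have := h.qis f hf
    rw [← NatIso.naturality_1 α f]
    infer_instance

lemma PreservesDb.comp (h : PreservesDb S) (h' : PreservesDb S') : PreservesDb (S ⋙ S') where
  bounded Y hY := h'.bounded _ (h.bounded Y hY)
  qis f hf := h'.qis _ (h.qis f hf)

lemma PreservesDb.id : PreservesDb (𝟭 (CochainComplex (ModuleCat.{u} A) ℤ)) where
  bounded _ hY := hY
  qis _ hf := hf

lemma PreservesDb.coneFunctor (h : PreservesDb S) (h' : PreservesDb S') (τ : S ⟶ S') :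
    PreservesDb (SphericalTwist.coneFunctor τ) where
  bounded Y hY := isBoundedFG_mappingCone _ (h.bounded Y hY) (h'.bounded Y hY)
  qis f hf := quasiIso_mappingCone_map _ _ _ _ (τ.naturality f).symm (h.qis f hf) (h'.qis f hf)

/-- An exact functor that preserves finitely generated modules, applied degreewise. -/
lemma PreservesDb.mapHomologicalComplex (Ψ : ModuleCat.{u} A ⥤ ModuleCat.{u} A) [Ψ.Additive]
    [Ψ.PreservesHomology]
    (hΨ : ∀ N : ModuleCat.{u} A, Module.Finite A N → Module.Finite A (Ψ.obj N)) :
    PreservesDb (Ψ.mapHomologicalComplex (.up ℤ)) where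
  bounded Y hY := by
    obtain ⟨⟨p, q, hp, hq⟩, hf⟩ := hY
    rw [CochainComplex.isStrictlyGE_iff] at hp
    rw [CochainComplex.isStrictlyLE_iff] at hq
    refine ⟨⟨p, q, ?_, ?_⟩, fun i => hΨ _ (hf i)⟩
    · rw [CochainComplex.isStrictlyGE_iff]
      exact fun i hi => Ψ.map_isZero (hp i hi)
    · rw [CochainComplex.isStrictlyLE_iff]
      exact fun i hi => Ψ.map_isZero (hq i hi)
  qis f _ := HomologicalComplex.quasiIso_map_of_preservesHomology f Ψ

variable {k : Type u} [Field k] [Algebra k A]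

lemma PreservesDb.induces {X : CochainComplex (Bimod k A) ℤ} (h : PreservesDb (tensorComplex X)) :
    Induces X :=
  ⟨h.bounded, fun f hf => h.qis f.hom hf⟩

/-- An isomorphism of functors on complexes induces an isomorphism of functors on `D^b(A)`. -/
def tensorDbCompIso {X Y Z : CochainComplex (Bimod k A) ℤ} (hX : Induces X) (hY : Induces Y)
    (hZ : Induces Z) (α : tensorComplex Z ≅ tensorComplex X ⋙ tensorComplex Y) :
    tensorDb X hX ⋙ tensorDb Y hY ≅ tensorDb Z hZ :=
  letI β : tensorChb X hX ⋙ tensorChb Y hY ≅ tensorChb Z hZ :=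
    NatIso.ofComponents (fun V => (isBoundedFG A).isoMk (α.symm.app V.obj)) fun f =>
      (isBoundedFG A).ι.map_injective (α.inv.naturality f.hom)
  letI := Localization.Lifting.mk (L := (qisChb A).Q) (W := qisChb A)
    (F := (tensorChb X hX ⋙ tensorChb Y hY) ⋙ (qisChb A).Q)
    (F' := tensorDb X hX ⋙ tensorDb Y hY)
    (Functor.isoWhiskerRight (Localization.fac (tensorChb X hX ⋙ (qisChb A).Q)
        (tensorChb_inverts X hX) (qisChb A).Q) (tensorDb Y hY) ≪≫
      Functor.isoWhiskerLeft (tensorChb X hX) (Localization.fac (tensorChb Y hY ⋙ (qisChb A).Q)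
        (tensorChb_inverts Y hY) (qisChb A).Q))
  letI := Localization.Lifting.mk (L := (qisChb A).Q) (W := qisChb A)
    (F := tensorChb Z hZ ⋙ (qisChb A).Q) (F' := tensorDb Z hZ)
    (Localization.fac _ (tensorChb_inverts Z hZ) (qisChb A).Q)
  Localization.liftNatIso (qisChb A).Q (qisChb A)
    ((tensorChb X hX ⋙ tensorChb Y hY) ⋙ (qisChb A).Q)
    (tensorChb Z hZ ⋙ (qisChb A).Q) _ _ (Functor.isoWhiskerRight β (qisChb A).Q)

/-- If `Z ⊗ -` is isomorphic to the identity on complexes, then so it is on `D^b(A)`. -/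
def tensorDbIdIso {Z : CochainComplex (Bimod k A) ℤ} (hZ : Induces Z) (α : tensorComplex Z ≅ 𝟭 _) :
    𝟭 (Db A) ≅ tensorDb Z hZ :=
  letI β : 𝟭 (Chb A) ≅ tensorChb Z hZ :=
    NatIso.ofComponents (fun V => (isBoundedFG A).isoMk (α.symm.app V.obj)) fun f =>
      (isBoundedFG A).ι.map_injective (α.inv.naturality f.hom)
  letI := Localization.Lifting.mk (L := (qisChb A).Q) (W := qisChb A)
    (F := 𝟭 (Chb A) ⋙ (qisChb A).Q) (F' := 𝟭 (Db A)) (Iso.refl _)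
  letI := Localization.Lifting.mk (L := (qisChb A).Q) (W := qisChb A)
    (F := tensorChb Z hZ ⋙ (qisChb A).Q) (F' := tensorDb Z hZ)
    (Localization.fac _ (tensorChb_inverts Z hZ) (qisChb A).Q)
  Localization.liftNatIso (qisChb A).Q (qisChb A) (𝟭 (Chb A) ⋙ (qisChb A).Q)
    (tensorChb Z hZ ⋙ (qisChb A).Q) _ _ (Functor.isoWhiskerRight β (qisChb A).Q)

end Preserves

/-! ### Compositions of twists -/

section Main

open CochainComplex

variable (k : Type u) [Field k] (n : ℕ)

/-- The functor `M ⊗_A -` on complexes, for a bimodule `M`. -/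
abbrev tensorDegreewise (M : Bimod k (Gam k n)) :
    CochainComplex (ModuleCat.{u} (Gam k n)) ℤ ⥤ CochainComplex (ModuleCat.{u} (Gam k n)) ℤ :=
  ((tensorBifunctor k (Gam k n)).obj M).mapHomologicalComplex (.up ℤ)

/-- Tensoring a complex with `Γ_n` changes nothing. -/
def unitComplexIso : tensorDegreewise k n (gamBimod k n) ≅ 𝟭 _ :=
  NatIso.mapHomologicalComplex unitNatIso (.up ℤ) ≪≫ Functor.mapHomologicalComplexIdIso _ _

/-- The natural map `P_{i,i} ⊗ Y → Γ_n ⊗ Y` induced by evaluation. -/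
def evNat (i : ℕ) :
    tensorDegreewise k n (ppBimod k n i i) ⟶ tensorDegreewise k n (gamBimod k n) :=
  NatTrans.mapHomologicalComplex ((tensorBifunctor k (Gam k n)).map (evHom k n i)) (.up ℤ)

/-- The functor `X_i ⊗ -` is the cone of `P_{i,i} ⊗ - → Γ_n ⊗ -`. -/
def tensorXIso (i : ℕ) : coneFunctor (evNat k n i) ≅ tensorComplex (X k n i) :=
  coneFunctorIso (evNat k n i)
    ((tensorBifunctor k (Gam k n)).map₂CochainComplex.map
      ((HomologicalComplex.single _ (.up ℤ) 0).map (evHom k n i)))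
    (singleTotFunctorIso _) (singleTotFunctorIso _) (singleTotFunctorIso_naturality _) ≪≫
    totConeFunctorIso _

lemma preservesDb_tensorX (i : ℕ) : PreservesDb (tensorComplex (X k n i)) :=
  ((PreservesDb.mapHomologicalComplex _ fun N _ => finite_ppTensor k n i i N).coneFunctor
    (PreservesDb.id.of_iso (unitComplexIso k n).symm) (evNat k n i)).of_iso (tensorXIso k n i)

/-- Since `G_0 = 0`, the complex `H_0` is `Γ_n`. -/
instance isIso_inr_ev_zero : IsIso (mappingCone.inr (G.ev k n 0)) := by
  have (p : ℤ) : IsIso ((mappingCone.inr (G.ev k n 0)).f p) := by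
    refine ⟨(mappingCone.snd (G.ev k n 0)).v p p (add_zero p), by simp, ?_⟩
    have hz : (mappingCone.inl (G.ev k n 0)).v (p + 1) p (by omega) = 0 :=
      (isZero_G k n 0 fun i j => by simp only [IsIdx]; omega).eq_of_src _ _
    rw [← mappingCone.id_X _ p (p + 1) rfl, hz, comp_zero, zero_add]
  exact HomologicalComplex.Hom.isIso_of_components _

/-- The functor `H_0 ⊗ -` is the identity. -/
def tensorHZeroIso : tensorComplex (H k n 0) ≅ 𝟭 _ :=
  (tensorBifunctor k (Gam k n)).map₂CochainComplex.mapIso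
      (asIso (mappingCone.inr (G.ev k n 0))).symm ≪≫
    (singleTotFunctorIso (gamBimod k n)).symm ≪≫ unitComplexIso k n

variable {n} in
/-- The functor `(G_{m+1} / G_m) ⊗ -` is isomorphic to `P_{m+1,m+1} ⊗ (H_m ⊗ -)`. -/
def tensorQuotientIso {m : ℕ} (hm : m + 1 ≤ n) :
    tensorComplex (G.quotient k n m) ≅
      tensorComplex (H k n m) ⋙ tensorDegreewise k n (ppBimod k n (m + 1) (m + 1)) :=
  totCompFunctorIso ((tensorBifunctor k (Gam k n)).obj (ppBimod k n (m + 1) (m + 1)))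
    (fun p N => adjIsoOfBijective ((G.toH k n m).f p) (toH_injective k n m hm p)
      (toH_surjective k n m hm p) N)
    (fun p q N _ => by
      obtain ⟨g, hg⟩ := exists_quotient_d k n m p q
      exact adjHom_comm ((G.toH k n m).f p) ((G.toH k n m).f q) ((G.quotient k n m).d p q) g hg
        ((H k n m).d p q) ((G.toH k n m).comm p q) N)
    (fun p _ _ g => adjHom_naturality ((G.toH k n m).f p) g)
    (Finset.Icc (-(m : ℤ)) 0) fun _ hp => isZero_H k n m hp

variable {n} in
/-- Under `tensorQuotientIso` and `H_m ⊗ - ≅ Γ_n ⊗ (H_m ⊗ -)`, the map `G_{m+1} / G_m → H_m` becomes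
the evaluation `P_{m+1,m+1} ⊗ (H_m ⊗ -) → Γ_n ⊗ (H_m ⊗ -)`. -/
lemma tensorQuotientIso_comp {m : ℕ} (hm : m + 1 ≤ n) :
    (tensorBifunctor k (Gam k n)).map₂CochainComplex.map (G.toH k n m) ≫
        Functor.whiskerLeft (tensorComplex (H k n m)) (unitComplexIso k n).inv =
      (tensorQuotientIso k hm).hom ≫
        Functor.whiskerLeft (tensorComplex (H k n m)) (evNat k n (m + 1)) := by
  refine totCompFunctorIso_hom_comp (G.toH k n m) _ _ _ _ _ _ _
    ((tensorBifunctor k (Gam k n)).map (evHom k n (m + 1))) unitNatIso.inv fun p N => ?_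
  have h := adjHom_ev ((G.toH k n m).f p) N
  rw [← Category.assoc] at h
  exact (Iso.eq_comp_inv _).2 h

variable {n} in
/-- The functor `H_{m+1} ⊗ -` is isomorphic to `X_{m+1} ⊗ (H_m ⊗ -)`. -/
def tensorHSuccIso {m : ℕ} (hm : m + 1 ≤ n) :
    tensorComplex (H k n (m + 1)) ≅ tensorComplex (H k n m) ⋙ tensorComplex (X k n (m + 1)) :=
  (tensorBifunctor k (Gam k n)).map₂CochainComplex.mapIso (coneToHIso k n m).symm ≪≫
    (totConeFunctorIso (G.toH k n m)).symm ≪≫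
    coneFunctorIso _ (Functor.whiskerLeft (tensorComplex (H k n m)) (evNat k n (m + 1)))
      (tensorQuotientIso k hm)
      (Functor.isoWhiskerLeft (tensorComplex (H k n m)) (unitComplexIso k n).symm)
      (tensorQuotientIso_comp k hm) ≪≫
    Functor.isoWhiskerLeft (tensorComplex (H k n m)) (tensorXIso k n (m + 1))

lemma preservesDb_tensorH (m : ℕ) (hm : m ≤ n) : PreservesDb (tensorComplex (H k n m)) := by
  induction m with
  | zero => exact PreservesDb.id.of_iso (tensorHZeroIso k n).symm
  | succ m ih =>
    exact ((ih (by omega)).comp (preservesDb_tensorX k n (m + 1))).of_iso (tensorHSuccIso k hm).symm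

variable {n} in
/-- The composition of the first `m` twists is `H_m ⊗ -`. -/
lemma nonempty_composedTwists_iso (hF : ∀ i, 1 ≤ i → i ≤ n → Induces (X k n i)) (m : ℕ)
    (hm : m ≤ n) (hH : Induces (H k n m)) :
    Nonempty (composedTwists hF m hm ≅ tensorDb (H k n m) hH) := by
  induction m with
  | zero => exact ⟨tensorDbIdIso hH (tensorHZeroIso k n)⟩
  | succ m ih =>
    have hH' : Induces (H k n m) := (preservesDb_tensorH k n m (by omega)).induces
    obtain ⟨α⟩ := ih (by omega) hH'
    exact ⟨Functor.isoWhiskerRight α _ ≪≫ tensorDbCompIso hH' _ hH (tensorHSuccIso k hm)⟩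

end Main

end SphericalTwist

end

theorem mainTheorem7 (k : Type u) [Field k] [IsAlgClosed k] (n m : ℕ) (hm : 1 ≤ m) (hmn : m ≤ n) :
    ∃ (hF : ∀ i, 1 ≤ i → i ≤ n → SphericalTwist.Induces (SphericalTwist.X k n i))
      (hH : SphericalTwist.Induces (SphericalTwist.H k n m)),
      Nonempty (SphericalTwist.composedTwists hF m hmn ≅
        SphericalTwist.tensorDb (SphericalTwist.H k n m) hH) :=
  ⟨fun i _ _ => (SphericalTwist.preservesDb_tensorX k n i).induces,
    (SphericalTwist.preservesDb_tensorH k n m hmn).induces,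
    SphericalTwist.nonempty_composedTwists_iso k _ m hmn _⟩
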